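/- Let $T=T[1..n]$ be a text over an integer alphabet (symbols are natural numbers), terminated by an end-marker $T[n]=\$$ that is smaller than all other symbols of $T$ and occurs only at the end. Let $\mathrm{CDAWG}(T)$ be the edge-labeled DAG obtained from the suffix tree of $T$ (the compacted trie of all non-empty suffixes of $T$) by merging isomorphic subtrees, and let $e=e_R+e_L$ be its size, where $e_R$ is the number of its edges and $e_L$ the number of its suffix links (one for every node except the root). Let $\mathrm{BWT}$ be the Burrows–Wheeler transform of $T$ ($\mathrm{BWT}[k]$ is the symbol cyclically preceding the lexicographically $k$-th suffix) and let $\mathrm{RLBWT}$ be its run-length encoding by $r$ maximal runs $(c,\ell)$. An edge $f=(v,X,w)$ is $(-)$-primary if the longest string spelled by a root-to-$w$ path goes through $f$, and $(-)$-secondary otherwise. For a $(-)$-secondary edge $f=(v,X,w)$ let $\mathrm{cano}(f)=U\,X\,D$ be the suffix of $T$ in which $U$ is the longest string of a root-to-$v$ path and $D$ the lexicographically first string of a $w$-to-sink path, let $\mathrm{precsym}(f)$ be the symbol of $T$ immediately preceding this suffix, and let $\mathrm{nleaves}(w)$ be the number of $w$-to-sink paths. The recursive procedure $\mathrm{RecRBWT}(v)$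 returns $(\$,1)$ if $v$ has no outgoing edge; otherwise it goes through the outgoing edges $f=(v,X,w)$ of $v$ in the order of the first symbols of their labels and returns the concatenation (merging adjacent runs of equal symbols) of the results of the recursive calls $\mathrm{RecRBWT}(w)$, for $(-)$-primary $f$, and of the single runs $(\mathrm{precsym}(f),\mathrm{nleaves}(w))$, for $(-)$-secondary $f$. The self-index version of $\mathrm{CDAWG}(T)$ is the following sequence of words, which gives no access to the text: under an arbitrary numbering of the nodes, the numbers of nodes and edges, the root and the sink; for every node its suffix link and the positions and lengths of its lists of outgoing and incoming edges, the former sorted by the first symbols of the labels, the latter by decreasing length of the longest root path through the edge; for every edge its source, its target, and the length and the first symbol of its label. Then $r\le e$; the call $\mathrm{RecRBWT}(\mathrm{root})$ terminates, handles every edge of $\mathrm{CDAWG}(T)$ exactly once (thus emitting exactly one equal-letter run per $(-)$-secondary edge), and returns $\mathrm{RLBWT}$. Moreover, there are a word-RAM program $P$ and a constant $C$, independent of $T$ and of the numbering, such that the following holds whenever all symbols of $T$ are at most $\sigma$: the self-index version of $\mathrm{CDAWG}(T)$ consists of at most $C e$ words, and with it as its read-only input, $P$ outputs $\mathrm{RLBWT}$,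 handling the edges in the order in which $\mathrm{RecRBWT}$ does, in at most $C e$ steps in the worst case, using at most $C e$ words of working memory (besides a constant number of registers), all words being smaller than $C(n+\sigma+1)$. -/

import Mathlib

/-! ### Texts, suffixes, the Burrows-Wheeler transform -/

/-- A text over an integer alphabet: a string of natural numbers terminated by an end-marker
that is smaller than every other symbol of the text and occurs only at the end. -/
def IsText (T : List ℕ) : Prop :=
  ∃ (w : List ℕ) (d : ℕ), T = w ++ [d] ∧ ∀ a ∈ w, d < a

/-- The set of all non-empty suffixes of `T`. -/
def Suf (T : List ℕ) : Set (List ℕ) := {X | X ≠ [] ∧ X <:+ T}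

/-- The suffix array, with 0-based positions: the positions `0, …, n - 1` sorted by the
lexicographic order of the suffixes starting there. -/
def suffixArray (T : List ℕ) : List ℕ :=
  (List.range T.length).mergeSort (fun p q => decide (T.drop p ≤ T.drop q))

/-- The Burrows-Wheeler transform: the symbols that cyclically precede the sorted suffixes. -/
def bwt (T : List ℕ) : List ℕ :=
  (suffixArray T).map
    (fun p => if p = 0 then T.getD (T.length - 1) 0 else T.getD (p - 1) 0)

/-- Run-length encoding by maximal equal-letter runs `(symbol, length)`. -/
def runLength : List ℕ → List (ℕ × ℕ)
  | [] => []
  | a :: l =>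
    match runLength l with
    | [] => [(a, 1)]
    | (b, k) :: R => if a = b then (b, k + 1) :: R else (a, 1) :: (b, k) :: R

/-- The run-length BWT of `T`; its length is the parameter `r`. -/
def rlbwt (T : List ℕ) : List (ℕ × ℕ) := runLength (bwt T)

/-- Concatenation of two run-length encoded strings: the last run of the first one and the
first run of the second one are merged when they carry the same symbol. -/
def rlConcat (A R : List (ℕ × ℕ)) : List (ℕ × ℕ) :=
  match A.getLast?, R with
  | some (c, k), (d, m) :: R' => if c = d then A.dropLast ++ (c, k + m) :: R' else A ++ R
  | _, _ => A ++ R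

/-! ### The suffix tree and the CDAWG -/

/-- A node of the suffix tree (the compacted trie of all suffixes), identified with the string
spelled from the root to it: the root, a leaf, or a branching factor. -/
def IsTreeNode (T X : List ℕ) : Prop :=
  X = [] ∨ X ∈ Suf T ∨ ∃ a b : ℕ, a ≠ b ∧ X ++ [a] <:+: T ∧ X ++ [b] <:+: T

/-- The suffix tree has an edge labeled `X` from the node `U` down to the node `U ++ X`. -/
def IsTreeEdge (T U X : List ℕ) : Prop :=
  X ≠ [] ∧ IsTreeNode T U ∧ IsTreeNode T (U ++ X) ∧
    ∀ Y, Y <+: X → Y ≠ [] → Y ≠ X → ¬ IsTreeNode T (U ++ Y)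

/-- The subtree of the suffix tree below the node `X`, given by the set of the strings that lead
from `X` to its descendants. Two subtrees are isomorphic as edge-labeled compacted tries if and
only if these sets are equal. -/
def subtree (T X : List ℕ) : Set (List ℕ) := {Z | IsTreeNode T (X ++ Z)}

/-- A node of the CDAWG is what isomorphic subtrees of the suffix tree are merged into. -/
abbrev Node := Set (List ℕ)

/-- A labeled edge of the CDAWG. -/
structure CEdge where
  src : Node
  lab : List ℕ
  dst : Node

/-- The nodes of `CDAWG(T)`. -/
def cdawgNodes (T : List ℕ) : Set Node := {v | ∃ X, IsTreeNode T X ∧ v = subtree T X}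

/-- The edges of `CDAWG(T)`. -/
def cdawgEdges (T : List ℕ) : Set CEdge :=
  {f | ∃ U X, IsTreeEdge T U X ∧ f = ⟨subtree T U, X, subtree T (U ++ X)⟩}

def cdawgRoot (T : List ℕ) : Node := subtree T []

def cdawgSink (T : List ℕ) : Node := subtree T T

/-- The suffix links of `CDAWG(T)`: the suffix links `aY ↦ Y` of the suffix tree, as far as
they connect nodes that have not been merged. There is one for each node but the root. -/
def suffixLinks (T : List ℕ) : Set (Node × Node) :=
  {p | ∃ (a : ℕ) (Y : List ℕ), IsTreeNode T (a :: Y) ∧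
    p = (subtree T (a :: Y), subtree T Y) ∧ p.1 ≠ p.2}

/-- The size `e = e_R + e_L` of `CDAWG(T)`: the number of edges plus the number of suffix
links. -/
noncomputable def cdawgSize (T : List ℕ) : ℕ := (cdawgEdges T).ncard + (suffixLinks T).ncard

/-- `IsPath T v π w`: `π` is a path of `CDAWG(T)` from `v` to `w`. -/
inductive IsPath (T : List ℕ) : Node → List CEdge → Node → Prop
  | nil (v : Node) : IsPath T v [] v
  | cons {f : CEdge} {π : List CEdge} {w : Node} (hf : f ∈ cdawgEdges T)
      (h : IsPath T f.dst π w) : IsPath T f.src (f :: π) w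

/-- The string spelled by a path. -/
def pathStr (π : List CEdge) : List ℕ := π.flatMap CEdge.lab

/-- The upper set `U₋(v)`: the strings of all root-to-`v` paths. -/
def upper (T : List ℕ) (v : Node) : Set (List ℕ) :=
  {U | ∃ π, IsPath T (cdawgRoot T) π v ∧ U = pathStr π}

/-- The lower set `U₊(v)`: the strings of all `v`-to-sink paths. -/
def lower (T : List ℕ) (v : Node) : Set (List ℕ) :=
  {D | ∃ π, IsPath T v π (cdawgSink T) ∧ D = pathStr π}

/-- `U` is the `(-)`-representative of `v`: the longest upper string, that is, the first one in
the text order. -/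
def IsReprUp (T : List ℕ) (v : Node) (U : List ℕ) : Prop :=
  U ∈ upper T v ∧ ∀ U' ∈ upper T v, U'.length ≤ U.length

/-- `D` is the `(+)`-representative of `v`: the lexicographically first lower string. -/
def IsReprDown (T : List ℕ) (v : Node) (D : List ℕ) : Prop :=
  D ∈ lower T v ∧ ∀ D' ∈ lower T v, D ≤ D'

/-- The length of the `(-)`-representative of `v`. -/
noncomputable def reprUpLen (T : List ℕ) (v : Node) : ℕ := sSup (List.length '' upper T v)

/-- The first symbol of the label of an edge (labels are non-empty). -/
def firstSym (f : CEdge) : ℕ := f.lab.headD 0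

/-- The edge `f` is `(-)`-primary: the `(-)`-representative of the end node of `f` goes
through `f`. -/
def IsPrimaryUp (T : List ℕ) (f : CEdge) : Prop :=
  ∃ π, IsPath T (cdawgRoot T) (π ++ [f]) f.dst ∧ IsReprUp T f.dst (pathStr (π ++ [f]))

/-- `S` is the suffix `cano₋(f)` with the `(-)`-certificate `f`. -/
def IsCano (T : List ℕ) (f : CEdge) (S : List ℕ) : Prop :=
  ∃ U D, IsReprUp T f.src U ∧ IsReprDown T f.dst D ∧ S = U ++ f.lab ++ D

/-- `c` is the symbol `precsym(f)` of the text that immediately precedes the suffix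
`cano₋(f)`. -/
def IsPrecSym (T : List ℕ) (f : CEdge) (c : ℕ) : Prop :=
  ∃ S, IsCano T f S ∧ c :: S <:+ T

/-- The number of lower paths of `v`. -/
noncomputable def nleaves (T : List ℕ) (v : Node) : ℕ := (lower T v).ncard

/-- `es` lists the outgoing edges of `v` by increasing first symbols. -/
def IsOutList (T : List ℕ) (v : Node) (es : List CEdge) : Prop :=
  es.Pairwise (fun f g => firstSym f < firstSym g) ∧
    ∀ f, f ∈ es ↔ f ∈ cdawgEdges T ∧ f.src = v

/-- `es` lists, without repetitions, the incoming edges of `v` in the edge order that is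
compatible with the text order: by decreasing length of the longest upper strings through
them. -/
def IsInList (T : List ℕ) (v : Node) (es : List CEdge) : Prop :=
  es.Nodup ∧
  es.Pairwise
    (fun f g => reprUpLen T g.src + g.lab.length ≤ reprUpLen T f.src + f.lab.length) ∧
    ∀ f, f ∈ es ↔ f ∈ cdawgEdges T ∧ f.dst = v

/-! ### The recursive procedure -/

mutual

/-- `RecRBWT T v R tr`: the call of the recursive procedure `RecRBWT` at the node `v` of
`CDAWG(T)` terminates and returns the run-length encoded string `R`; the edges that its loop
(including those of the recursive calls) handles are, in this order, those of `tr`. -/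
inductive RecRBWT (T : List ℕ) : Node → List (ℕ × ℕ) → List CEdge → Prop
  | sink {v : Node} (d : ℕ) (hv : IsOutList T v []) (hd : T.getLast? = some d) :
      RecRBWT T v [(d, 1)] []
  | branch {v : Node} {es : List CEdge} {R : List (ℕ × ℕ)} {tr : List CEdge}
      (hes : IsOutList T v es) (hne : es ≠ []) (hloop : RecLoop T es [] R tr) :
      RecRBWT T v R tr

/-- The loop of `RecRBWT` over the remaining outgoing edges `es`, where the third argument is
the current value of the variable `RBWT` and the fourth one is its final value. -/
inductive RecLoop (T : List ℕ) :
    List CEdge → List (ℕ × ℕ) → List (ℕ × ℕ) → List CEdge → Prop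
  | done (A : List (ℕ × ℕ)) : RecLoop T [] A A []
  | primary {f : CEdge} {es : List CEdge} {A R' R : List (ℕ × ℕ)} {tr' tr : List CEdge}
      (hf : IsPrimaryUp T f) (hcall : RecRBWT T f.dst R' tr')
      (hrest : RecLoop T es (rlConcat A R') R tr) :
      RecLoop T (f :: es) A R (f :: tr' ++ tr)
  | secondary {f : CEdge} {es : List CEdge} {A R : List (ℕ × ℕ)} {tr : List CEdge} {c : ℕ}
      (hf : ¬ IsPrimaryUp T f) (hc : IsPrecSym T f c)
      (hrest : RecLoop T es (rlConcat A [(c, nleaves T f.dst)]) R tr) :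
      RecLoop T (f :: es) A R (f :: tr)

end

/-! ### The self-index version of the CDAWG -/

/-- The ordered CDAWG of `T` as a data structure: an arbitrary numbering of its nodes, its
adjacency lists, sorted by the two edge orders, and its suffix links. -/
structure OrderedCDAWG (T : List ℕ) where
  nodes : List Node
  nodes_nodup : nodes.Nodup
  mem_nodes : ∀ v, v ∈ nodes ↔ v ∈ cdawgNodes T
  out : Node → List CEdge
  isOutList : ∀ v ∈ cdawgNodes T, IsOutList T v (out v)
  inc : Node → List CEdge
  isInList : ∀ v ∈ cdawgNodes T, IsInList T v (inc v)
  suf : Node → Node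
  isSuffixLink : ∀ v ∈ cdawgNodes T, v ≠ cdawgRoot T → (v, suf v) ∈ suffixLinks T

namespace OrderedCDAWG

variable {T : List ℕ} (G : OrderedCDAWG T)

/-- All edges, grouped by their source nodes. -/
def edges : List CEdge := G.nodes.flatMap G.out

open scoped Classical in
/-- The number of a node. -/
noncomputable def nodeId (v : Node) : ℕ := G.nodes.idxOf v

open scoped Classical in
/-- The number of an edge. -/
noncomputable def edgeId (f : CEdge) : ℕ := G.edges.idxOf f

open scoped Classical in
/-- The record of a node, 5 words: where its outgoing edges start in the edge table, how many
they are, where its incoming edges start in the table of incoming edges, how many they are, and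
its suffix link (the number of nodes stands for the missing link of the root). -/
noncomputable def nodeRecord (v : Node) : List ℕ :=
  [((G.nodes.take (G.nodeId v)).flatMap G.out).length, (G.out v).length,
    ((G.nodes.take (G.nodeId v)).flatMap G.inc).length, (G.inc v).length,
    if v = cdawgRoot T then G.nodes.length else G.nodeId (G.suf v)]

/-- The record of an edge, 4 words: source, target, length of the label and first symbol of the
label. -/
noncomputable def edgeRecord (f : CEdge) : List ℕ :=
  [G.nodeId f.src, G.nodeId f.dst, f.lab.length, firstSym f]

/-- The self-index as a sequence of words: a header (number of nodes, number of edges, root,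
sink), the node table, the edge table, and the table of incoming edges. It has no access to the
text: of an edge label it holds only the length and the first symbol. -/
noncomputable def selfIndex : List ℕ :=
  [G.nodes.length, G.edges.length, G.nodeId (cdawgRoot T), G.nodeId (cdawgSink T)] ++
    G.nodes.flatMap G.nodeRecord ++ G.edges.flatMap G.edgeRecord ++
    (G.nodes.flatMap G.inc).map G.edgeId

end OrderedCDAWG

/-! ### A word RAM with structured control flow -/

namespace WordRAM

/-- The contents of the registers, of the working memory, of the write-only output, and of a
write-only log, into which a program can report what it is doing. -/
structure State where
  reg : ℕ → ℕ
  mem : ℕ → ℕ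
  out : List ℕ
  log : List ℕ

/-- The initial state: everything is zero or empty. -/
def initial : State := ⟨fun _ => 0, fun _ => 0, [], []⟩

/-- An operand: a constant or a register. -/
inductive Operand
  | const (k : ℕ)
  | reg (r : ℕ)

def Operand.val (s : State) : Operand → ℕ
  | .const k => k
  | .reg r => s.reg r

/-- Arithmetic operations; subtraction is truncated at zero. -/
inductive Op
  | add
  | sub
  | mul

def Op.eval : Op → ℕ → ℕ → ℕ
  | .add, x, y => x + y
  | .sub, x, y => x - y
  | .mul, x, y => x * y

/-- Tests. -/
inductive Test
  | lt (a b : Operand)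
  | eq (a b : Operand)

def Test.holds (s : State) : Test → Prop
  | .lt a b => a.val s < b.val s
  | .eq a b => a.val s = b.val s

/-- Programs. -/
inductive Program
  | skip
  /-- `reg r := a op b` -/
  | arith (r : ℕ) (o : Op) (a b : Operand)
  /-- `reg r := input[a]` -/
  | read (r : ℕ) (a : Operand)
  /-- `reg r := mem[a]` -/
  | load (r : ℕ) (a : Operand)
  /-- `mem[a] := b` -/
  | store (a b : Operand)
  /-- append `a` to the output -/
  | write (a : Operand)
  /-- append `a` to the log -/
  | report (a : Operand)
  | seq (p q : Program)
  | ite (c : Test) (p q : Program)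
  | loop (c : Test) (p : Program)

/-- `Exec W S input p s s' t`: on the read-only input, the program `p` started in the state `s`
terminates in the state `s'` after `t` steps, every instruction and every test being one step,
while every word it produces is smaller than `W` and every memory address it uses is smaller
than `S`. There is no way to go on after a violation of these bounds or after an attempt to read
past the end of the input. -/
inductive Exec (W S : ℕ) (input : List ℕ) : Program → State → State → ℕ → Prop
  | skip (s : State) : Exec W S input .skip s s 1
  | arith {s : State} {r : ℕ} {o : Op} {a b : Operand}
      (h : o.eval (a.val s) (b.val s) < W) :
      Exec W S input (.arith r o a b) s
        { s with reg := Function.update s.reg r (o.eval (a.val s) (b.val s)) } 1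
  | read {s : State} {r : ℕ} {a : Operand} {x : ℕ}
      (hx : input[a.val s]? = some x) (h : x < W) :
      Exec W S input (.read r a) s { s with reg := Function.update s.reg r x } 1
  | load {s : State} {r : ℕ} {a : Operand} (h : a.val s < S) :
      Exec W S input (.load r a) s
        { s with reg := Function.update s.reg r (s.mem (a.val s)) } 1
  | store {s : State} {a b : Operand} (h : a.val s < S) (hb : b.val s < W) :
      Exec W S input (.store a b) s
        { s with mem := Function.update s.mem (a.val s) (b.val s) } 1
  | write {s : State} {a : Operand} (h : a.val s < W) :
      Exec W S input (.write a) s { s with out := s.out ++ [a.val s] } 1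
  | report {s : State} {a : Operand} (h : a.val s < W) :
      Exec W S input (.report a) s { s with log := s.log ++ [a.val s] } 1
  | seq {p q : Program} {s s' s'' : State} {t t' : ℕ}
      (hp : Exec W S input p s s' t) (hq : Exec W S input q s' s'' t') :
      Exec W S input (.seq p q) s s'' (t + t')
  | ite_true {c : Test} {p q : Program} {s s' : State} {t : ℕ}
      (hc : c.holds s) (hp : Exec W S input p s s' t) :
      Exec W S input (.ite c p q) s s' (t + 1)
  | ite_false {c : Test} {p q : Program} {s s' : State} {t : ℕ}
      (hc : ¬ c.holds s) (hq : Exec W S input q s s' t) :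
      Exec W S input (.ite c p q) s s' (t + 1)
  | loop_true {c : Test} {p : Program} {s s' s'' : State} {t t' : ℕ}
      (hc : c.holds s) (hp : Exec W S input p s s' t)
      (hl : Exec W S input (.loop c p) s' s'' t') :
      Exec W S input (.loop c p) s s'' (t + t' + 1)
  | loop_false {c : Test} {p : Program} {s : State} (hc : ¬ c.holds s) :
      Exec W S input (.loop c p) s s 1

end WordRAM

/-! ### Factors and classes of strings -/

-- Two nodes of the suffix tree have the same subtree exactly when they have the same continuations
-- to suffixes of `T` (`IsText.suf_congr`, `IsText.subtree_congr`). A node of the CDAWG is thus a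
-- class of strings. Its members form a chain under the suffix order, without gaps
-- (`IsText.suffix_of_subtree_eq`, `IsText.subtree_eq_of_between`). The upper strings of the node
-- are these members (`mem_upper_iff`), and the lower strings are their common continuations
-- (`IsText.mem_lower_iff`).
--
-- Let `U` be the longest member at the source of an edge `f`. If `f` is secondary, `U ++ f.lab` is
-- not the longest member of its class, so the class also contains `c :: (U ++ f.lab)` for some `c`.
-- Then `c` precedes every suffix that starts with `U ++ f.lab`, and this block of the transform is
-- a single run of `c` (`IsText.map_precOf_below`). If `f` is primary, `U ++ f.lab` is again a
-- longest member and the recursion continues there. Prefixes of longest members that are nodes are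
-- longest members too, so the primary edges form a spanning tree, every edge is handled exactly
-- once, and the pieces appear in lexicographic order (`below_eq_flatMap`, `IsText.exists_recRBWT`).
-- Each edge contributes at most one run, whence the bound on `r`.
--
-- The symbol `c` is found without the text. Ordered by length, the members of a class split into
-- intervals according to their last edges, and the list of incoming edges enumerates these
-- intervals from longest to shortest. The string `c :: (U ++ f.lab)` is therefore the shortest one
-- through the edge listed just before `f` (`IsText.precSym_eq`). Its first symbol is that of the
-- shortest string at the source of that edge, or the first symbol of the label if the source is the
-- root. The shortest string of a node goes through its last incoming edge (`IsText.leadSym_dst`),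
-- so these symbols propagate from the root downwards, while numbers of leaves propagate from the
-- sink upwards.
--
-- The program computes a reverse topological order together with the numbers of leaves, then the
-- leading symbols, and then simulates the recursion with a stack of edge intervals. Suffix links
-- and label lengths are never read. `NumIndex` isolates the arithmetic facts that the program
-- relies on. `Walk` describes the traversal in terms of edge numbers: `OrderedCDAWG.exists_walk`
-- derives it from the recursion and `Walk.runs` executes it. Each phase takes time linear in the
-- numbers of nodes and edges, and the words are small enough because there are fewer than `2n`
-- edges (`IsText.trace_length_le`).

theorem IsText.ne_nil {T : List ℕ} (hT : IsText T) : T ≠ [] := by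
  obtain ⟨w, d, rfl, -⟩ := hT; simp

theorem IsText.self_mem_suf {T : List ℕ} (hT : IsText T) : T ∈ Suf T :=
  ⟨hT.ne_nil, List.suffix_rfl⟩

/-- A suffix of a text cannot be extended to the right inside the text. -/
theorem IsText.suf_append {T X Z : List ℕ} (hT : IsText T) (hX : X ∈ Suf T)
    (h : X ++ Z <:+: T) : Z = [] := by
  obtain ⟨w, d, rfl, hw⟩ := hT
  obtain ⟨hX0, hX⟩ := hX
  obtain ⟨X', c, rfl⟩ := List.eq_nil_or_concat' X |>.resolve_left hX0
  have hc : c = d := by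
    obtain ⟨A, hA⟩ := hX
    rw [← List.append_assoc] at hA
    simpa using (List.append_inj' hA rfl).2
  subst hc
  obtain ⟨A, B, hAB⟩ := h
  by_contra hZ
  have hne : Z ++ B ≠ [] := by simp [hZ]
  -- Splitting off the last symbol `b` of the text leaves the end-marker at the end of `X` inside
  -- `w`, where all symbols are larger.
  obtain ⟨Y, b, hY⟩ := List.eq_nil_or_concat' (Z ++ B) |>.resolve_left hne
  have h1 : (A ++ (X' ++ [c]) ++ Y) ++ [b] = w ++ [c] := by
    rw [← hAB]
    simp only [List.append_assoc]
    rw [hY]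
  have h2 := (List.append_inj' h1 rfl).1
  have := hw c (by rw [← h2]; simp)
  omega

theorem Suf.isTreeNode {T X : List ℕ} (h : X ∈ Suf T) : IsTreeNode T X := Or.inr (Or.inl h)

theorem isTreeNode_nil (T : List ℕ) : IsTreeNode T [] := Or.inl rfl

theorem IsTreeNode.infix {T X : List ℕ} (h : IsTreeNode T X) : X <:+: T := by
  rcases h with rfl | h | ⟨a, b, -, h, -⟩
  · exact List.nil_infix
  · exact h.2.isInfix
  · exact (List.infix_append' [] X [a] |>.trans (by simpa using h))

theorem exists_suf_of_infix {T X : List ℕ} (hT : T ≠ []) (h : X <:+: T) :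
    ∃ D, X ++ D ∈ Suf T := by
  by_cases hX : X = []
  · subst hX; exact ⟨T, hT, List.suffix_rfl⟩
  · obtain ⟨A, B, h⟩ := h
    exact ⟨B, by simp [hX], A, by rw [← h]; simp⟩

theorem infix_of_append_suf {T X D : List ℕ} (h : X ++ D ∈ Suf T) : X <:+: T :=
  (List.prefix_append X D).isInfix.trans h.2.isInfix

theorem subtree_append (T X Y : List ℕ) : subtree T (X ++ Y) = {Z | Y ++ Z ∈ subtree T X} := by
  ext Z; simp [subtree]

theorem mem_subtree {T X Z : List ℕ} : Z ∈ subtree T X ↔ IsTreeNode T (X ++ Z) := Iff.rfl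

theorem nil_mem_subtree {T X : List ℕ} : [] ∈ subtree T X ↔ IsTreeNode T X := by
  simp [mem_subtree]

theorem isTreeNode_of_subtree_eq {T X Y : List ℕ} (h : subtree T X = subtree T Y)
    (hX : IsTreeNode T X) : IsTreeNode T Y := by
  rw [← nil_mem_subtree, ← h, nil_mem_subtree]; exact hX

/-- Having the same subtree is a right congruence, as in the Myhill-Nerode construction. This makes
edges between merged nodes well defined. -/
theorem subtree_append_congr {T X Y : List ℕ} (h : subtree T X = subtree T Y) (Z : List ℕ) :
    subtree T (X ++ Z) = subtree T (Y ++ Z) := by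
  rw [subtree_append, subtree_append, h]

theorem IsText.subtree_suf {T X : List ℕ} (hT : IsText T) (hX : X ∈ Suf T) :
    subtree T X = {[]} := by
  ext Z
  simp only [mem_subtree, Set.mem_singleton_iff]
  constructor
  · intro h; exact hT.suf_append hX h.infix
  · rintro rfl; simpa using Suf.isTreeNode hX

theorem IsText.sink_eq {T : List ℕ} (hT : IsText T) : cdawgSink T = {[]} :=
  hT.subtree_suf hT.self_mem_suf

/-- A node that is not a suffix has a non-empty continuation to one, which is a non-empty member of
its subtree. The subtree of a suffix contains only the empty string. -/
theorem IsText.subtree_eq_sink_iff {T X : List ℕ} (hT : IsText T) (hX : IsTreeNode T X) :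
    subtree T X = cdawgSink T ↔ X ∈ Suf T := by
  rw [hT.sink_eq]
  refine ⟨fun h => ?_, hT.subtree_suf⟩
  have key : ∀ Z, Z ≠ [] → X ++ Z ∉ Suf T := by
    intro Z hZ hs
    have : Z ∈ subtree T X := Suf.isTreeNode hs
    rw [h] at this
    exact hZ this
  rcases hX with rfl | hX | ⟨a, b, -, ha, -⟩
  · exact absurd hT.self_mem_suf (key T hT.ne_nil)
  · exact hX
  · obtain ⟨D, hD⟩ := exists_suf_of_infix hT.ne_nil ha
    exact absurd (by simpa using hD) (key ([a] ++ D) (by simp))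

/-- Nodes with isomorphic subtrees have the same continuations to suffixes. -/
theorem IsText.suf_congr {T X Y : List ℕ} (hT : IsText T) (h : subtree T X = subtree T Y)
    (D : List ℕ) (hD : X ++ D ∈ Suf T) : Y ++ D ∈ Suf T := by
  have h1 := subtree_append_congr h D
  have h2 := Suf.isTreeNode hD
  rw [← hT.subtree_eq_sink_iff (isTreeNode_of_subtree_eq h1 h2), ← h1,
    hT.subtree_eq_sink_iff h2]
  exact hD

/-- Branching is visible in the continuations to suffixes: a symbol may follow `X ++ Z` inside `T`
exactly when some continuation of `X` to a suffix begins with `Z` and that symbol. -/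
theorem IsText.subtree_congr {T X Y : List ℕ} (hT : IsText T) (hX : IsTreeNode T X)
    (hY : IsTreeNode T Y) (h : ∀ D, X ++ D ∈ Suf T ↔ Y ++ D ∈ Suf T) :
    subtree T X = subtree T Y := by
  have aux : ∀ X Y, IsTreeNode T Y → (∀ D, X ++ D ∈ Suf T ↔ Y ++ D ∈ Suf T) →
      subtree T X ⊆ subtree T Y := by
    intro X Y hY h Z hZ
    rw [mem_subtree] at *
    rcases hZ with hZ | hZ | ⟨a, b, hab, ha, hb⟩
    · simp only [List.append_eq_nil_iff] at hZ
      rw [hZ.2]; simpa using hY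
    · exact Suf.isTreeNode ((h Z).1 hZ)
    · have key : ∀ c, (X ++ Z) ++ [c] <:+: T → (Y ++ Z) ++ [c] <:+: T := by
        intro c hc
        obtain ⟨D, hD⟩ := exists_suf_of_infix hT.ne_nil hc
        refine infix_of_append_suf (D := D) ?_
        have := (h (Z ++ [c] ++ D)).1 (by simpa using hD)
        simpa using this
      exact Or.inr (Or.inr ⟨a, b, hab, key a ha, key b hb⟩)
  exact Set.Subset.antisymm (aux X Y hY h) (aux Y X hX fun D => (h D).symm)

/-- A common continuation `D` turns both strings into suffixes of `T`, which are comparable, and `D`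
can be cancelled. -/
theorem IsText.suffix_of_subtree_eq {T X Y : List ℕ} (hT : IsText T) (hX : IsTreeNode T X)
    (h : subtree T X = subtree T Y) (hl : X.length ≤ Y.length) : X <:+ Y := by
  obtain ⟨D, hD⟩ := exists_suf_of_infix hT.ne_nil hX.infix
  have h2 := hT.suf_congr h D hD
  exact List.suffix_append_self_iff.1
    (List.suffix_of_suffix_length_le hD.2 h2.2 (by simpa using hl))

/-- The strings of a class form an interval of the suffix order. -/
theorem IsText.subtree_eq_of_between {T X Y Z : List ℕ} (hT : IsText T) (hX : IsTreeNode T X)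
    (h : subtree T X = subtree T Z) (hXY : X <:+ Y) (hYZ : Y <:+ Z) :
    IsTreeNode T Y ∧ subtree T X = subtree T Y := by
  have hZ := isTreeNode_of_subtree_eq h hX
  -- The class of the empty string is a singleton: for another member `Z`, the string `Z ++ T` would
  -- be a suffix of `T`. This settles the case of the root, which does not branch by necessity.
  have ne : X ≠ [] ∨ Y = [] := by
    by_contra! hc
    have h0 : X = [] := hc.1
    subst h0
    have h1 := hT.suf_congr h T (by simpa using hT.self_mem_suf)
    have h2 := h1.2.length_le
    have h3 := hYZ.length_le
    have h4 := List.length_pos_of_ne_nil hc.2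
    simp at h2
    simp [h2] at h3
    exact hc.2 h3
  -- A sandwich: `X ++ D` is a suffix of `Y ++ D`, which is a suffix of `Z ++ D`, and the outer two
  -- are suffixes of `T` simultaneously.
  have key : ∀ D, X ++ D ∈ Suf T ↔ Y ++ D ∈ Suf T := by
    intro D
    obtain ⟨A, rfl⟩ := hXY
    obtain ⟨B, rfl⟩ := hYZ
    constructor
    · intro hD
      have := hT.suf_congr h D hD
      refine ⟨?_, (List.suffix_append B _).trans (by simpa using this.2)⟩
      have := hD.1
      simp only [ne_eq, List.append_eq_nil_iff] at *
      tauto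
    · intro hD
      refine ⟨?_, (List.suffix_append A _).trans (by simpa using hD.2)⟩
      have := hD.1
      simp only [ne_eq, List.append_eq_nil_iff] at *
      tauto
  have hY : IsTreeNode T Y := by
    rcases hX with rfl | hX | ⟨a, b, hab, ha, hb⟩
    · exact Or.inl (ne.resolve_left (by simp))
    · exact Suf.isTreeNode (by simpa using (key []).1 (by simpa using hX))
    · have key2 : ∀ c, X ++ [c] <:+: T → Y ++ [c] <:+: T := by
        intro c hc
        obtain ⟨D, hD⟩ := exists_suf_of_infix hT.ne_nil hc
        exact infix_of_append_suf (D := D) (by simpa using (key ([c] ++ D)).1 (by simpa using hD))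
      exact Or.inr (Or.inr ⟨a, b, hab, key2 a ha, key2 b hb⟩)
  exact ⟨hY, hT.subtree_congr hX hY key⟩

/-! ### Edges -/

theorem isTreeEdge_congr {T U V X : List ℕ} (h : subtree T U = subtree T V)
    (hX : IsTreeEdge T U X) : IsTreeEdge T V X := by
  obtain ⟨h1, h2, h3, h4⟩ := hX
  refine ⟨h1, isTreeNode_of_subtree_eq h h2, ?_, fun Y hY hY0 hYX => ?_⟩
  · rw [← mem_subtree, ← h]; exact h3
  · rw [← mem_subtree, ← h]; exact h4 Y hY hY0 hYX

/-- An edge of the CDAWG can be followed in the suffix tree from every string of its source class,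
so any representative may be chosen. -/
theorem edge_of_src_eq {T U : List ℕ} {f : CEdge} (hf : f ∈ cdawgEdges T)
    (h : f.src = subtree T U) :
    IsTreeEdge T U f.lab ∧ f.dst = subtree T (U ++ f.lab) := by
  obtain ⟨V, X, hX, rfl⟩ := hf
  exact ⟨isTreeEdge_congr h hX, subtree_append_congr h X⟩

theorem IsTreeEdge.mem_cdawgEdges {T U X : List ℕ} (h : IsTreeEdge T U X) :
    (⟨subtree T U, X, subtree T (U ++ X)⟩ : CEdge) ∈ cdawgEdges T := ⟨U, X, h, rfl⟩

theorem CEdge.ext' {f g : CEdge} (h1 : f.src = g.src) (h2 : f.lab = g.lab)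
    (h3 : f.dst = g.dst) : f = g := by
  cases f; cases g; simp_all

theorem edge_ext {T : List ℕ} {f g : CEdge} (hf : f ∈ cdawgEdges T) (hg : g ∈ cdawgEdges T)
    (h1 : f.src = g.src) (h2 : f.lab = g.lab) : f = g := by
  obtain ⟨V, X, hX, rfl⟩ := hf
  have := (edge_of_src_eq hg h1.symm).2
  refine CEdge.ext' h1 h2 ?_
  rw [this, ← h2]

/-- The first edge on the way from a node down to another one. -/
theorem exists_first_edge {T U Z : List ℕ} (hU : IsTreeNode T U) (hZ : Z ≠ [])
    (hUZ : IsTreeNode T (U ++ Z)) : ∃ X, IsTreeEdge T U X ∧ X <+: Z := by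
  classical
  -- The label is the shortest non-empty prefix of `Z` that leads to a node.
  have hex : ∃ k, 0 < k ∧ IsTreeNode T (U ++ Z.take k) :=
    ⟨Z.length, List.length_pos_of_ne_nil hZ, by simpa using hUZ⟩
  obtain ⟨h1, h2⟩ := Nat.find_spec hex
  have h3 : Nat.find hex ≤ Z.length :=
    Nat.find_min' hex ⟨List.length_pos_of_ne_nil hZ, by simpa using hUZ⟩
  refine ⟨Z.take (Nat.find hex), ⟨?_, hU, h2, fun Y hY hY0 hYX hn => ?_⟩, List.take_prefix _ _⟩
  · intro h
    rw [List.take_eq_nil_iff] at h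
    rcases h with h | h
    · omega
    · exact hZ h
  · have hlt : Y.length < Nat.find hex := by
      have := hY.length_le
      rcases this.lt_or_eq with h | h
      · rw [List.length_take] at h; omega
      · exact absurd (hY.eq_of_length h) hYX
    refine Nat.find_min hex hlt ⟨List.length_pos_of_ne_nil hY0, ?_⟩
    rwa [← List.prefix_iff_eq_take.1 (hY.trans (List.take_prefix _ _))]

/-- The last edge on the way from the root down to a node. -/
theorem exists_last_edge {T U : List ℕ} (hU : IsTreeNode T U) (h0 : U ≠ []) :
    ∃ V X, IsTreeEdge T V X ∧ V ++ X = U := by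
  suffices H : ∀ n V Z, Z.length ≤ n → Z ≠ [] → IsTreeNode T V → V ++ Z = U →
      ∃ V X, IsTreeEdge T V X ∧ V ++ X = U from
    H _ [] U le_rfl h0 (isTreeNode_nil T) rfl
  intro n
  induction n with
  | zero => intro V Z hn hZ; exact absurd (List.length_eq_zero_iff.1 (by omega)) hZ
  | succ n ih =>
    intro V Z hn hZ hV hVZ
    obtain ⟨X, hX, Y, hY⟩ := exists_first_edge hV hZ (hVZ ▸ hU)
    by_cases hY0 : Y = []
    · subst hY0
      exact ⟨V, X, hX, by rw [← hVZ, ← hY]; simp⟩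
    · refine ih (V ++ X) Y ?_ hY0 hX.2.2.1 (by rw [← hVZ, ← hY]; simp)
      have := List.length_pos_of_ne_nil hX.1
      have := congrArg List.length hY
      simp at this
      omega

theorem IsTreeEdge.eq_of_prefix {T U X Y : List ℕ} (hX : IsTreeEdge T U X)
    (hY : IsTreeEdge T U Y) (h : X <+: Y) : X = Y := by
  by_contra hne
  exact hY.2.2.2 X h hX.1 hne hX.2.2.1

theorem IsTreeEdge.eq_of_common {T U X Y Z : List ℕ} (hX : IsTreeEdge T U X)
    (hY : IsTreeEdge T U Y) (hXZ : X <+: Z) (hYZ : Y <+: Z) : X = Y := by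
  rcases le_total X.length Y.length with h | h
  · exact hX.eq_of_prefix hY (List.prefix_of_prefix_length_le hXZ hYZ h)
  · exact (hY.eq_of_prefix hX (List.prefix_of_prefix_length_le hYZ hXZ h)).symm

theorem eq_prefix_or_split (X Y : List ℕ) :
    X <+: Y ∨ Y <+: X ∨ ∃ P a b, a ≠ b ∧ P ++ [a] <+: X ∧ P ++ [b] <+: Y := by
  induction X generalizing Y with
  | nil => simp
  | cons x X ih =>
    cases Y with
    | nil => simp
    | cons y Y =>
      by_cases h : x = y
      · subst h
        rcases ih Y with h | h | ⟨P, a, b, hab, h1, h2⟩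
        · exact Or.inl (by simpa using h)
        · exact Or.inr (Or.inl (by simpa using h))
        · exact Or.inr (Or.inr ⟨x :: P, a, b, hab, by simpa using h1, by simpa using h2⟩)
      · exact Or.inr (Or.inr ⟨[], x, y, h, by simp, by simp⟩)

theorem infix_append_of_prefix {T U X P : List ℕ} (h : P <+: X) (hX : U ++ X <:+: T) :
    U ++ P <:+: T := by
  obtain ⟨Q, rfl⟩ := h
  exact (List.prefix_append (U ++ P) Q).isInfix.trans (by simpa using hX)

/-- Different edges out of a node have labels with different first symbols. -/
theorem IsTreeEdge.eq_of_head {T U X Y : List ℕ} (hX : IsTreeEdge T U X)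
    (hY : IsTreeEdge T U Y) (h : X.headD 0 = Y.headD 0) : X = Y := by
  rcases eq_prefix_or_split X Y with h1 | h1 | ⟨P, a, b, hab, h1, h2⟩
  · exact hX.eq_of_prefix hY h1
  · exact (hY.eq_of_prefix hX h1).symm
  -- The common part `P` is non-empty because the first symbols agree, and it is followed by two
  -- different symbols. This puts a branching node strictly inside the edge `X`.
  · exfalso
    have hP0 : P ≠ [] := by
      rintro rfl
      obtain ⟨X', rfl⟩ := h1
      obtain ⟨Y', rfl⟩ := h2
      simp at h
      exact hab h
    refine hX.2.2.2 P ((List.prefix_append P [a]).trans h1) hP0 ?_ (Or.inr (Or.inr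
      ⟨a, b, hab, ?_, ?_⟩))
    · rintro rfl
      have := h1.length_le
      simp at this
    · simpa using infix_append_of_prefix h1 hX.2.2.1.infix
    · simpa using infix_append_of_prefix h2 hY.2.2.1.infix

/-- If the two edges into the same string began at different nodes, the lower of the two would lie
strictly inside the longer edge. -/
theorem IsTreeEdge.last_unique {T U V X Y : List ℕ} (hX : IsTreeEdge T U X)
    (hY : IsTreeEdge T V Y) (h : U ++ X = V ++ Y) : U = V ∧ X = Y := by
  have aux : ∀ U V X Y : List ℕ, IsTreeEdge T U X → IsTreeEdge T V Y → U ++ X = V ++ Y →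
      U.length ≤ V.length → U = V ∧ X = Y := by
    intro U V X Y hX hY h hl
    obtain ⟨Z, rfl⟩ := List.prefix_of_prefix_length_le (List.prefix_append U X)
      (h ▸ List.prefix_append V Y) hl
    have h' : X = Z ++ Y := by simpa using h
    by_cases hZ : Z = []
    · subst hZ; simp [h']
    · exfalso
      refine hX.2.2.2 Z (h' ▸ List.prefix_append Z Y) hZ ?_ hY.2.1
      rintro rfl
      exact hY.1 (by simpa using h')
  rcases le_total U.length V.length with hl | hl
  · exact aux U V X Y hX hY h hl
  · obtain ⟨h1, h2⟩ := aux V U Y X hY hX h.symm hl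
    exact ⟨h1.symm, h2.symm⟩

/-! ### Paths -/

/-- A path of the CDAWG lifts to the suffix tree, starting from any string of the class of its first
node. -/
theorem IsPath.treeNode {T : List ℕ} {v w : Node} {π : List CEdge} (h : IsPath T v π w) :
    ∀ U, IsTreeNode T U → v = subtree T U →
      IsTreeNode T (U ++ pathStr π) ∧ w = subtree T (U ++ pathStr π) := by
  induction h with
  | nil v => intro U hU hv; simpa [pathStr] using ⟨hU, hv⟩
  | cons hf _ ih =>
    intro U hU hv
    obtain ⟨h1, h2⟩ := edge_of_src_eq hf hv
    simpa [pathStr] using ih _ h1.2.2.1 h2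

theorem exists_path {T : List ℕ} (Z : List ℕ) : ∀ U, IsTreeNode T U → IsTreeNode T (U ++ Z) →
    ∃ π, IsPath T (subtree T U) π (subtree T (U ++ Z)) ∧ pathStr π = Z := by
  induction hn : Z.length using Nat.strong_induction_on generalizing Z with
  | _ n ih =>
    intro U hU hUZ
    by_cases hZ : Z = []
    · subst hZ; exact ⟨[], by simpa using IsPath.nil _, rfl⟩
    · obtain ⟨X, hX, Y, rfl⟩ := exists_first_edge hU hZ hUZ
      have h1 := List.length_pos_of_ne_nil hX.1
      simp at hn
      obtain ⟨π, h2, h3⟩ := ih Y.length (by omega) Y rfl (U ++ X) hX.2.2.1 (by simpa using hUZ)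
      refine ⟨_ :: π, IsPath.cons hX.mem_cdawgEdges (by simpa using h2), ?_⟩
      simp [pathStr] at *
      exact h3

theorem IsPath.append {T : List ℕ} {u v w : Node} {π ρ : List CEdge} (h : IsPath T u π v)
    (h' : IsPath T v ρ w) : IsPath T u (π ++ ρ) w := by
  induction h with
  | nil => exact h'
  | cons hf _ ih => exact IsPath.cons hf (ih h')

theorem IsPath.of_append {T : List ℕ} {u w : Node} {π ρ : List CEdge}
    (h : IsPath T u (π ++ ρ) w) : ∃ v, IsPath T u π v ∧ IsPath T v ρ w := by
  induction π generalizing u with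
  | nil => exact ⟨u, IsPath.nil u, h⟩
  | cons f π ih =>
    cases h with
    | cons hf h =>
      obtain ⟨v, h1, h2⟩ := ih h
      exact ⟨v, IsPath.cons hf h1, h2⟩

theorem isPath_singleton {T : List ℕ} {f : CEdge} (hf : f ∈ cdawgEdges T) :
    IsPath T f.src [f] f.dst := IsPath.cons hf (IsPath.nil _)

/-- This eliminates paths from the argument: upper strings are nothing but the members of the class.
-/
theorem mem_upper_iff {T U : List ℕ} {v : Node} :
    U ∈ upper T v ↔ IsTreeNode T U ∧ subtree T U = v := by
  constructor
  · rintro ⟨π, hπ, rfl⟩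
    have := hπ.treeNode [] (isTreeNode_nil T) rfl
    simp only [List.nil_append] at this
    exact ⟨this.1, this.2.symm⟩
  · rintro ⟨h, rfl⟩
    obtain ⟨π, h1, h2⟩ := exists_path U [] (isTreeNode_nil T) (by simpa using h)
    exact ⟨π, h1, h2.symm⟩

theorem IsText.mem_lower_iff {T X D : List ℕ} (hT : IsText T) (hX : IsTreeNode T X) :
    D ∈ lower T (subtree T X) ↔ X ++ D ∈ Suf T := by
  constructor
  · rintro ⟨π, hπ, rfl⟩
    obtain ⟨h1, h2⟩ := hπ.treeNode X hX rfl
    exact (hT.subtree_eq_sink_iff h1).1 h2.symm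
  · intro h
    have h1 := Suf.isTreeNode h
    obtain ⟨π, h2, h3⟩ := exists_path D X hX h1
    rw [(hT.subtree_eq_sink_iff h1).2 h] at h2
    exact ⟨π, h2, h3.symm⟩

/-! ### Representatives -/

theorem mem_cdawgNodes_of_treeNode {T U : List ℕ} (hU : IsTreeNode T U) :
    subtree T U ∈ cdawgNodes T := ⟨U, hU, rfl⟩

theorem src_mem_cdawgNodes {T : List ℕ} {f : CEdge} (hf : f ∈ cdawgEdges T) :
    f.src ∈ cdawgNodes T := by
  obtain ⟨U, X, h, rfl⟩ := hf
  exact ⟨U, h.2.1, rfl⟩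

theorem dst_mem_cdawgNodes {T : List ℕ} {f : CEdge} (hf : f ∈ cdawgEdges T) :
    f.dst ∈ cdawgNodes T := by
  obtain ⟨U, X, h, rfl⟩ := hf
  exact ⟨U ++ X, h.2.2.1, rfl⟩

theorem lab_ne_nil {T : List ℕ} {f : CEdge} (hf : f ∈ cdawgEdges T) : f.lab ≠ [] := by
  obtain ⟨U, X, h, rfl⟩ := hf
  exact h.1

theorem bddAbove_upper (T : List ℕ) (v : Node) : BddAbove (List.length '' upper T v) := by
  refine ⟨T.length, ?_⟩
  rintro _ ⟨U, hU, rfl⟩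
  exact (mem_upper_iff.1 hU).1.infix.length_le

theorem upper_nonempty {T : List ℕ} {v : Node} (hv : v ∈ cdawgNodes T) :
    (upper T v).Nonempty := by
  obtain ⟨U, hU, rfl⟩ := hv
  exact ⟨U, mem_upper_iff.2 ⟨hU, rfl⟩⟩

theorem length_le_reprUpLen {T U : List ℕ} {v : Node} (h : U ∈ upper T v) :
    U.length ≤ reprUpLen T v :=
  le_csSup (bddAbove_upper T v) ⟨U, h, rfl⟩

theorem exists_isReprUp {T : List ℕ} {v : Node} (hv : v ∈ cdawgNodes T) :
    ∃ U, IsReprUp T v U := by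
  obtain ⟨U, hU, h⟩ := Nat.sSup_mem ((upper_nonempty hv).image List.length) (bddAbove_upper T v)
  exact ⟨U, hU, fun V hV => h ▸ length_le_reprUpLen hV⟩

theorem IsReprUp.reprUpLen_eq {T U : List ℕ} {v : Node} (h : IsReprUp T v U) :
    reprUpLen T v = U.length := by
  refine le_antisymm (csSup_le ⟨_, ⟨U, h.1, rfl⟩⟩ ?_) (length_le_reprUpLen h.1)
  rintro _ ⟨V, hV, rfl⟩
  exact h.2 V hV

theorem IsReprUp.treeNode {T U : List ℕ} {v : Node} (h : IsReprUp T v U) : IsTreeNode T U :=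
  (mem_upper_iff.1 h.1).1

theorem IsReprUp.eq_subtree {T U : List ℕ} {v : Node} (h : IsReprUp T v U) :
    v = subtree T U := (mem_upper_iff.1 h.1).2.symm

theorem IsText.suffix_of_mem_upper {T U V : List ℕ} {v : Node} (hT : IsText T)
    (hU : U ∈ upper T v) (hV : V ∈ upper T v) (hl : U.length ≤ V.length) : U <:+ V := by
  rw [mem_upper_iff] at hU hV
  exact hT.suffix_of_subtree_eq hU.1 (hU.2.trans hV.2.symm) hl

theorem IsText.upper_eq_of_length {T U V : List ℕ} {v : Node} (hT : IsText T)
    (hU : U ∈ upper T v) (hV : V ∈ upper T v) (hl : U.length = V.length) : U = V :=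
  (hT.suffix_of_mem_upper hU hV hl.le).eq_of_length hl

theorem IsText.mem_upper_of_between {T U V W : List ℕ} {v : Node} (hT : IsText T)
    (hU : U ∈ upper T v) (hW : W ∈ upper T v) (h1 : U <:+ V) (h2 : V <:+ W) : V ∈ upper T v := by
  rw [mem_upper_iff] at hU hW ⊢
  have := hT.subtree_eq_of_between hU.1 (hU.2.trans hW.2.symm) h1 h2
  exact ⟨this.1, this.2.symm.trans hU.2⟩

theorem IsText.reprUp_unique {T U V : List ℕ} {v : Node} (hT : IsText T)
    (hU : IsReprUp T v U) (hV : IsReprUp T v V) : U = V :=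
  hT.upper_eq_of_length hU.1 hV.1 (le_antisymm (hV.2 U hU.1) (hU.2 V hV.1))

/-- Prefixes of representatives are representatives. -/
theorem IsReprUp.of_append {T U X : List ℕ} {v : Node} (h : IsReprUp T v (U ++ X))
    (hU : IsTreeNode T U) : IsReprUp T (subtree T U) U := by
  refine ⟨mem_upper_iff.2 ⟨hU, rfl⟩, fun V hV => ?_⟩
  have hV := mem_upper_iff.1 hV
  have h1 := subtree_append_congr hV.2 X
  have h2 : V ++ X ∈ upper T v :=
    mem_upper_iff.2 ⟨isTreeNode_of_subtree_eq h1.symm h.treeNode, h1.trans h.eq_subtree.symm⟩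
  simpa using h.2 _ h2

theorem mem_upper_dst {T V : List ℕ} {f : CEdge} (hf : f ∈ cdawgEdges T)
    (hV : V ∈ upper T f.src) : V ++ f.lab ∈ upper T f.dst := by
  rw [mem_upper_iff] at *
  obtain ⟨h1, h2⟩ := edge_of_src_eq hf hV.2.symm
  exact ⟨h1.2.2.1, h2.symm⟩

theorem isTreeEdge_of_mem_upper {T V : List ℕ} {f : CEdge} (hf : f ∈ cdawgEdges T)
    (hV : V ∈ upper T f.src) : IsTreeEdge T V f.lab :=
  (edge_of_src_eq hf (mem_upper_iff.1 hV).2.symm).1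

/-- Every non-empty upper string goes through some last edge. -/
theorem exists_last_of_mem_upper {T W : List ℕ} {w : Node} (hW : W ∈ upper T w) (h0 : W ≠ []) :
    ∃ g ∈ cdawgEdges T, g.dst = w ∧ ∃ V ∈ upper T g.src, W = V ++ g.lab := by
  rw [mem_upper_iff] at hW
  obtain ⟨V, X, hX, rfl⟩ := exists_last_edge hW.1 h0
  exact ⟨_, hX.mem_cdawgEdges, hW.2, V, mem_upper_iff.2 ⟨hX.2.1, rfl⟩, rfl⟩

theorem last_edge_unique {T V V' : List ℕ} {f g : CEdge} (hf : f ∈ cdawgEdges T)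
    (hg : g ∈ cdawgEdges T) (hV : V ∈ upper T f.src) (hV' : V' ∈ upper T g.src)
    (h : V ++ f.lab = V' ++ g.lab) : f = g := by
  obtain ⟨h1, h2⟩ := (isTreeEdge_of_mem_upper hf hV).last_unique
    (isTreeEdge_of_mem_upper hg hV') h
  subst h1
  rw [mem_upper_iff] at *
  exact edge_ext hf hg (hV.2.symm.trans hV'.2) h2

/-- The upper strings through an edge form an interval. -/
theorem IsText.through_of_between {T V W S : List ℕ} {g : CEdge} (hT : IsText T)
    (hV : V ∈ upper T g.src) (hW : W ∈ upper T g.src)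
    (h1 : V ++ g.lab <:+ S) (h2 : S <:+ W ++ g.lab) : ∃ V' ∈ upper T g.src, S = V' ++ g.lab := by
  obtain ⟨A, rfl⟩ := h1
  rw [← List.append_assoc] at *
  refine ⟨A ++ V, hT.mem_upper_of_between hV hW (List.suffix_append _ _) ?_, rfl⟩
  exact List.suffix_append_self_iff.1 h2

-- The incoming edges of a node, compared by their longest upper strings

/-- The length of the longest upper string through an edge. -/
noncomputable def topLen (T : List ℕ) (f : CEdge) : ℕ := reprUpLen T f.src + f.lab.length

theorem IsReprUp.topLen_eq {T U : List ℕ} {f : CEdge} (h : IsReprUp T f.src U) :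
    topLen T f = (U ++ f.lab).length := by
  simp [topLen, h.reprUpLen_eq]

/-- The longest strings through both edges lie in one class, where a string is determined by its
length, and a string determines its last edge. Hence the order of the incoming edges has no ties. -/
theorem IsText.topLen_inj {T : List ℕ} {f g : CEdge} (hT : IsText T) (hf : f ∈ cdawgEdges T)
    (hg : g ∈ cdawgEdges T) (hd : f.dst = g.dst) (h : topLen T f = topLen T g) : f = g := by
  obtain ⟨U, hU⟩ := exists_isReprUp (src_mem_cdawgNodes hf)
  obtain ⟨V, hV⟩ := exists_isReprUp (src_mem_cdawgNodes hg)
  rw [hU.topLen_eq, hV.topLen_eq] at h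
  refine last_edge_unique hf hg hU.1 hV.1 (hT.upper_eq_of_length (mem_upper_dst hf hU.1) ?_ h)
  rw [hd]; exact mem_upper_dst hg hV.1

theorem topLen_le {T : List ℕ} {f : CEdge} (hf : f ∈ cdawgEdges T) :
    topLen T f ≤ reprUpLen T f.dst := by
  obtain ⟨U, hU⟩ := exists_isReprUp (src_mem_cdawgNodes hf)
  rw [hU.topLen_eq]
  exact length_le_reprUpLen (mem_upper_dst hf hU.1)

/-- The part of a longest upper string before its last edge is itself longest in its class, so the
path in the definition of primary edges must spell `U` before it takes `f`. -/
theorem IsText.isPrimaryUp_iff {T U : List ℕ} {f : CEdge} (hT : IsText T) (hf : f ∈ cdawgEdges T)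
    (hU : IsReprUp T f.src U) : IsPrimaryUp T f ↔ IsReprUp T f.dst (U ++ f.lab) := by
  constructor
  · rintro ⟨π, hπ, hr⟩
    obtain ⟨v, h1, h2⟩ := hπ.of_append
    have hv : v = f.src := by cases h2; rfl
    subst hv
    have hs : pathStr (π ++ [f]) = pathStr π ++ f.lab := by simp [pathStr]
    rw [hs] at hr
    have hm : pathStr π ∈ upper T f.src := ⟨π, h1, rfl⟩
    have := hr.of_append (mem_upper_iff.1 hm).1
    rw [(mem_upper_iff.1 hm).2] at this
    rwa [hT.reprUp_unique hU this]
  · intro h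
    obtain ⟨π, hπ, hs⟩ := hU.1
    refine ⟨π, hπ.append (isPath_singleton hf), ?_⟩
    have : pathStr (π ++ [f]) = U ++ f.lab := by rw [hs]; simp [pathStr]
    rwa [this]

/-- Every non-empty upper string of the target has a last edge `g` and is at most `topLen T g` long,
so comparing the edges suffices to compare all strings of the class. -/
theorem IsText.isPrimaryUp_iff_topLen {T : List ℕ} {f : CEdge} (hT : IsText T)
    (hf : f ∈ cdawgEdges T) :
    IsPrimaryUp T f ↔ ∀ g ∈ cdawgEdges T, g.dst = f.dst → topLen T g ≤ topLen T f := by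
  obtain ⟨U, hU⟩ := exists_isReprUp (src_mem_cdawgNodes hf)
  have hm := mem_upper_dst hf hU.1
  rw [hT.isPrimaryUp_iff hf hU]
  constructor
  · intro h g hg hd
    rw [hU.topLen_eq, ← h.reprUpLen_eq, ← hd]
    exact topLen_le hg
  · intro h
    refine ⟨hm, fun W hW => ?_⟩
    by_cases hW0 : W = []
    · simp [hW0]
    obtain ⟨g, hg, hd, V, hV, rfl⟩ := exists_last_of_mem_upper hW hW0
    obtain ⟨V', hV'⟩ := exists_isReprUp (src_mem_cdawgNodes hg)
    have := h g hg hd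
    rw [hU.topLen_eq, hV'.topLen_eq] at this
    refine le_trans ?_ this
    simpa using hV'.2 V hV

/-! ### Preceding symbols -/

/-- The symbol before the longest string through a secondary edge. -/
theorem IsText.exists_cons_mem_upper {T U : List ℕ} {f : CEdge} (hT : IsText T)
    (hf : f ∈ cdawgEdges T) (hU : IsReprUp T f.src U) (hp : ¬ IsPrimaryUp T f) :
    ∃ c, c :: (U ++ f.lab) ∈ upper T f.dst := by
  have hm := mem_upper_dst hf hU.1
  obtain ⟨W, hW⟩ := exists_isReprUp (dst_mem_cdawgNodes hf)
  -- The longest member is `A ++ (U ++ f.lab)`, with `A` non-empty as `f` is secondary. The last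
  -- symbol of `A` is the required one, since there are no gaps in a class.
  obtain ⟨A, hA⟩ := hT.suffix_of_mem_upper hm hW.1 (hW.2 _ hm)
  rcases List.eq_nil_or_concat' A with rfl | ⟨A, c, rfl⟩
  · refine absurd ((hT.isPrimaryUp_iff hf hU).2 ?_) hp
    simp only [List.nil_append] at hA
    rwa [hA]
  · refine ⟨c, hT.mem_upper_of_between hm hW.1 (List.suffix_cons _ _) ⟨A, by simpa using hA⟩⟩

/-- The symbol `c` does not depend on `D`. This is why the block of the transform that belongs to a
secondary edge is one run, whose symbol may be read off at the canonical suffix. -/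
theorem IsText.cons_suffix {T X D : List ℕ} {c : ℕ} {v : Node} (hT : IsText T)
    (hX : c :: X ∈ upper T v) (hD : D ∈ lower T v) : c :: (X ++ D) <:+ T := by
  rw [mem_upper_iff] at hX
  rw [← hX.2, hT.mem_lower_iff hX.1] at hD
  exact hD.2

theorem IsText.exists_isReprDown {T : List ℕ} {v : Node} (hT : IsText T) (hv : v ∈ cdawgNodes T) :
    ∃ D, IsReprDown T v D := by
  obtain ⟨X, hX, rfl⟩ := hv
  have hfin : (lower T (subtree T X)).Finite := by
    refine Set.Finite.subset (List.finite_toSet T.tails) fun D hD => ?_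
    rw [hT.mem_lower_iff hX] at hD
    simpa using (List.suffix_append X D).trans hD.2
  obtain ⟨D, hD⟩ := exists_suf_of_infix hT.ne_nil hX.infix
  obtain ⟨D, hD, h⟩ := Set.exists_min_image _ id hfin ⟨D, (hT.mem_lower_iff hX).2 hD⟩
  exact ⟨D, hD, h⟩

theorem IsText.exists_isPrecSym {T U : List ℕ} {f : CEdge} {c : ℕ} (hT : IsText T)
    (hf : f ∈ cdawgEdges T) (hU : IsReprUp T f.src U) (hc : c :: (U ++ f.lab) ∈ upper T f.dst) :
    IsPrecSym T f c := by
  obtain ⟨D, hD⟩ := hT.exists_isReprDown (dst_mem_cdawgNodes hf)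
  exact ⟨U ++ f.lab ++ D, ⟨U, D, hU, hD, rfl⟩, hT.cons_suffix hc hD.1⟩

theorem eq_of_cons_suffix {T S : List ℕ} {a b : ℕ} (ha : a :: S <:+ T) (hb : b :: S <:+ T) :
    a = b := by
  have := (List.suffix_of_suffix_length_le ha hb (by simp)).eq_of_length (by simp)
  simpa using this

theorem IsText.precSym_unique {T U : List ℕ} {f : CEdge} {a c : ℕ} (hT : IsText T)
    (ha : IsPrecSym T f a) (hU : IsReprUp T f.src U) (hc : c :: (U ++ f.lab) ∈ upper T f.dst) :
    a = c := by
  obtain ⟨S, ⟨U', D, hU', hD, rfl⟩, h⟩ := ha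
  obtain rfl := hT.reprUp_unique hU hU'
  exact eq_of_cons_suffix h (hT.cons_suffix hc hD.1)

-- Shortest upper strings and their first symbols

/-- `V` is the shortest upper string of `v`. -/
def IsShortest (T : List ℕ) (v : Node) (V : List ℕ) : Prop :=
  V ∈ upper T v ∧ ∀ W ∈ upper T v, V.length ≤ W.length

/-- The first symbol of the shortest upper string. -/
noncomputable def leadSym (T : List ℕ) (v : Node) : ℕ :=
  (Classical.epsilon (IsShortest T v)).headD 0

theorem exists_isShortest {T : List ℕ} {v : Node} (hv : v ∈ cdawgNodes T) :
    ∃ V, IsShortest T v V := by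
  obtain ⟨U, hU⟩ := upper_nonempty hv
  have := WellFounded.min_mem (measure (List.length : List ℕ → ℕ)).wf (upper T v) ⟨U, hU⟩
  refine ⟨_, this, fun W hW => ?_⟩
  have h := WellFounded.not_lt_min (measure (List.length : List ℕ → ℕ)).wf (upper T v) hW
  exact not_lt.1 h

theorem IsText.leadSym_eq {T V : List ℕ} {v : Node} (hT : IsText T) (h : IsShortest T v V) :
    leadSym T v = V.headD 0 := by
  have h' := Classical.epsilon_spec (p := IsShortest T v) ⟨V, h⟩
  unfold leadSym
  rw [hT.upper_eq_of_length h'.1 h.1 (le_antisymm (h'.2 _ h.1) (h.2 _ h'.1))]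

open scoped Classical in
/-- The first symbol of the shortest upper string through an edge. -/
noncomputable def edgeSym (T : List ℕ) (g : CEdge) : ℕ :=
  if g.src = cdawgRoot T then firstSym g else leadSym T g.src

theorem IsText.upper_root {T V : List ℕ} (hT : IsText T) :
    V ∈ upper T (cdawgRoot T) ↔ V = [] := by
  rw [mem_upper_iff]
  constructor
  · rintro ⟨-, h2⟩
    have h1 := (hT.suf_congr (X := []) h2.symm T (by simpa using hT.self_mem_suf)).2.length_le
    simp at h1
    exact h1
  · rintro rfl; exact ⟨isTreeNode_nil T, rfl⟩

/-- The string `V` is empty exactly when the source is the root. Only then does the first symbol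
come from the label of the edge. -/
theorem IsText.edgeSym_eq {T V : List ℕ} {g : CEdge} (hT : IsText T)
    (h : IsShortest T g.src V) : edgeSym T g = (V ++ g.lab).headD 0 := by
  unfold edgeSym
  split_ifs with hr
  · have := h.1
    rw [hr, hT.upper_root] at this
    simp [this, firstSym]
  · rw [hT.leadSym_eq h]
    cases V with
    | nil => exact absurd (mem_upper_iff.1 h.1).2.symm hr
    | cons a V => simp

/-- The shortest string `S` of the target goes through some edge `h`. The longest string through `g`
is at least as long as `S` and, by minimality, at most as long as the longest one through `h`. The
strings through `h` have no gaps, so `g = h`. -/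
theorem IsText.leadSym_dst {T : List ℕ} {g : CEdge} (hT : IsText T) (hg : g ∈ cdawgEdges T)
    (hmin : ∀ h ∈ cdawgEdges T, h.dst = g.dst → topLen T g ≤ topLen T h) :
    leadSym T g.dst = edgeSym T g := by
  obtain ⟨S, hS⟩ := exists_isShortest (dst_mem_cdawgNodes hg)
  obtain ⟨U, hU⟩ := exists_isReprUp (src_mem_cdawgNodes hg)
  have hm := mem_upper_dst hg hU.1
  have hS0 : S ≠ [] := by
    rintro rfl
    have h1 := (mem_upper_iff.1 hS.1).2
    change cdawgRoot T = _ at h1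
    rw [← h1, hT.upper_root] at hm
    simp [lab_ne_nil hg] at hm
  obtain ⟨h, hh, hd, V, hV, rfl⟩ := exists_last_of_mem_upper hS.1 hS0
  obtain ⟨V', hV'⟩ := exists_isReprUp (src_mem_cdawgNodes hh)
  have hle := hmin h hh hd
  rw [hU.topLen_eq, hV'.topLen_eq] at hle
  have hm' := mem_upper_dst hh hV'.1
  rw [hd] at hm'
  obtain ⟨V'', hV'', he⟩ := hT.through_of_between hV hV'.1
    (hT.suffix_of_mem_upper hS.1 hm (hS.2 _ hm)) (hT.suffix_of_mem_upper hm hm' hle)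
  obtain rfl := last_edge_unique hg hh hU.1 hV'' he
  rw [hT.leadSym_eq hS]
  refine (hT.edgeSym_eq ⟨hV, fun W hW => ?_⟩).symm
  simpa using hS.2 _ (mem_upper_dst hg hW)

/-- Here `g` is the next incoming edge above `f`. The string that extends the longest one through
`f` by the preceding symbol must be the shortest one through `g`, as the strings through the
incoming edges form adjacent intervals. -/
theorem IsText.precSym_eq {T : List ℕ} {f g : CEdge} {c : ℕ} (hT : IsText T)
    (hf : f ∈ cdawgEdges T) (hg : g ∈ cdawgEdges T) (hd : f.dst = g.dst)
    (hlt : topLen T f < topLen T g)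
    (hmin : ∀ h ∈ cdawgEdges T, h.dst = f.dst → topLen T f < topLen T h →
      topLen T g ≤ topLen T h)
    (hc : IsPrecSym T f c) : c = edgeSym T g := by
  obtain ⟨U, hU⟩ := exists_isReprUp (src_mem_cdawgNodes hf)
  obtain ⟨V, hV⟩ := exists_isReprUp (src_mem_cdawgNodes hg)
  have hp : ¬ IsPrimaryUp T f := by
    rw [hT.isPrimaryUp_iff_topLen hf]
    push Not
    exact ⟨g, hg, hd.symm, hlt⟩
  obtain ⟨a, ha⟩ := hT.exists_cons_mem_upper hf hU hp
  obtain rfl := hT.precSym_unique hc hU ha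
  obtain ⟨h, hh, hhd, W, hW, he⟩ := exists_last_of_mem_upper ha (by simp)
  obtain ⟨W', hW'⟩ := exists_isReprUp (src_mem_cdawgNodes hh)
  have hmf := mem_upper_dst hf hU.1
  have hmg := mem_upper_dst hg hV.1
  rw [← hd] at hmg
  have hmh := mem_upper_dst hh hW'.1
  rw [hhd] at hmh
  have h1 : topLen T f < topLen T h := by
    rw [hU.topLen_eq, hW'.topLen_eq]
    have h2 := congrArg List.length he
    have h3 := hW'.2 W hW
    simp at *
    omega
  have h2 := hmin h hh hhd h1
  rw [hU.topLen_eq, hV.topLen_eq] at hlt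
  rw [hV.topLen_eq, hW'.topLen_eq] at h2
  obtain ⟨W'', hW'', he'⟩ := hT.through_of_between hW hW'.1
    (he ▸ hT.suffix_of_mem_upper ha hmg (by simpa using hlt)) (hT.suffix_of_mem_upper hmg hmh h2)
  obtain rfl := last_edge_unique hg hh hV.1 hW'' he'
  rw [hT.edgeSym_eq (V := W), ← he]
  · rfl
  -- If a shorter `X` existed at the source of `g`, the longest string through `f` would lie between
  -- two strings through `g`, which forces `f = g`.
  · refine ⟨hW, fun X hX => ?_⟩
    by_contra! hlt'
    have hmX := mem_upper_dst hg hX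
    rw [hhd] at hmX
    have h3 := congrArg List.length he
    simp only [List.length_append, List.length_cons] at h3 hlt
    obtain ⟨Y, hY, hYe⟩ := hT.through_of_between hX hV.1
      (hT.suffix_of_mem_upper hmX hmf (by simp; omega))
      (hT.suffix_of_mem_upper hmf hmg (by simp; omega))
    have := last_edge_unique hf hg hU.1 hY hYe
    subst this
    obtain rfl := hT.reprUp_unique hU hV
    omega

/-! ### Run-length encodings -/

theorem rlConcat_nil_left (R : List (ℕ × ℕ)) : rlConcat [] R = R := by simp [rlConcat]

theorem rlConcat_nil_right (A : List (ℕ × ℕ)) : rlConcat A [] = A := by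
  unfold rlConcat; split <;> simp_all

theorem rlConcat_concat_cons (A : List (ℕ × ℕ)) (x y : ℕ × ℕ) (R : List (ℕ × ℕ)) :
    rlConcat (A ++ [x]) (y :: R) =
      if x.1 = y.1 then A ++ (x.1, x.2 + y.2) :: R else A ++ x :: y :: R := by
  obtain ⟨c, k⟩ := x
  obtain ⟨d, m⟩ := y
  simp [rlConcat]

theorem rlConcat_append_right (A : List (ℕ × ℕ)) (x : ℕ × ℕ) (B D : List (ℕ × ℕ)) :
    rlConcat A (x :: B ++ D) = rlConcat A [x] ++ B ++ D := by
  rcases List.eq_nil_or_concat' A with rfl | ⟨A, y, rfl⟩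
  · simp [rlConcat_nil_left]
  · simp only [List.cons_append, rlConcat_concat_cons]
    split_ifs <;> simp

theorem rlConcat_append_left (A B D : List (ℕ × ℕ)) (x : ℕ × ℕ) :
    rlConcat (A ++ (B ++ [x])) D = A ++ rlConcat (B ++ [x]) D := by
  cases D with
  | nil => simp [rlConcat_nil_right]
  | cons y D =>
    rw [← List.append_assoc, rlConcat_concat_cons, rlConcat_concat_cons]
    split_ifs <;> simp

/-- If `B` has at least two runs, the two merges happen at different ends of `B`. The only delicate
case is a single run, which may merge with both neighbours. -/
theorem rlConcat_assoc (A B D : List (ℕ × ℕ)) :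
    rlConcat (rlConcat A B) D = rlConcat A (rlConcat B D) := by
  rcases List.eq_nil_or_concat' B with rfl | ⟨B, y, rfl⟩
  · simp [rlConcat_nil_left, rlConcat_nil_right]
  cases B with
  | nil =>
    rcases List.eq_nil_or_concat' A with rfl | ⟨A, x, rfl⟩
    · simp [rlConcat_nil_left]
    cases D with
    | nil => simp [rlConcat_nil_right]
    | cons z D =>
      have h1 : rlConcat [y] (z :: D) = _ := rlConcat_concat_cons [] y z D
      rw [List.nil_append, h1, rlConcat_concat_cons]
      obtain ⟨a, i⟩ := x
      obtain ⟨b, j⟩ := y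
      obtain ⟨c, k⟩ := z
      simp only [List.nil_append]
      by_cases hab : a = b <;> by_cases hbc : b = c
      · subst hab hbc
        simp [rlConcat_concat_cons, Nat.add_assoc]
      · subst hab
        simp [rlConcat_concat_cons, hbc]
      · subst hbc
        have := rlConcat_concat_cons (A ++ [(a, i)]) (b, j) (b, k) D
        simp only [List.append_assoc, List.cons_append, List.nil_append] at this
        simp [rlConcat_concat_cons, hab, this]
      · have := rlConcat_concat_cons (A ++ [(a, i)]) (b, j) (c, k) D
        simp only [List.append_assoc, List.cons_append, List.nil_append] at this
        simp [rlConcat_concat_cons, hab, this, hbc]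
  | cons x B =>
    rw [rlConcat_append_right, List.append_assoc, rlConcat_append_left,
      show x :: B ++ [y] = [x] ++ (B ++ [y]) from rfl, rlConcat_append_left,
      List.singleton_append]
    have := rlConcat_append_right A x [] (rlConcat (B ++ [y]) D)
    simpa using this.symm

theorem runLength_cons (a : ℕ) (l : List ℕ) :
    runLength (a :: l) = rlConcat [(a, 1)] (runLength l) := by
  rw [runLength]
  cases h : runLength l with
  | nil => simp [rlConcat_nil_right]
  | cons x R =>
    have := rlConcat_concat_cons [] (a, 1) x R
    simp only [List.nil_append] at this
    rw [this]
    obtain ⟨b, k⟩ := x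
    simp only
    split_ifs with hab
    · simp [hab, Nat.add_comm]
    · rfl

/-- Encoding turns concatenation into `rlConcat`, so the encoded transform can be assembled from the
pieces that belong to the edges. -/
theorem runLength_append (l m : List ℕ) :
    runLength (l ++ m) = rlConcat (runLength l) (runLength m) := by
  induction l with
  | nil => simp [runLength, rlConcat_nil_left]
  | cons a l ih => rw [List.cons_append, runLength_cons, ih, runLength_cons, rlConcat_assoc]

theorem runLength_replicate (c k : ℕ) : runLength (List.replicate (k + 1) c) = [(c, k + 1)] := by
  induction k with
  | zero => simp [runLength]
  | succ k ih =>
    rw [List.replicate_succ, runLength, ih]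
    simp

/-- The length of the encoded string. -/
def runTotal (A : List (ℕ × ℕ)) : ℕ := (A.map Prod.snd).sum

theorem runTotal_rlConcat (A R : List (ℕ × ℕ)) :
    runTotal (rlConcat A R) = runTotal A + runTotal R := by
  rcases List.eq_nil_or_concat' A with rfl | ⟨A, x, rfl⟩
  · simp [rlConcat_nil_left, runTotal]
  cases R with
  | nil => simp [rlConcat_nil_right, runTotal]
  | cons y R =>
    rw [rlConcat_concat_cons]
    split_ifs <;> simp [runTotal] <;> omega

theorem runTotal_runLength (l : List ℕ) : runTotal (runLength l) = l.length := by
  induction l with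
  | nil => simp [runLength, runTotal]
  | cons a l ih =>
    rw [runLength_cons, runTotal_rlConcat, ih]
    simp [runTotal, Nat.add_comm]

theorem length_rlConcat_le (A R : List (ℕ × ℕ)) :
    (rlConcat A R).length ≤ A.length + R.length := by
  rcases List.eq_nil_or_concat' A with rfl | ⟨A, x, rfl⟩
  · simp [rlConcat_nil_left]
  cases R with
  | nil => simp [rlConcat_nil_right]
  | cons y R =>
    rw [rlConcat_concat_cons]
    split_ifs
    · simp
    · simp; omega

/-! ### The sorted suffixes -/

/-- The suffixes in lexicographic order. -/
def sortedSufs (T : List ℕ) : List (List ℕ) := (suffixArray T).map (T.drop ·)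

/-- The symbol that cyclically precedes a suffix. -/
def precOf (T S : List ℕ) : ℕ :=
  if S.length = T.length then T.getD (T.length - 1) 0 else T.getD (T.length - S.length - 1) 0

theorem mem_suffixArray {T : List ℕ} {p : ℕ} : p ∈ suffixArray T ↔ p < T.length := by
  rw [suffixArray, (List.mergeSort_perm _ _).mem_iff, List.mem_range]

theorem bwt_eq_map (T : List ℕ) : bwt T = (sortedSufs T).map (precOf T) := by
  rw [bwt, sortedSufs, List.map_map]
  refine List.map_congr_left fun p hp => ?_
  rw [mem_suffixArray] at hp
  simp only [Function.comp, precOf, List.length_drop]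
  by_cases h : p = 0
  · simp [h]
  · rw [if_neg h, if_neg (by omega)]
    congr 1
    omega

theorem mem_sortedSufs {T S : List ℕ} : S ∈ sortedSufs T ↔ S ∈ Suf T := by
  simp only [sortedSufs, List.mem_map, mem_suffixArray, Suf, Set.mem_ofPred_eq]
  constructor
  · rintro ⟨p, hp, rfl⟩
    exact ⟨by simpa using hp, List.drop_suffix _ _⟩
  · rintro ⟨h0, hs⟩
    have := List.length_pos_of_ne_nil h0
    have := hs.length_le
    exact ⟨T.length - S.length, by omega, (List.suffix_iff_eq_drop.1 hs).symm⟩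

theorem pairwise_sortedSufs (T : List ℕ) : (sortedSufs T).Pairwise (· < ·) := by
  have h1 : (suffixArray T).Pairwise (fun p q => T.drop p ≤ T.drop q) := by
    have := List.pairwise_mergeSort (le := fun p q => decide (T.drop p ≤ T.drop q))
      (fun a b c hab hbc => by simp at *; exact hab.trans hbc)
      (fun a b => by simpa using le_total _ _) (List.range T.length)
    simp only [decide_eq_true_eq] at this
    exact this
  have h2 : (suffixArray T).Nodup := (List.mergeSort_perm _ _).nodup_iff.2 List.nodup_range
  rw [sortedSufs, List.pairwise_map]
  refine (h1.and h2).imp_of_mem fun {a b} ha hb h => ?_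
  rw [mem_suffixArray] at ha hb
  refine lt_of_le_of_ne h.1 fun he => h.2 ?_
  have := congrArg List.length he
  simp at this
  omega

theorem length_sortedSufs (T : List ℕ) : (sortedSufs T).length = T.length := by
  simp [sortedSufs, suffixArray]

theorem precOf_eq {T S : List ℕ} {c : ℕ} (h : c :: S <:+ T) : precOf T S = c := by
  obtain ⟨A, rfl⟩ := h
  have h1 : A.length + (S.length + 1) - S.length - 1 = A.length := by omega
  rw [precOf, if_neg (by simp; omega)]
  simp [h1]

/-- The sorted suffixes with a given prefix. -/
def below (T U : List ℕ) : List (List ℕ) := (sortedSufs T).filter (fun S => U.isPrefixOf S)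

theorem mem_below {T U S : List ℕ} : S ∈ below T U ↔ S ∈ Suf T ∧ U <+: S := by
  simp [below, mem_sortedSufs]

theorem pairwise_below (T U : List ℕ) : (below T U).Pairwise (· < ·) :=
  (pairwise_sortedSufs T).filter _

theorem below_nil (T : List ℕ) : below T [] = sortedSufs T := by
  simp [below]

theorem IsText.below_suf {T U : List ℕ} (hT : IsText T) (hU : U ∈ Suf T) : below T U = [U] := by
  refine List.Pairwise.eq_of_mem_iff (pairwise_below T U) (by simp) fun S => ?_
  rw [mem_below, List.mem_singleton]
  constructor
  · rintro ⟨h1, Z, rfl⟩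
    rw [hT.suf_append hU h1.2.isInfix]; simp
  · rintro rfl; exact ⟨hU, List.prefix_rfl⟩

theorem append_cons_lt {U X Y : List ℕ} {a b : ℕ} (h : a < b) : U ++ a :: X < U ++ b :: Y := by
  induction U with
  | nil => exact List.Lex.rel h
  | cons u U ih => exact List.Lex.cons ih

/-- The suffixes below `U` are grouped by the edge they follow, and the groups are ordered by the
first symbols of the labels. Both sides are strictly sorted lists with the same members. As `U` is
not a suffix itself, no suffix stops at `U`. -/
theorem below_eq_flatMap {T U : List ℕ} {es : List CEdge}
    (hU : IsTreeNode T U) (hs : U ∉ Suf T) (hes : IsOutList T (subtree T U) es) :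
    below T U = es.flatMap (fun f => below T (U ++ f.lab)) := by
  refine List.Pairwise.eq_of_mem_iff (pairwise_below T U) ?_ fun S => ?_
  · rw [List.pairwise_flatMap]
    refine ⟨fun f _ => pairwise_below T _, hes.1.imp_of_mem fun {f g} hf hg hfg => ?_⟩
    intro S hS S' hS'
    obtain ⟨-, Z, rfl⟩ := mem_below.1 hS
    obtain ⟨-, Z', rfl⟩ := mem_below.1 hS'
    have h1 := lab_ne_nil ((hes.2 f).1 hf).1
    have h2 := lab_ne_nil ((hes.2 g).1 hg).1
    unfold firstSym at hfg
    cases hx : f.lab with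
    | nil => exact absurd hx h1
    | cons a X =>
      cases hy : g.lab with
      | nil => exact absurd hy h2
      | cons b Y =>
        rw [hx, hy] at hfg
        simpa using append_cons_lt (U := U) (X := X ++ Z) (Y := Y ++ Z') (by simpa using hfg)
  · simp only [List.mem_flatMap, mem_below]
    constructor
    · rintro ⟨h1, Z, rfl⟩
      have hZ : Z ≠ [] := by rintro rfl; exact hs (by simpa using h1)
      obtain ⟨X, hX, hXZ⟩ := exists_first_edge hU hZ (Suf.isTreeNode h1)
      refine ⟨_, (hes.2 _).2 ⟨hX.mem_cdawgEdges, rfl⟩, h1, ?_⟩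
      simpa using hXZ
    · rintro ⟨f, -, h1, h2⟩
      exact ⟨h1, (List.prefix_append _ _).trans h2⟩

theorem IsText.length_below {T U : List ℕ} (hT : IsText T) (hU : IsTreeNode T U) :
    (below T U).length = nleaves T (subtree T U) := by
  have h1 : {D | D ∈ lower T (subtree T U)}.ncard = ({S | S ∈ below T U} : Set (List ℕ)).ncard := by
    refine Set.ncard_congr (fun D _ => U ++ D) ?_ ?_ ?_
    · intro D hD
      have := (hT.mem_lower_iff hU).1 hD
      exact mem_below.2 ⟨this, List.prefix_append _ _⟩
    · intro D E _ _ h; simpa using h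
    · intro S hS
      obtain ⟨h1, Z, rfl⟩ := mem_below.1 hS
      exact ⟨Z, (hT.mem_lower_iff hU).2 h1, rfl⟩
  have h2 : (below T U).Nodup := (pairwise_below T U).imp fun h => h.ne
  rw [nleaves, ← Set.ofPred_mem_eq (s := lower T (subtree T U)), h1]
  rw [show {S | S ∈ below T U} = ((below T U).toFinset : Set (List ℕ)) by ext; simp,
    Set.ncard_coe_finset, List.toFinset_card_of_nodup h2]

theorem IsText.nleaves_pos {T : List ℕ} {v : Node} (hT : IsText T) (hv : v ∈ cdawgNodes T) :
    0 < nleaves T v := by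
  obtain ⟨U, hU, rfl⟩ := hv
  rw [← hT.length_below hU]
  obtain ⟨D, hD⟩ := exists_suf_of_infix hT.ne_nil hU.infix
  exact List.length_pos_of_mem (mem_below.2 ⟨hD, List.prefix_append _ _⟩)

theorem IsText.nleaves_sink {T : List ℕ} (hT : IsText T) : nleaves T (cdawgSink T) = 1 := by
  rw [cdawgSink, ← hT.length_below (Suf.isTreeNode hT.self_mem_suf), hT.below_suf hT.self_mem_suf]
  rfl

theorem IsText.nleaves_eq_sum {T : List ℕ} {v : Node} {es : List CEdge} (hT : IsText T)
    (hv : v ∈ cdawgNodes T) (hs : v ≠ cdawgSink T) (hes : IsOutList T v es) :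
    nleaves T v = (es.map fun f => nleaves T f.dst).sum := by
  obtain ⟨U, hU, rfl⟩ := hv
  rw [Ne, hT.subtree_eq_sink_iff hU] at hs
  rw [← hT.length_below hU, below_eq_flatMap hU hs hes, List.length_flatMap]
  congr 1
  refine List.map_congr_left fun f hf => ?_
  obtain ⟨h1, h2⟩ := (hes.2 f).1 hf
  obtain ⟨h3, h4⟩ := edge_of_src_eq h1 h2
  rw [h4, hT.length_below h3.2.2.1]

/-- The Burrows-Wheeler transform below a secondary edge consists of one symbol. -/
theorem IsText.map_precOf_below {T X : List ℕ} {v : Node} {c : ℕ} (hT : IsText T)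
    (hX : IsTreeNode T X) (hv : subtree T X = v) (hc : c :: X ∈ upper T v) :
    (below T X).map (precOf T) = List.replicate (nleaves T v) c := by
  rw [List.eq_replicate_iff]
  subst hv
  refine ⟨by rw [List.length_map, hT.length_below hX], fun b hb => ?_⟩
  obtain ⟨S, hS, rfl⟩ := List.mem_map.1 hb
  obtain ⟨h1, D, rfl⟩ := mem_below.1 hS
  exact precOf_eq (hT.cons_suffix hc ((hT.mem_lower_iff hX).2 h1))

/-! ### The run of the recursive procedure -/

theorem finite_out (T : List ℕ) (v : Node) : {f | f ∈ cdawgEdges T ∧ f.src = v}.Finite := by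
  by_cases hv : v ∈ cdawgNodes T
  · obtain ⟨U, hU, rfl⟩ := hv
    have h1 : {X | IsTreeEdge T U X}.Finite := by
      refine Set.Finite.subset (List.finite_toSet T.sublists) fun X hX => ?_
      simpa using ((List.suffix_append U X).isInfix.trans hX.2.2.1.infix).sublist
    refine Set.Finite.subset (h1.image fun X => (⟨subtree T U, X, subtree T (U ++ X)⟩ : CEdge)) ?_
    rintro f ⟨hf, hs⟩
    obtain ⟨h2, h3⟩ := edge_of_src_eq hf hs
    exact ⟨f.lab, h2, CEdge.ext' hs.symm rfl h3.symm⟩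
  · refine Set.Finite.subset Set.finite_empty ?_
    rintro f ⟨hf, rfl⟩
    exact hv (src_mem_cdawgNodes hf)

theorem edge_eq_of_firstSym {T : List ℕ} {f g : CEdge} (hf : f ∈ cdawgEdges T)
    (hg : g ∈ cdawgEdges T) (hs : f.src = g.src) (h : firstSym f = firstSym g) : f = g := by
  obtain ⟨U, hU, he⟩ := src_mem_cdawgNodes hf
  exact edge_ext hf hg hs
    ((edge_of_src_eq hf he).1.eq_of_head (edge_of_src_eq hg (hs ▸ he)).1 h)

theorem exists_isOutList (T : List ℕ) (v : Node) : ∃ es, IsOutList T v es := by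
  classical
  let l := (finite_out T v).toFinset.toList
  let es := l.mergeSort (fun f g => decide (firstSym f ≤ firstSym g))
  have hmem : ∀ f, f ∈ es ↔ f ∈ cdawgEdges T ∧ f.src = v := by
    intro f
    rw [(List.mergeSort_perm _ _).mem_iff, Finset.mem_toList, Set.Finite.mem_toFinset]
    rfl
  refine ⟨es, ?_, hmem⟩
  have h1 : es.Pairwise fun f g => firstSym f ≤ firstSym g := by
    have := List.pairwise_mergeSort (le := fun f g => decide (firstSym f ≤ firstSym g))
      (fun a b c hab hbc => by simp at *; exact hab.trans hbc)
      (fun a b => by simpa using le_total _ _) l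
    simpa only [decide_eq_true_eq] using this
  have h2 : es.Nodup := (List.mergeSort_perm _ _).nodup_iff.2 (Finset.nodup_toList _)
  refine (h1.and h2).imp_of_mem fun {f g} hf hg h => lt_of_le_of_ne h.1 fun he => h.2 ?_
  rw [hmem] at hf hg
  exact edge_eq_of_firstSym hf.1 hg.1 (hf.2.trans hg.2.symm) he

theorem IsOutList.unique {T : List ℕ} {v : Node} {es es' : List CEdge} (h : IsOutList T v es)
    (h' : IsOutList T v es') : es = es' := by
  have : Std.Irrefl (fun f g : CEdge => firstSym f < firstSym g) := ⟨fun _ => lt_irrefl _⟩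
  have : Std.Antisymm (fun f g : CEdge => firstSym f < firstSym g) :=
    ⟨fun _ _ h1 h2 => absurd h1 h2.asymm⟩
  exact List.Pairwise.eq_of_mem_iff h.1 h'.1 fun f => (h.2 f).trans (h'.2 f).symm

theorem IsText.isOutList_sink {T : List ℕ} (hT : IsText T) : IsOutList T (cdawgSink T) [] := by
  refine ⟨List.Pairwise.nil, fun f => ⟨fun h => by simp at h, fun ⟨hf, hs⟩ => ?_⟩⟩
  have h1 := (edge_of_src_eq hf hs).1
  exact absurd (hT.suf_append hT.self_mem_suf h1.2.2.1.infix) h1.1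

theorem IsText.root_ne_sink {T : List ℕ} (hT : IsText T) : cdawgRoot T ≠ cdawgSink T := by
  intro h
  have := (hT.subtree_eq_sink_iff (isTreeNode_nil T)).1 h
  exact this.1 rfl

/-- A node that is neither the root nor the sink has at least two outgoing edges. -/
theorem IsText.two_le_length_out {T : List ℕ} {v : Node} {es : List CEdge} (hT : IsText T)
    (hv : v ∈ cdawgNodes T) (hr : v ≠ cdawgRoot T) (hs : v ≠ cdawgSink T)
    (hes : IsOutList T v es) : 2 ≤ es.length := by
  obtain ⟨U, hU, rfl⟩ := hv
  rw [Ne, hT.subtree_eq_sink_iff hU] at hs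
  have hU' := hU
  rcases hU with rfl | hU | ⟨a, b, hab, ha, hb⟩
  · exact absurd rfl hr
  · exact absurd hU hs
  have key : ∀ c, U ++ [c] <:+: T → ∃ f ∈ es, firstSym f = c := by
    intro c hc
    obtain ⟨D, hD⟩ := exists_suf_of_infix hT.ne_nil hc
    obtain ⟨X, hX, hXD⟩ := exists_first_edge hU' (Z := [c] ++ D) (by simp)
      (by simpa using Suf.isTreeNode hD)
    refine ⟨_, (hes.2 _).2 ⟨hX.mem_cdawgEdges, rfl⟩, ?_⟩
    cases X with
    | nil => exact absurd rfl hX.1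
    | cons x X =>
      rw [List.singleton_append, List.cons_prefix_cons] at hXD
      exact hXD.1
  obtain ⟨f, hf, rfl⟩ := key a ha
  obtain ⟨g, hg, rfl⟩ := key b hb
  have hfg : f ≠ g := fun h => hab (h ▸ rfl)
  match es, hf, hg with
  | [], hf, _ => simp at hf
  | [x], hf, hg => simp at hf hg; exact absurd (hf.trans hg.symm) hfg
  | x :: y :: es, _, _ => simp

theorem IsText.out_ne_nil {T : List ℕ} {v : Node} {es : List CEdge} (hT : IsText T)
    (hv : v ∈ cdawgNodes T) (hs : v ≠ cdawgSink T) (hes : IsOutList T v es) : es ≠ [] := by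
  obtain ⟨U, hU, rfl⟩ := hv
  rw [Ne, hT.subtree_eq_sink_iff hU] at hs
  obtain ⟨D, hD⟩ := exists_suf_of_infix hT.ne_nil hU.infix
  obtain ⟨X, hX, -⟩ := exists_first_edge hU (Z := D) (by rintro rfl; exact hs (by simpa using hD))
    (Suf.isTreeNode hD)
  exact List.ne_nil_of_mem ((hes.2 _).2 ⟨hX.mem_cdawgEdges, rfl⟩)

/-- The edges handled below `U`: those that start at a node whose representative extends `U`. -/
def edgesBelow (T U : List ℕ) : Set CEdge :=
  {f | f ∈ cdawgEdges T ∧ ∃ V, IsReprUp T f.src V ∧ U <+: V}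

/-- The part of the transform that is due to the edge out of `U` labeled `X`. -/
def bwtBelow (T U : List ℕ) : List ℕ := (below T U).map (precOf T)

/-- The loop invariant, where `l` is the part of the transform produced so far. Only primary edges
need the recursive hypothesis, as only they lead from the representative `U` to a representative. -/
theorem IsText.exists_recLoop {T U : List ℕ} {v : Node} (hT : IsText T) (hU : IsReprUp T v U)
    (es : List CEdge) (hes : ∀ f ∈ es, f ∈ cdawgEdges T ∧ f.src = v)
    (hsort : es.Pairwise fun f g => firstSym f < firstSym g)
    (hrec : ∀ f ∈ es, IsReprUp T f.dst (U ++ f.lab) →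
      ∃ tr, RecRBWT T f.dst (runLength (bwtBelow T (U ++ f.lab))) tr ∧ tr.Nodup ∧
        ∀ g, g ∈ tr ↔ g ∈ edgesBelow T (U ++ f.lab)) (l : List ℕ) :
    ∃ tr, RecLoop T es (runLength l)
        (runLength (l ++ es.flatMap fun f => bwtBelow T (U ++ f.lab))) tr ∧ tr.Nodup ∧
      ∀ g, g ∈ tr ↔ g ∈ es ∨
        ∃ f ∈ es, IsReprUp T f.dst (U ++ f.lab) ∧ g ∈ edgesBelow T (U ++ f.lab) := by
  induction es generalizing l with
  | nil => exact ⟨[], by simpa using RecLoop.done _, by simp, by simp⟩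
  | cons f es ih =>
    obtain ⟨hf, hfs⟩ := hes f (by simp)
    obtain ⟨hlt, hsort'⟩ := List.pairwise_cons.1 hsort
    have hUf : IsReprUp T f.src U := hfs.symm ▸ hU
    have hte := isTreeEdge_of_mem_upper hf hUf.1
    obtain ⟨tr, h1, h2, h3⟩ := ih (fun g hg => hes g (by simp [hg])) hsort'
      (fun g hg => hrec g (by simp [hg])) (l ++ bwtBelow T (U ++ f.lab))
    -- Two different edges out of `U` have no common extension, so the edges handled below them are
    -- disjoint.
    have hnot : ∀ W g, g ∈ es → U ++ g.lab <+: W → ¬ U ++ f.lab <+: W := by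
      intro W g hg hgW hfW
      obtain ⟨Z, rfl⟩ := hgW
      obtain ⟨hgE, hgs⟩ := hes g (by simp [hg])
      have h4 : f.lab <+: g.lab ++ Z := by simpa using hfW
      have h5 := hte.eq_of_common (isTreeEdge_of_mem_upper hgE (hgs.symm ▸ hU.1)) h4
        (List.prefix_append _ _)
      have := hlt g hg
      simp [firstSym, h5] at this
    have hff : f ∉ es := fun h => lt_irrefl _ (hlt f h)
    have hftr : f ∉ tr := by
      rw [h3]
      rintro (h | ⟨g, hg, -, -, V, hV, h⟩)
      · exact hff h
      · obtain rfl := hT.reprUp_unique hUf hV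
        have h6 := h.length_le
        have := List.length_pos_of_ne_nil (lab_ne_nil (hes g (by simp [hg])).1)
        rw [List.length_append] at h6
        omega
    simp only [List.flatMap_cons]
    rw [List.append_assoc] at h1
    by_cases hp : IsReprUp T f.dst (U ++ f.lab)
    · obtain ⟨tr', g1, g2, g3⟩ := hrec f (by simp) hp
      refine ⟨f :: tr' ++ tr, RecLoop.primary ((hT.isPrimaryUp_iff hf hUf).2 hp) g1 ?_, ?_, ?_⟩
      · rwa [← runLength_append]
      · rw [List.cons_append, List.nodup_cons, List.mem_append, List.nodup_append']
        refine ⟨?_, g2, h2, ?_⟩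
        · rintro (h | h)
          · obtain ⟨-, V, hV, h⟩ := (g3 f).1 h
            obtain rfl := hT.reprUp_unique hUf hV
            have h6 := h.length_le
            have := List.length_pos_of_ne_nil (lab_ne_nil hf)
            rw [List.length_append] at h6
            omega
          · exact hftr h
        · intro g hg hg'
          obtain ⟨-, V, hV, hpre⟩ := (g3 g).1 hg
          rcases (h3 g).1 hg' with h | ⟨e, he, -, -, V', hV', h⟩
          · have := (hes g (by simp [h])).2
            rw [this] at hV
            obtain rfl := hT.reprUp_unique hU hV
            have h6 := hpre.length_le
            have := List.length_pos_of_ne_nil (lab_ne_nil hf)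
            rw [List.length_append] at h6
            omega
          · obtain rfl := hT.reprUp_unique hV hV'
            exact hnot _ e he h hpre
      · intro g
        simp only [List.cons_append, List.mem_cons, List.mem_append, h3, g3]
        constructor
        · rintro (h | h | h | ⟨e, he, h⟩)
          · exact Or.inl (Or.inl h)
          · exact Or.inr ⟨f, Or.inl rfl, hp, h⟩
          · exact Or.inl (Or.inr h)
          · exact Or.inr ⟨e, Or.inr he, h⟩
        · rintro ((h | h) | ⟨e, rfl | he, h⟩)
          · exact Or.inl h
          · exact Or.inr (Or.inr (Or.inl h))
          · exact Or.inr (Or.inl h.2)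
          · exact Or.inr (Or.inr (Or.inr ⟨e, he, h⟩))
    · have hnp : ¬ IsPrimaryUp T f := fun h => hp ((hT.isPrimaryUp_iff hf hUf).1 h)
      obtain ⟨c, hc⟩ := hT.exists_cons_mem_upper hf hUf hnp
      have hm := mem_upper_iff.1 (mem_upper_dst hf hUf.1)
      refine ⟨f :: tr, RecLoop.secondary hnp (hT.exists_isPrecSym hf hUf hc) ?_,
        List.nodup_cons.2 ⟨hftr, h2⟩, ?_⟩
      -- The number of leaves is positive, so that the single emitted run is the encoding of a
      -- non-empty block.
      · obtain ⟨k, hk⟩ := Nat.exists_eq_add_of_lt (hT.nleaves_pos (dst_mem_cdawgNodes hf))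
        rw [zero_add] at hk
        rw [hk, ← runLength_replicate, ← runLength_append, ← hk,
          ← hT.map_precOf_below hm.1 hm.2 hc]
        exact h1
      · intro g
        simp only [List.mem_cons, h3]
        constructor
        · rintro (h | h | ⟨e, he, h⟩)
          · exact Or.inl (Or.inl h)
          · exact Or.inl (Or.inr h)
          · exact Or.inr ⟨e, Or.inr he, h⟩
        · rintro ((h | h) | ⟨e, rfl | he, h⟩)
          · exact Or.inl h
          · exact Or.inr (Or.inl h)
          · exact absurd h.1 hp
          · exact Or.inr (Or.inr ⟨e, he, h⟩)

/-- Induction on the distance of the representative `U` from the full length of the text. Each call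
is identified with its representative, and an edge is handled below `U` exactly when the
representative of its source extends `U`. -/
theorem IsText.exists_recRBWT {T U : List ℕ} {v : Node} (hT : IsText T) (hU : IsReprUp T v U) :
    ∃ tr, RecRBWT T v (runLength (bwtBelow T U)) tr ∧ tr.Nodup ∧
      ∀ g, g ∈ tr ↔ g ∈ edgesBelow T U := by
  induction hn : T.length - U.length using Nat.strong_induction_on generalizing U v with
  | _ n ih =>
  have hv := hU.eq_subtree
  by_cases hs : v = cdawgSink T
  · have hUT : U = T := by
      refine hT.reprUp_unique hU (hs ▸ ⟨mem_upper_iff.2 ⟨Suf.isTreeNode hT.self_mem_suf, rfl⟩, ?_⟩)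
      exact fun V hV => (mem_upper_iff.1 hV).1.infix.length_le
    obtain ⟨d, hd⟩ : ∃ d, T.getLast? = some d := ⟨_, List.getLast?_eq_some_getLast hT.ne_nil⟩
    refine ⟨[], ?_, List.nodup_nil, fun g => ?_⟩
    · have h1 : bwtBelow T U = [d] := by
        rw [bwtBelow, hUT, hT.below_suf hT.self_mem_suf]
        simp only [List.map_cons, List.map_nil, precOf, if_true]
        rw [List.getLast?_eq_getElem?] at hd
        simp [List.getD, hd]
      rw [h1]
      exact RecRBWT.sink d (hs ▸ hT.isOutList_sink) hd
    · simp only [List.not_mem_nil, false_iff]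
      rintro ⟨hg, V, hV, hpre⟩
      have h1 : V = T := by
        obtain ⟨A, B, h⟩ := hV.treeNode.infix
        rw [hUT] at hpre
        refine (hpre.eq_of_length (le_antisymm hpre.length_le ?_)).symm
        rw [← h]; simp; omega
      have h2 : g.src = cdawgSink T := by rw [hV.eq_subtree, h1]; rfl
      have := (hT.isOutList_sink.2 g).2 ⟨hg, h2⟩
      simp at this
  · obtain ⟨es, hes⟩ := exists_isOutList T v
    have hvn : v ∈ cdawgNodes T := hv ▸ mem_cdawgNodes_of_treeNode hU.treeNode
    have hsuf : U ∉ Suf T := by rwa [← hT.subtree_eq_sink_iff hU.treeNode, ← hv]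
    obtain ⟨tr, h1, h2, h3⟩ := hT.exists_recLoop hU es (fun f hf => (hes.2 f).1 hf) hes.1
      (fun f hf hr => by
        have := hr.treeNode.infix.length_le
        have := List.length_pos_of_ne_nil (lab_ne_nil ((hes.2 f).1 hf).1)
        simp at *
        exact ih (T.length - (U ++ f.lab).length) (by simp; omega) hr rfl) []
    have h4 : (es.flatMap fun f => bwtBelow T (U ++ f.lab)) = bwtBelow T U := by
      unfold bwtBelow
      rw [below_eq_flatMap hU.treeNode hsuf (hv ▸ hes), List.map_flatMap]
    rw [List.nil_append, h4] at h1
    refine ⟨tr, RecRBWT.branch hes (hT.out_ne_nil hvn hs hes) h1, h2, fun g => ?_⟩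
    rw [h3]
    constructor
    · rintro (h | ⟨f, hf, hr, hg, V, hV, hpre⟩)
      · obtain ⟨hg, hgs⟩ := (hes.2 g).1 h
        exact ⟨hg, U, hgs ▸ hU, List.prefix_rfl⟩
      · exact ⟨hg, V, hV, (List.prefix_append _ _).trans hpre⟩
    · rintro ⟨hg, V, hV, Z, rfl⟩
      by_cases hZ : Z = []
      · subst hZ
        left
        rw [List.append_nil] at hV
        exact (hes.2 g).2 ⟨hg, by rw [hv, hV.eq_subtree]⟩
      · right
        -- The first edge from `U` towards the representative of `g.src` is primary, because a
        -- prefix of a representative that is a node is a representative. So the recursion does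
        -- reach `g`.
        obtain ⟨X, hX, Y, rfl⟩ := exists_first_edge hU.treeNode hZ hV.treeNode
        refine ⟨_, (hes.2 _).2 ⟨hX.mem_cdawgEdges, hv.symm⟩, ?_, hg, _, hV, by simp⟩
        rw [← List.append_assoc] at hV
        exact hV.of_append hX.2.2.1

/-! ### Counting edges and nodes -/

/-- A secondary edge pays for its own run, and a primary edge pays for the run that a call at the
sink returns. Merging never increases the number of runs. -/
theorem RecRBWT.length_le {T : List ℕ} {v : Node} {R : List (ℕ × ℕ)} {tr : List CEdge}
    (h : RecRBWT T v R tr) : R.length ≤ tr.length ∨ tr = [] ∧ R.length = 1 := by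
  refine RecRBWT.rec (motive_1 := fun _ R tr _ => R.length ≤ tr.length ∨ tr = [] ∧ R.length = 1)
    (motive_2 := fun _ A R tr _ => R.length ≤ A.length + tr.length) ?_ ?_ ?_ ?_ ?_ h
  · intro v d _ _; simp
  · intro v es R tr _ _ _ ih; left; simpa using ih
  · intro A; simp
  · intro f es A R' R tr' tr _ _ _ ih1 ih2
    have := length_rlConcat_le A R'
    rcases ih1 with h | ⟨rfl, h⟩ <;> simp <;> omega
  · intro f es A R tr c _ _ _ ih
    have := length_rlConcat_le A [(c, nleaves T f.dst)]
    simp at *; omega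

theorem IsText.dst_ne_root {T : List ℕ} {f : CEdge} (hT : IsText T) (hf : f ∈ cdawgEdges T) :
    f.dst ≠ cdawgRoot T := by
  intro h
  obtain ⟨U, hU⟩ := upper_nonempty (src_mem_cdawgNodes hf)
  have := mem_upper_dst hf hU
  rw [h, hT.upper_root] at this
  simp [lab_ne_nil hf] at this

/-- This bounds the number of edges by the length of the text, so that edge numbers fit into words.
A call at a node other than the root and the sink has at least two edges, hence the stronger
estimate away from the root. It leaves one unit for the primary edge that causes the call and one
for its place in the list. -/
theorem IsText.trace_length_le {T : List ℕ} {v : Node} {R : List (ℕ × ℕ)} {tr : List CEdge}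
    (hT : IsText T) (hv : v ∈ cdawgNodes T) (h : RecRBWT T v R tr) :
    tr.length + 1 ≤ 2 * runTotal R := by
  have := RecRBWT.rec
    (motive_1 := fun v R tr _ => v ∈ cdawgNodes T → tr.length + 1 ≤ 2 * runTotal R ∧
      (v ≠ cdawgRoot T → tr.length + 2 ≤ 2 * runTotal R))
    (motive_2 := fun es A R tr _ => (∀ f ∈ es, f ∈ cdawgEdges T) →
      tr.length + es.length + 2 * runTotal A ≤ 2 * runTotal R) ?_ ?_ ?_ ?_ ?_ h
  · exact (this hv).1
  · intro v d _ _; simp [runTotal]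
  · intro v es R tr hes hne _ ih hv
    have h1 := ih fun f hf => ((hes.2 f).1 hf).1
    have h2 := List.length_pos_of_ne_nil hne
    simp [runTotal] at h1
    unfold runTotal
    refine ⟨by omega, fun hr => ?_⟩
    have := hT.two_le_length_out hv hr ?_ hes
    · omega
    · rintro rfl; exact hne (hes.unique hT.isOutList_sink)
  · intro A; simp
  · intro f es A R' R tr' tr _ _ _ ih1 ih2 hes
    have hf := hes f (by simp)
    have h1 := (ih1 (dst_mem_cdawgNodes hf)).2 (hT.dst_ne_root hf)
    have h2 := ih2 fun g hg => hes g (by simp [hg])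
    rw [runTotal_rlConcat] at h2
    simp; omega
  · intro f es A R tr c _ _ _ ih hes
    have h1 := hT.nleaves_pos (dst_mem_cdawgNodes (hes f (by simp)))
    have h2 := ih fun g hg => hes g (by simp [hg])
    rw [runTotal_rlConcat] at h2
    simp [runTotal] at *; omega

theorem IsText.isReprUp_root {T : List ℕ} (hT : IsText T) : IsReprUp T (cdawgRoot T) [] :=
  ⟨hT.upper_root.2 rfl, fun U hU => by rw [hT.upper_root.1 hU]⟩

/-- The recursive procedure computes the run-length BWT and handles every edge once. -/
theorem IsText.exists_trace {T : List ℕ} (hT : IsText T) :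
    ∃ tr, RecRBWT T (cdawgRoot T) (rlbwt T) tr ∧ tr.Nodup ∧ ∀ f, f ∈ tr ↔ f ∈ cdawgEdges T := by
  obtain ⟨tr, h1, h2, h3⟩ := hT.exists_recRBWT hT.isReprUp_root
  refine ⟨tr, ?_, h2, fun f => ?_⟩
  · rwa [bwtBelow, below_nil, ← bwt_eq_map] at h1
  · rw [h3]
    refine ⟨fun h => h.1, fun h => ⟨h, ?_⟩⟩
    obtain ⟨V, hV⟩ := exists_isReprUp (src_mem_cdawgNodes h)
    exact ⟨V, hV, List.nil_prefix⟩

theorem runTotal_rlbwt (T : List ℕ) : runTotal (rlbwt T) = T.length := by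
  rw [rlbwt, runTotal_runLength, bwt_eq_map, List.length_map, length_sortedSufs]

theorem exists_edge_to {T : List ℕ} {v : Node} (hv : v ∈ cdawgNodes T) (hr : v ≠ cdawgRoot T) :
    ∃ g ∈ cdawgEdges T, g.dst = v := by
  obtain ⟨U, hU⟩ := upper_nonempty hv
  obtain ⟨g, hg, hd, -⟩ := exists_last_of_mem_upper hU (by
    rintro rfl; exact hr (mem_upper_iff.1 hU).2.symm)
  exact ⟨g, hg, hd⟩

theorem ncard_edges {T : List ℕ} {tr : List CEdge} (h : tr.Nodup)
    (hm : ∀ f, f ∈ tr ↔ f ∈ cdawgEdges T) : (cdawgEdges T).ncard = tr.length := by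
  classical
  rw [show cdawgEdges T = (tr.toFinset : Set CEdge) by ext; simp [hm], Set.ncard_coe_finset,
    List.toFinset_card_of_nodup h]

theorem IsText.trace_ne_nil {T : List ℕ} {tr : List CEdge} (hT : IsText T)
    (hm : ∀ f, f ∈ tr ↔ f ∈ cdawgEdges T) : tr ≠ [] := by
  obtain ⟨g, hg, -⟩ := exists_edge_to
    (mem_cdawgNodes_of_treeNode (Suf.isTreeNode hT.self_mem_suf)) hT.root_ne_sink.symm
  exact List.ne_nil_of_mem ((hm g).2 hg)

/-! ### Reasoning about programs -/

namespace WordRAM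

/-- Assignment to a register. -/
def State.set (s : State) (r x : ℕ) : State := { s with reg := Function.update s.reg r x }

/-- Assignment to a memory cell. -/
def State.put (s : State) (a x : ℕ) : State := { s with mem := Function.update s.mem a x }

/-- Output of a word. -/
def State.emit (s : State) (x : ℕ) : State := { s with out := s.out ++ [x] }

/-- Log of a word. -/
def State.note (s : State) (x : ℕ) : State := { s with log := s.log ++ [x] }

section
variable (s : State) (r x q : ℕ)

theorem reg_set : (s.set r x).reg q = if q = r then x else s.reg q := by
  simp [State.set, Function.update_apply]
theorem mem_set : (s.set r x).mem = s.mem := id rfl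
theorem out_set : (s.set r x).out = s.out := id rfl
theorem log_set : (s.set r x).log = s.log := id rfl
theorem reg_put : (s.put r x).reg = s.reg := id rfl
theorem mem_put : (s.put r x).mem q = if q = r then x else s.mem q := by
  simp [State.put, Function.update_apply]
theorem out_put : (s.put r x).out = s.out := id rfl
theorem log_put : (s.put r x).log = s.log := id rfl
theorem reg_emit : (s.emit x).reg = s.reg := id rfl
theorem out_emit : (s.emit x).out = s.out ++ [x] := id rfl
theorem log_emit : (s.emit x).log = s.log := id rfl
theorem reg_note : (s.note x).reg = s.reg := id rfl
theorem mem_note : (s.note x).mem = s.mem := id rfl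
theorem log_note : (s.note x).log = s.log ++ [x] := id rfl

theorem set_set (y : ℕ) : (s.set r x).set r y = s.set r y := by simp [State.set]

theorem val_const (k : ℕ) : (Operand.const k).val s = k := id rfl
theorem val_reg : (Operand.reg r).val s = s.reg r := id rfl

end

-- Weakest preconditions, running times and loop invariants

/-- The weakest precondition of a loop-free program. -/
def wp (W S : ℕ) (input : List ℕ) : Program → (State → Prop) → State → Prop
  | .skip, Q, s => Q s
  | .arith r o a b, Q, s =>
    o.eval (a.val s) (b.val s) < W ∧ Q (s.set r (o.eval (a.val s) (b.val s)))
  | .read r a, Q, s => ∃ x, input[a.val s]? = some x ∧ x < W ∧ Q (s.set r x)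
  | .load r a, Q, s => a.val s < S ∧ Q (s.set r (s.mem (a.val s)))
  | .store a b, Q, s => (a.val s < S ∧ b.val s < W) ∧ Q (s.put (a.val s) (b.val s))
  | .write a, Q, s => a.val s < W ∧ Q (s.emit (a.val s))
  | .report a, Q, s => a.val s < W ∧ Q (s.note (a.val s))
  | .seq p q, Q, s => wp W S input p (wp W S input q Q) s
  | .ite c p q, Q, s => (c.holds s → wp W S input p Q s) ∧ (¬ c.holds s → wp W S input q Q s)
  | .loop _ _, _, _ => False

/-- An upper bound for the number of steps of a loop-free program. -/
def cost : Program → ℕ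
  | .seq p q => cost p + cost q
  | .ite _ p q => cost p + cost q + 1
  | _ => 1

/-- The program `p` terminates after at most `k` steps in a state with the property `Q`. -/
def Runs (W S : ℕ) (input : List ℕ) (p : Program) (s : State) (k : ℕ) (Q : State → Prop) : Prop :=
  ∃ s' t, Exec W S input p s s' t ∧ t ≤ k ∧ Q s'

variable {W S : ℕ} {input : List ℕ} {p q : Program} {s : State} {k l : ℕ} {Q Q' : State → Prop}

theorem Runs.mono (h : Runs W S input p s k Q) (hk : k ≤ l) (hQ : ∀ s, Q s → Q' s) :
    Runs W S input p s l Q' := by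
  obtain ⟨s', t, h1, h2, h3⟩ := h
  exact ⟨s', t, h1, h2.trans hk, hQ _ h3⟩

theorem Runs.seq (h : Runs W S input p s k fun s' => Runs W S input q s' l Q) :
    Runs W S input (.seq p q) s (k + l) Q := by
  obtain ⟨s', t, h1, h2, s'', t', h3, h4, h5⟩ := h
  exact ⟨s'', t + t', .seq h1 h3, by omega, h5⟩

/-- Loops need invariants, but for the code between them the precondition can be evaluated by
rewriting, and the number of steps is bounded independently of the input. -/
theorem runs_of_wp (h : wp W S input p Q s) : Runs W S input p s (cost p) Q := by
  induction p generalizing s Q with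
  | skip => exact ⟨s, 1, .skip s, le_rfl, h⟩
  | arith r o a b => exact ⟨_, 1, .arith h.1, le_rfl, h.2⟩
  | read r a =>
    obtain ⟨x, h1, h2, h3⟩ := h
    exact ⟨_, 1, .read h1 h2, le_rfl, h3⟩
  | load r a => exact ⟨_, 1, .load h.1, le_rfl, h.2⟩
  | store a b => exact ⟨_, 1, .store h.1.1 h.1.2, le_rfl, h.2⟩
  | write a => exact ⟨_, 1, .write h.1, le_rfl, h.2⟩
  | report a => exact ⟨_, 1, .report h.1, le_rfl, h.2⟩
  | seq p q ihp ihq => exact ((ihp h).mono le_rfl fun s' hs' => ihq hs').seq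
  | ite c p q ihp ihq =>
    by_cases hc : c.holds s
    · obtain ⟨s', t, h1, h2, h3⟩ := ihp (h.1 hc)
      exact ⟨s', t + 1, .ite_true hc h1, by simp only [cost]; omega, h3⟩
    · obtain ⟨s', t, h1, h2, h3⟩ := ihq (h.2 hc)
      exact ⟨s', t + 1, .ite_false hc h1, by simp only [cost]; omega, h3⟩
  | loop c p => exact h.elim

theorem Runs.loop_step {c : Test} (hc : c.holds s)
    (h : Runs W S input p s k fun s' => Runs W S input (.loop c p) s' l Q) :
    Runs W S input (.loop c p) s (l + (k + 1)) Q := by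
  obtain ⟨s', t, h1, h2, s'', t', h3, h4, h5⟩ := h
  exact ⟨s'', t + t' + 1, .loop_true hc h1 h3, by omega, h5⟩

theorem Runs.loop_end {c : Test} (hc : ¬ c.holds s) (h : Q s) :
    Runs W S input (.loop c p) s 1 Q :=
  ⟨s, 1, .loop_false hc, le_rfl, h⟩

/-- A loop with an invariant that counts the remaining iterations. -/
theorem Runs.loop {c : Test} (I : ℕ → State → Prop)
    (hstep : ∀ n s, I (n + 1) s → c.holds s ∧ Runs W S input p s k (I n))
    (hend : ∀ s, I 0 s → ¬ c.holds s) (n : ℕ) (h : I n s) :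
    Runs W S input (.loop c p) s (n * (k + 1) + 1) (I 0) := by
  induction n generalizing s with
  | zero => simpa using Runs.loop_end (hend s h) h
  | succ n ih =>
    obtain ⟨h1, h2⟩ := hstep n s h
    exact (Runs.loop_step h1 (h2.mono le_rfl fun s' hs' => ih hs')).mono
      (by rw [Nat.succ_mul]; omega) fun _ => id

/-- A sequence of programs. -/
def seqs : List Program → Program
  | [] => .skip
  | p :: ps => .seq p (seqs ps)

theorem wp_seqs_nil : wp W S input (seqs []) Q = Q := id rfl

theorem wp_seqs_cons (ps : List Program) :
    wp W S input (seqs (p :: ps)) Q s = wp W S input p (wp W S input (seqs ps) Q) s := id rfl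

theorem wp_skip : wp W S input .skip Q s = Q s := id rfl

theorem wp_ite (c : Test) : wp W S input (.ite c p q) Q s =
    ((c.holds s → wp W S input p Q s) ∧ (¬ c.holds s → wp W S input q Q s)) := id rfl

theorem holds_lt (a b : Operand) : (Test.lt a b).holds s = (a.val s < b.val s) := id rfl

theorem holds_eq (a b : Operand) : (Test.eq a b).holds s = (a.val s = b.val s) := id rfl

theorem wp_add {r : ℕ} {a b : Operand} (h : a.val s + b.val s < W) :
    wp W S input (.arith r .add a b) Q s = Q (s.set r (a.val s + b.val s)) := by
  simp [wp, Op.eval, h]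

theorem wp_sub {r : ℕ} {a b : Operand} (h : a.val s < W) :
    wp W S input (.arith r .sub a b) Q s = Q (s.set r (a.val s - b.val s)) := by
  simp only [wp, Op.eval, eq_iff_iff, and_iff_right_iff_imp]
  omega

theorem wp_mul {r : ℕ} {a b : Operand} (h : a.val s * b.val s < W) :
    wp W S input (.arith r .mul a b) Q s = Q (s.set r (a.val s * b.val s)) := by
  simp [wp, Op.eval, h]

theorem wp_write {a : Operand} (h : a.val s < W) :
    wp W S input (.write a) Q s = Q (s.emit (a.val s)) := by simp [wp, h]

theorem wp_report {a : Operand} (h : a.val s < W) :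
    wp W S input (.report a) Q s = Q (s.note (a.val s)) := by simp [wp, h]

theorem wp_read {r x : ℕ} {a : Operand} (h : input[a.val s]? = some x) (hx : x < W) :
    wp W S input (.read r a) Q s = Q (s.set r x) := by simp [wp, h, hx]

-- Access to the working memory and to the tables of the input

/-- Access to an array of records of 8 words: `reg r := mem[8 a + c]`. -/
def getCell (r : ℕ) (a : Operand) (c : ℕ) : Program :=
  seqs [.arith r .mul a (.const 8), .arith r .add (.reg r) (.const c), .load r (.reg r)]

/-- Access to an array of records of 8 words: `mem[8 a + c] := b`. -/
def setCell (a : Operand) (c : ℕ) (b : Operand) : Program :=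
  seqs [.arith 30 .mul a (.const 8), .arith 30 .add (.reg 30) (.const c), .store (.reg 30) b]

/-- A numeric view of an index: the tables that are found in the input, and the values that are
to be computed from them. -/
structure NumIndex (W S : ℕ) (input : List ℕ) where
  (N E root sink nodeBase edgeBase : ℕ)
  (outStart outCount incStart incCount src dst fst inc pos rank leaves lead : ℕ → ℕ)
  hW : 10 * (N + E + 2) ≤ W
  hS : 8 * (N + E + 2) ≤ S
  leaves_lt : ∀ v < N, leaves v < W
  leaves_pos : ∀ v < N, 0 < leaves v
  fst_lt : ∀ e < E, fst e < W
  lead_lt : ∀ v < N, v ≠ root → lead v < W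
  nodeBase_eq : nodeBase = N * 5 + 4
  edgeBase_eq : edgeBase = E * 4 + nodeBase
  read_N : input[0]? = some N
  read_E : input[1]? = some E
  read_root : input[2]? = some root
  read_sink : input[3]? = some sink
  read_outStart : ∀ v < N, input[v * 5 + 4]? = some (outStart v)
  read_outCount : ∀ v < N, input[v * 5 + 5]? = some (outCount v)
  read_incStart : ∀ v < N, input[v * 5 + 6]? = some (incStart v)
  read_incCount : ∀ v < N, input[v * 5 + 7]? = some (incCount v)
  read_src : ∀ e < E, input[e * 4 + nodeBase]? = some (src e)
  read_dst : ∀ e < E, input[e * 4 + nodeBase + 1]? = some (dst e)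
  read_fst : ∀ e < E, input[e * 4 + nodeBase + 3]? = some (fst e)
  read_inc : ∀ k < E, input[k + edgeBase]? = some (inc k)
  root_lt : root < N
  sink_lt : sink < N
  root_ne_sink : root ≠ sink
  src_lt : ∀ e < E, src e < N
  dst_lt : ∀ e < E, dst e < N
  inc_lt : ∀ k < E, inc k < E
  pos_lt : ∀ e < E, pos e < E
  pos_inc : ∀ k < E, pos (inc k) = k
  inc_pos : ∀ e < E, inc (pos e) = e
  src_eq_iff : ∀ e < E, ∀ v < N, src e = v ↔ outStart v ≤ e ∧ e < outStart v + outCount v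
  out_le : ∀ v < N, outStart v + outCount v ≤ E
  dst_eq_iff : ∀ e < E, ∀ v < N, dst e = v ↔ incStart v ≤ pos e ∧ pos e < incStart v + incCount v
  inc_le : ∀ v < N, incStart v + incCount v ≤ E
  rank_lt : ∀ e < E, rank (dst e) < rank (src e)
  outCount_eq_zero : ∀ v < N, outCount v = 0 ↔ v = sink
  leaves_sink : leaves sink = 1
  leaves_eq : ∀ v < N, v ≠ sink →
    leaves v = ∑ e ∈ Finset.Ico (outStart v) (outStart v + outCount v), leaves (dst e)
  incCount_pos : ∀ v < N, v ≠ root → 0 < incCount v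
  lead_eq : ∀ v < N, v ≠ root → lead v =
    if src (inc (incStart v + incCount v - 1)) = root then fst (inc (incStart v + incCount v - 1))
    else lead (src (inc (incStart v + incCount v - 1)))

namespace NumIndex

variable (D : NumIndex W S input)

/-- The first symbol of the shortest upper string through an edge. -/
def sym (e : ℕ) : ℕ := if D.src e = D.root then D.fst e else D.lead (D.src e)

theorem sym_lt {e : ℕ} (he : e < D.E) : D.sym e < W := by
  unfold sym
  split_ifs with h
  · exact D.fst_lt e he
  · exact D.lead_lt _ (D.src_lt e he) h

end NumIndex

/-- `reg r` is the word number `k` of the record of the node `a`. -/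
def nodeField (r : ℕ) (a : Operand) (k : ℕ) : Program :=
  seqs [.arith r .mul a (.const 5), .arith r .add (.reg r) (.const k), .read r (.reg r)]

/-- `reg r` is the word number `k` of the record of the edge `a`. -/
def edgeField (r : ℕ) (a : Operand) (k : ℕ) : Program :=
  seqs [.arith r .mul a (.const 4), .arith r .add (.reg r) (.reg 4),
    .arith r .add (.reg r) (.const k), .read r (.reg r)]

/-- `reg r` is the entry number `a` of the table of incoming edges. -/
def incEntry (r : ℕ) (a : Operand) : Program :=
  seqs [.arith r .add a (.reg 5), .read r (.reg r)]

/-- `reg r` is the first symbol of the shortest upper string through the edge `a`. -/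
def edgeSymbol (r : ℕ) (a : Operand) : Program :=
  seqs [edgeField 20 a 0, .ite (.eq (.reg 20) (.reg 2)) (edgeField r a 3) (getCell r (.reg 20) 2)]

section
variable (D : NumIndex W S input) {r : ℕ} {a b : Operand}
include D

/-- One bound on the record number serves nodes, edges and stack positions alike: it keeps the
address below `S` and the intermediate results below `W`. -/
theorem wp_getCell {c : ℕ} (hc : c < 8) (h : a.val s < D.N + D.E + 2) :
    wp W S input (getCell r a c) Q s = Q (s.set r (s.mem (a.val s * 8 + c))) := by
  have h1 := D.hW
  have h2 := D.hS
  rw [getCell, wp_seqs_cons, wp_mul (by simp only [val_const]; omega), wp_seqs_cons,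
    wp_add (by simp only [val_const, val_reg, reg_set, if_true]; omega), wp_seqs_cons]
  simp only [wp, val_const, val_reg, reg_set, if_true, set_set, wp_seqs_nil, mem_set]
  simp only [eq_iff_iff, and_iff_right_iff_imp]
  omega

/-- Register 30 holds the address while the cell is written, so the value must not come from there.
-/
theorem wp_setCell {c : ℕ} (hc : c < 8) (h : a.val s < D.N + D.E + 2) (hb : b.val s < W)
    (hb' : b ≠ .reg 30) :
    wp W S input (setCell a c b) Q s =
      Q ((s.set 30 (a.val s * 8 + c)).put (a.val s * 8 + c) (b.val s)) := by
  have h1 := D.hW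
  have h2 := D.hS
  have h3 : ∀ x, b.val (s.set 30 x) = b.val s := by
    intro x
    cases b with
    | const k => rfl
    | reg q =>
      have : q ≠ 30 := by rintro rfl; exact hb' rfl
      simp [val_reg, reg_set, this]
  rw [setCell, wp_seqs_cons, wp_mul (by simp only [val_const]; omega), wp_seqs_cons,
    wp_add (by simp only [val_const, val_reg, reg_set, if_true]; omega), wp_seqs_cons]
  simp only [wp, val_const, val_reg, reg_set, if_true, set_set, wp_seqs_nil, h3]
  simp only [eq_iff_iff, and_iff_right_iff_imp]
  omega

/-- The offset `k` includes the four words of the header: the first four fields of a node record are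
read with offsets 4 to 7. -/
theorem wp_nodeField {k x : ℕ} (hv : a.val s < D.N) (hk : k < 8)
    (hx : input[a.val s * 5 + k]? = some x) (hxW : x < W) :
    wp W S input (nodeField r a k) Q s = Q (s.set r x) := by
  have h1 := D.hW
  rw [nodeField, wp_seqs_cons, wp_mul (by simp only [val_const]; omega), wp_seqs_cons,
    wp_add (by simp only [val_const, val_reg, reg_set, if_true]; omega), wp_seqs_cons,
    wp_read (by simpa only [val_const, val_reg, reg_set, if_true] using hx) hxW, wp_seqs_nil,
    set_set, set_set]

theorem wp_outStart (hv : a.val s < D.N) :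
    wp W S input (nodeField r a 4) Q s = Q (s.set r (D.outStart (a.val s))) := by
  have h1 := D.hW
  have h2 := D.out_le _ hv
  exact wp_nodeField D hv (by omega) (D.read_outStart _ hv) (by omega)

theorem wp_outCount (hv : a.val s < D.N) :
    wp W S input (nodeField r a 5) Q s = Q (s.set r (D.outCount (a.val s))) := by
  have h1 := D.hW
  have h2 := D.out_le _ hv
  exact wp_nodeField D hv (by omega) (D.read_outCount _ hv) (by omega)

theorem wp_incStart (hv : a.val s < D.N) :
    wp W S input (nodeField r a 6) Q s = Q (s.set r (D.incStart (a.val s))) := by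
  have h1 := D.hW
  have h2 := D.inc_le _ hv
  exact wp_nodeField D hv (by omega) (D.read_incStart _ hv) (by omega)

theorem wp_incCount (hv : a.val s < D.N) :
    wp W S input (nodeField r a 7) Q s = Q (s.set r (D.incCount (a.val s))) := by
  have h1 := D.hW
  have h2 := D.inc_le _ hv
  exact wp_nodeField D hv (by omega) (D.read_incCount _ hv) (by omega)

theorem wp_edgeField {k x : ℕ} (hv : a.val s < D.E) (hk : k < 4) (h4 : s.reg 4 = D.nodeBase)
    (hr : r ≠ 4) (hx : input[a.val s * 4 + D.nodeBase + k]? = some x) (hxW : x < W) :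
    wp W S input (edgeField r a k) Q s = Q (s.set r x) := by
  have h1 := D.hW
  have h2 := D.nodeBase_eq
  have h3 : ∀ x, (s.set r x).reg 4 = D.nodeBase := fun x => by rw [reg_set, if_neg hr.symm, h4]
  rw [edgeField, wp_seqs_cons, wp_mul (by simp only [val_const]; omega), wp_seqs_cons,
    wp_add (by simp only [val_const, val_reg, h3]; simp only [reg_set, if_true]; omega),
    wp_seqs_cons]
  simp only [val_reg, h3]
  simp only [reg_set, if_true, val_const, set_set]
  rw [wp_add (by simp only [val_const, val_reg, reg_set, if_true]; omega), wp_seqs_cons,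
    wp_read (by simpa only [val_const, val_reg, reg_set, if_true] using hx) hxW, wp_seqs_nil,
    set_set, set_set]

theorem wp_src (hv : a.val s < D.E) (h4 : s.reg 4 = D.nodeBase) (hr : r ≠ 4) :
    wp W S input (edgeField r a 0) Q s = Q (s.set r (D.src (a.val s))) := by
  have h1 := D.hW
  have h2 := D.src_lt _ hv
  exact wp_edgeField D hv (by omega) h4 hr (D.read_src _ hv) (by omega)

theorem wp_dst (hv : a.val s < D.E) (h4 : s.reg 4 = D.nodeBase) (hr : r ≠ 4) :
    wp W S input (edgeField r a 1) Q s = Q (s.set r (D.dst (a.val s))) := by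
  have h1 := D.hW
  have h2 := D.dst_lt _ hv
  exact wp_edgeField D hv (by omega) h4 hr (D.read_dst _ hv) (by omega)

theorem wp_fst (hv : a.val s < D.E) (h4 : s.reg 4 = D.nodeBase) (hr : r ≠ 4) :
    wp W S input (edgeField r a 3) Q s = Q (s.set r (D.fst (a.val s))) :=
  wp_edgeField D hv (by omega) h4 hr (D.read_fst _ hv) (D.fst_lt _ hv)

theorem wp_incEntry (hv : a.val s < D.E) (h5 : s.reg 5 = D.edgeBase) :
    wp W S input (incEntry r a) Q s = Q (s.set r (D.inc (a.val s))) := by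
  have h1 := D.hW
  have h2 := D.nodeBase_eq
  have h3 := D.edgeBase_eq
  have h4 := D.inc_lt _ hv
  rw [incEntry, wp_seqs_cons, wp_add (by simp only [val_reg]; omega), wp_seqs_cons,
    wp_read (x := D.inc (a.val s))
      (by simpa only [val_const, val_reg, reg_set, if_true, h5] using D.read_inc _ hv) (by omega),
    wp_seqs_nil, set_set]

/-- Unless the source is the root, its leading symbol must already be in memory. Register 20 is
overwritten by the source, so it cannot hold the edge. -/
theorem wp_edgeSymbol {e : ℕ} (hv : s.reg e < D.E) (h2 : s.reg 2 = D.root)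
    (h4 : s.reg 4 = D.nodeBase) (hr : r ≠ 4) (he : e ≠ 20)
    (hl : D.src (s.reg e) ≠ D.root →
      s.mem (D.src (s.reg e) * 8 + 2) = D.lead (D.src (s.reg e))) :
    wp W S input (edgeSymbol r (.reg e)) Q s =
      Q ((s.set 20 (D.src (s.reg e))).set r (D.sym (s.reg e))) := by
  have h5 := D.src_lt _ hv
  rw [edgeSymbol, wp_seqs_cons, wp_src D (a := .reg e) hv h4 (by decide), wp_seqs_cons, wp_ite, wp_seqs_nil]
  simp only [holds_eq, val_reg, reg_set, if_true]
  rw [if_neg (by decide), h2, wp_fst D (by simp [val_reg, reg_set, he, hv]) (by simp [reg_set, h4]) hr,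
    wp_getCell D (by decide) (by simp [val_reg, reg_set]; omega)]
  unfold NumIndex.sym
  by_cases h : D.src (s.reg e) = D.root
  · simp [h, val_reg, reg_set, he]
  · simp [h, val_reg, reg_set, mem_set, hl h]

end

end WordRAM

open WordRAM Operand
set_option linter.unusedSimpArgs false

namespace WordRAM

/-! ### The program: reading the header and the tables -/

/-- Registers 0 to 5: number of nodes, number of edges, root, sink, start of the edge table,
start of the table of incoming edges. -/
def header : Program :=
  seqs [.read 0 (.const 0), .read 1 (.const 1), .read 2 (.const 2), .read 3 (.const 3),
    .arith 4 .mul (.reg 0) (.const 5), .arith 4 .add (.reg 4) (.const 4),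
    .arith 5 .mul (.reg 1) (.const 4), .arith 5 .add (.reg 5) (.reg 4)]

/-- Cells 4: the position of every edge in the table of incoming edges. -/
def posBody : Program :=
  seqs [incEntry 7 (.reg 6), setCell (.reg 7) 4 (.reg 6), .arith 6 .add (.reg 6) (.const 1)]

def posLoop : Program := .loop (.lt (.reg 6) (.reg 1)) posBody

variable {W S : ℕ} {input : List ℕ}

/-- The header has been read. -/
structure HasHeader (D : NumIndex W S input) (s : State) : Prop where
  r0 : s.reg 0 = D.N
  r1 : s.reg 1 = D.E
  r2 : s.reg 2 = D.root
  r3 : s.reg 3 = D.sink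
  r4 : s.reg 4 = D.nodeBase
  r5 : s.reg 5 = D.edgeBase

/-- The tables of cells 4 are complete. -/
def HasPos (D : NumIndex W S input) (s : State) : Prop := ∀ e < D.E, s.mem (e * 8 + 4) = D.pos e

theorem wp_header (D : NumIndex W S input) :
    wp W S input header (fun s => HasHeader D s ∧ s.reg 6 = 0 ∧ s.reg 24 = 0 ∧ s.reg 25 = 0 ∧
      s.mem = (fun _ => 0) ∧ s.out = [] ∧ s.log = []) initial := by
  have h1 := D.hW
  have h2 := D.nodeBase_eq
  have h3 := D.edgeBase_eq
  have h4 := D.root_lt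
  have h5 := D.sink_lt
  simp only [header, wp_seqs_cons, wp_seqs_nil, wp]
  refine ⟨_, D.read_N, by omega, _, D.read_E, by omega, _, D.read_root, by omega, _, D.read_sink,
    by omega, ?_⟩
  simp only [Op.eval, val_reg, val_const, reg_set]
  norm_num
  refine ⟨by omega, by omega, by omega, by omega, ⟨?_, ?_, ?_, ?_, ?_, ?_⟩, ?_⟩ <;>
    simp [reg_set, mem_set, out_set, log_set, initial, h2, h3]

/-- The table of incoming edges is a permutation of the edges. One pass over it stores the inverse
permutation. -/
theorem runs_posLoop (D : NumIndex W S input) {s : State} (hs : HasHeader D s)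
    (h6 : s.reg 6 = 0) :
    Runs W S input posLoop s (D.E * (cost posBody + 1) + 1) (fun s' => HasHeader D s' ∧ HasPos D s' ∧
      s'.reg 24 = s.reg 24 ∧ s'.reg 25 = s.reg 25 ∧ s'.out = s.out ∧ s'.log = s.log ∧
      ∀ i c, c < 8 → c ≠ 4 → s'.mem (i * 8 + c) = s.mem (i * 8 + c)) := by
  have := Runs.loop (W := W) (S := S) (input := input) (k := cost posBody) (p := posBody)
    (c := .lt (.reg 6) (.reg 1)) (fun n s' => n ≤ D.E ∧ HasHeader D s' ∧ s'.reg 6 = D.E - n ∧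
      (∀ e < D.E, D.pos e < D.E - n → s'.mem (e * 8 + 4) = D.pos e) ∧
      s'.reg 24 = s.reg 24 ∧ s'.reg 25 = s.reg 25 ∧ s'.out = s.out ∧ s'.log = s.log ∧
      ∀ i c, c < 8 → c ≠ 4 → s'.mem (i * 8 + c) = s.mem (i * 8 + c)) ?_ ?_ D.E
      (s := s) ⟨le_rfl, hs, by omega, fun e _ h => by omega, rfl, rfl, rfl, rfl, fun _ _ _ _ => rfl⟩
  · refine this.mono le_rfl fun s' hs' => ?_
    obtain ⟨-, h1, h2, h3, h4⟩ := hs'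
    exact ⟨h1, fun e he => h3 e he (by have := D.pos_lt e he; omega), h4⟩
  · rintro n s' ⟨hn, hh, g6, htab, g24, g25, gout, glog, gmem⟩
    have ⟨g0, g1, g2, g3, g4, g5⟩ := hh
    have hW := D.hW
    have hlt : s'.reg 6 < D.E := by omega
    have hinc := D.inc_lt _ hlt
    refine ⟨by rw [holds_lt, val_reg, val_reg]; omega, runs_of_wp ?_⟩
    simp (disch := (try simp [reg_set, val_reg, val_const, mem_set, mem_put, reg_put]) <;> omega) only
      [posBody, wp_seqs_cons, wp_seqs_nil, wp_incEntry D, wp_setCell D, val_const, wp_add, val_reg]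
    simp only [reg_put, mem_set, out_set, out_put, log_set, log_put]
    refine ⟨by omega, ⟨?_, ?_, ?_, ?_, ?_, ?_⟩, ?_, ?_, ?_, ?_, gout, glog, ?_⟩
    any_goals simp [reg_set, reg_put, g0, g1, g2, g3, g4, g5, g24, g25]
    · omega
    · intro e he hp
      simp only [mem_put, mem_set]
      split_ifs with h
      · have : e = D.inc (s'.reg 6) := by omega
        rw [this, D.pos_inc _ hlt]
      -- An edge whose position is the current counter would be the one whose cell has just been
      -- written.
      · refine htab e he (lt_of_le_of_ne (by omega) fun h' => h ?_)
        rw [← D.inc_pos e he, h', ← g6]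
    · intro i c hc hc4
      simp only [mem_put, mem_set]
      rw [if_neg (by omega), gmem i c hc hc4]
  · rintro s' ⟨-, hh, g6, -⟩
    have := hh.r1
    rw [holds_lt, val_reg, val_reg]; omega
end WordRAM

namespace WordRAM

variable {W S : ℕ} {input : List ℕ}

/-- The working memory consists of eight interleaved arrays, and writing to one of them leaves the
others intact. -/
theorem cell_eq_iff {i j c d : ℕ} (hc : c < 8) (hd : d < 8) :
    i * 8 + c = j * 8 + d ↔ i = j ∧ c = d := by omega

/-! ### Reverse topological order -/

/-- The edges out of a node. -/
def NumIndex.outSet (D : NumIndex W S input) (u : ℕ) : Finset ℕ :=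
  Finset.Ico (D.outStart u) (D.outStart u + D.outCount u)

theorem NumIndex.mem_outSet (D : NumIndex W S input) {u e : ℕ} (hu : u < D.N) :
    e ∈ D.outSet u ↔ e < D.E ∧ D.src e = u := by
  have h1 := D.out_le u hu
  rw [outSet, Finset.mem_Ico]
  constructor
  · intro h
    have he : e < D.E := by omega
    exact ⟨he, (D.src_eq_iff e he u hu).2 h⟩
  · rintro ⟨he, h⟩
    exact (D.src_eq_iff e he u hu).1 h

/-- The queue `Q` of the nodes without unprocessed outgoing edges, the set `F` of the processed
edges, and the number `h` of the nodes that have left the queue, the last one being `v`, whose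
incoming edges are in the table up to position `je` and processed up to position `j`. -/
structure Peeling (D : NumIndex W S input) (Q : List ℕ) (F : Finset ℕ) (h v j je : ℕ) : Prop where
  nodup : Q.Nodup
  mem_queue : ∀ u, u ∈ Q ↔ u < D.N ∧ D.outSet u ⊆ F
  mem_edges : ∀ e, e ∈ F ↔ e < D.E ∧ D.dst e ∈ Q.take h ∧ (D.dst e = v → D.pos e < j)
  topo : ∀ i (hi : i < Q.length), ∀ e ∈ D.outSet Q[i], D.dst e ∈ Q.take i
  le_length : h ≤ Q.length
  current : h = 0 ∧ j = 0 ∧ je = 0 ∨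
    v ∈ Q.take h ∧ D.incStart v ≤ j ∧ j ≤ je ∧ je = D.incStart v + D.incCount v

namespace Peeling

variable {D : NumIndex W S input} {Q : List ℕ} {F : Finset ℕ} {h v j je : ℕ}

theorem init (D : NumIndex W S input) (v : ℕ) : Peeling D [D.sink] ∅ 0 v 0 0 where
  nodup := List.nodup_singleton _
  mem_queue u := by
    rw [List.mem_singleton, Finset.subset_empty, NumIndex.outSet, Finset.Ico_eq_empty_iff]
    constructor
    · rintro rfl
      have := (D.outCount_eq_zero _ D.sink_lt).2 rfl
      exact ⟨D.sink_lt, by omega⟩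
    · rintro ⟨hu, h⟩
      exact (D.outCount_eq_zero u hu).1 (by omega)
  mem_edges e := by simp
  topo i hi e he := by
    obtain rfl : i = 0 := by simpa using hi
    have := (D.outCount_eq_zero _ D.sink_lt).2 rfl
    simp [NumIndex.outSet, this] at he
  le_length := by simp
  current := Or.inl ⟨rfl, rfl, rfl⟩

theorem lt_of_mem (P : Peeling D Q F h v j je) {u : ℕ} (hu : u ∈ Q) : u < D.N :=
  ((P.mem_queue u).1 hu).1

theorem length_le (P : Peeling D Q F h v j je) : Q.length ≤ D.N := by
  have h1 : Q.toFinset ⊆ Finset.range D.N := fun u hu => by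
    simpa using P.lt_of_mem (by simpa using hu)
  have := Finset.card_le_card h1
  rwa [List.toFinset_card_of_nodup P.nodup, Finset.card_range] at this

theorem subset_range (P : Peeling D Q F h v j je) : F ⊆ Finset.range D.E := fun e he => by
  simpa using ((P.mem_edges e).1 he).1

theorem card_le (P : Peeling D Q F h v j je) : F.card ≤ D.E := by
  simpa using Finset.card_le_card P.subset_range

theorem mem_of_ge (P : Peeling D Q F h v j je) (hj : je ≤ j) {e : ℕ} :
    e ∈ F ↔ e < D.E ∧ D.dst e ∈ Q.take h := by
  rw [P.mem_edges]
  refine and_congr_right fun he => and_iff_left_of_imp fun hq hv => ?_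
  rcases P.current with ⟨rfl, -⟩ | ⟨-, -, -, h4⟩
  · simp at hq
  · have := (D.dst_eq_iff e he v (hv ▸ D.dst_lt e he)).1 hv
    omega

theorem cur_mem (P : Peeling D Q F h v j je) (hj : j < je) : v ∈ Q.take h := by
  rcases P.current with h | h
  · omega
  · exact h.1

theorem cur_lt (P : Peeling D Q F h v j je) (hj : j < je) : v < D.N :=
  P.lt_of_mem (List.mem_of_mem_take (P.cur_mem hj))

theorem pos_lt (P : Peeling D Q F h v j je) (hj : j < je) : j < D.E := by
  have := D.inc_le v (P.cur_lt hj)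
  rcases P.current with h | h <;> omega

theorem dst_inc (P : Peeling D Q F h v j je) (hj : j < je) : D.dst (D.inc j) = v := by
  have hlt := P.pos_lt hj
  rw [D.dst_eq_iff _ (D.inc_lt j hlt) v (P.cur_lt hj), D.pos_inc j hlt]
  rcases P.current with h | h <;> omega

theorem not_mem (P : Peeling D Q F h v j je) (hj : j < je) : D.inc j ∉ F := by
  rw [P.mem_edges]
  rintro ⟨-, -, h⟩
  have := h (P.dst_inc hj)
  rw [D.pos_inc j (P.pos_lt hj)] at this
  omega

theorem mem_insert_iff (P : Peeling D Q F h v j je) (hj : j < je) (e : ℕ) :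
    e ∈ insert (D.inc j) F ↔ e < D.E ∧ D.dst e ∈ Q.take h ∧ (D.dst e = v → D.pos e < j + 1) := by
  have hlt := P.pos_lt hj
  rw [Finset.mem_insert, P.mem_edges]
  constructor
  · rintro (rfl | ⟨h1, h2, h3⟩)
    · refine ⟨D.inc_lt j hlt, ?_, fun _ => ?_⟩
      · rw [P.dst_inc hj]; exact P.cur_mem hj
      · rw [D.pos_inc j hlt]; omega
    · exact ⟨h1, h2, fun h => (h3 h).trans (by omega)⟩
  · rintro ⟨h1, h2, h3⟩
    by_cases he : e = D.inc j
    · exact Or.inl he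
    · refine Or.inr ⟨h1, h2, fun h => lt_of_le_of_ne (by have := h3 h; omega) fun h' => he ?_⟩
      rw [← h', D.inc_pos e h1]

theorem current_succ (P : Peeling D Q F h v j je) (hj : j < je) (Q' : List ℕ)
    (hQ : Q'.take h = Q.take h) : h = 0 ∧ j + 1 = 0 ∧ je = 0 ∨
    v ∈ Q'.take h ∧ D.incStart v ≤ j + 1 ∧ j + 1 ≤ je ∧ je = D.incStart v + D.incCount v := by
  rw [hQ]
  rcases P.current with h | h
  · omega
  · exact Or.inr ⟨h.1, by omega, by omega, h.2.2.2⟩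

theorem src_not_mem (P : Peeling D Q F h v j je) (hj : j < je) : D.src (D.inc j) ∉ Q := by
  have hlt := D.inc_lt j (P.pos_lt hj)
  intro hu
  exact P.not_mem hj (((P.mem_queue _).1 hu).2
    ((D.mem_outSet (D.src_lt _ hlt)).2 ⟨hlt, rfl⟩))

theorem outSet_subset_insert {u : ℕ} (hu : u < D.N)
    (hne : u ≠ D.src (D.inc j)) : D.outSet u ⊆ insert (D.inc j) F ↔ D.outSet u ⊆ F := by
  refine ⟨fun h e he => ?_, fun h => h.trans (Finset.subset_insert _ _)⟩
  refine (Finset.mem_insert.1 (h he)).resolve_left ?_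
  rintro rfl
  exact hne ((D.mem_outSet hu).1 he).2.symm

theorem step_push (P : Peeling D Q F h v j je) (hj : j < je)
    (hu : D.outSet (D.src (D.inc j)) ⊆ insert (D.inc j) F) :
    Peeling D (Q ++ [D.src (D.inc j)]) (insert (D.inc j) F) h v (j + 1) je where
  nodup := by
    rw [List.nodup_append']
    refine ⟨P.nodup, List.nodup_singleton _, fun a ha ha' => ?_⟩
    rw [List.mem_singleton] at ha'
    exact P.src_not_mem hj (ha' ▸ ha)
  mem_queue u := by
    rw [List.mem_append, List.mem_singleton, P.mem_queue]
    have hN := D.src_lt _ (D.inc_lt j (P.pos_lt hj))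
    by_cases h : u = D.src (D.inc j)
    · subst h; simp [hN, hu]
    · simp only [h, or_false]
      exact and_congr_right fun hlt => (outSet_subset_insert hlt h).symm
  mem_edges e := by
    rw [P.mem_insert_iff hj, List.take_append_of_le_length P.le_length]
  topo i hi e he := by
    rw [List.length_append, List.length_singleton] at hi
    rw [List.take_append_of_le_length (by omega)]
    by_cases h : i < Q.length
    · rw [List.getElem_append_left h] at he
      exact P.topo i h e he
    · obtain rfl : i = Q.length := by omega
      rw [List.getElem_append_right le_rfl] at he
      simp only [Nat.sub_self, List.getElem_cons_zero] at he
      -- A node enters the queue only when all its edges are processed, and processed edges point to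
      -- nodes that have already left the queue.
      have := ((P.mem_insert_iff hj e).1 (hu he)).2.1
      rw [List.take_length]
      exact List.mem_of_mem_take this
  le_length := by have := P.le_length; simp; omega
  current := P.current_succ hj _ (List.take_append_of_le_length P.le_length)

theorem step_skip (P : Peeling D Q F h v j je) (hj : j < je)
    (hu : ¬ D.outSet (D.src (D.inc j)) ⊆ insert (D.inc j) F) :
    Peeling D Q (insert (D.inc j) F) h v (j + 1) je where
  nodup := P.nodup
  mem_queue u := by
    rw [P.mem_queue]
    refine and_congr_right fun hlt => ?_
    by_cases h : u = D.src (D.inc j)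
    · subst h
      exact ⟨fun h' => absurd (h'.trans (Finset.subset_insert _ _)) hu, fun h' => absurd h' hu⟩
    · exact (outSet_subset_insert hlt h).symm
  mem_edges := P.mem_insert_iff hj
  topo := P.topo
  le_length := P.le_length
  current := P.current_succ hj _ rfl

theorem step_pop (P : Peeling D Q F h v j je) (hj : je ≤ j) (hh : h < Q.length) :
    Peeling D Q F (h + 1) Q[h] (D.incStart Q[h]) (D.incStart Q[h] + D.incCount Q[h]) where
  nodup := P.nodup
  mem_queue := P.mem_queue
  mem_edges e := by
    rw [P.mem_of_ge hj, List.take_add_one, List.getElem?_eq_getElem hh]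
    refine and_congr_right fun he => ?_
    simp only [Option.toList_some, List.mem_append, List.mem_singleton]
    -- No edge into the node that is about to leave has been processed, which matches the start of
    -- its interval as the new position.
    have hnot : Q[h] ∉ Q.take h := by
      intro hm
      obtain ⟨i, hi, he⟩ := List.mem_take_iff_getElem.1 hm
      have := P.nodup.getElem_inj_iff.1 he
      omega
    constructor
    · intro h1
      exact ⟨Or.inl h1, fun h2 => absurd (h2 ▸ h1) hnot⟩
    · rintro ⟨h1 | h1, h2⟩
      · exact h1
      · have := h2 h1
        have := (D.dst_eq_iff e he _ (h1 ▸ D.dst_lt e he)).1 h1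
        omega
  topo := P.topo
  le_length := hh
  current := by
    refine Or.inr ⟨?_, le_rfl, by omega, rfl⟩
    rw [List.mem_take_iff_getElem]
    exact ⟨h, by omega, rfl⟩

/-- The peeling cannot get stuck on an acyclic graph. By induction on the rank, all targets of the
edges out of `u` have left the queue, so these edges are processed and `u` has been queued. -/
theorem all_mem (P : Peeling D Q F h v j je) (hj : je ≤ j) (hh : Q.length ≤ h) :
    ∀ u < D.N, u ∈ Q := by
  intro u
  induction hr : D.rank u using Nat.strong_induction_on generalizing u with
  | _ n ih =>
    intro hu
    rw [P.mem_queue]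
    refine ⟨hu, fun e he => ?_⟩
    rw [P.mem_of_ge hj, List.take_of_length_le hh]
    obtain ⟨h1, h2⟩ := (D.mem_outSet hu).1 he
    have h3 := D.rank_lt e h1
    rw [h2, hr] at h3
    exact ⟨h1, ih _ h3 _ rfl (D.dst_lt e h1)⟩

theorem length_eq (P : Peeling D Q F h v j je) (hall : ∀ u < D.N, u ∈ Q) : Q.length = D.N := by
  refine le_antisymm P.length_le ?_
  have h1 : Finset.range D.N ⊆ Q.toFinset := fun u hu => by
    simpa using hall u (by simpa using hu)
  have := Finset.card_le_card h1
  rwa [List.toFinset_card_of_nodup P.nodup, Finset.card_range] at this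

/-- The work that is left. -/
theorem lt_length (P : Peeling D Q F h v j je) (hj : je ≤ j)
    (hn : 0 < (D.N - h) + (D.E - F.card)) : h < Q.length := by
  by_contra! hh
  have hall := P.all_mem hj hh
  have h1 := P.length_eq hall
  have h2 : Finset.range D.E ⊆ F := fun e he => by
    rw [Finset.mem_range] at he
    rw [P.mem_of_ge hj, List.take_of_length_le hh]
    exact ⟨he, hall _ (D.dst_lt e he)⟩
  have := Finset.card_le_card h2
  rw [Finset.card_range] at this
  omega

end Peeling

/-! ### The numbers of leaves -/

/-- The processed edges out of a node. -/
def NumIndex.done (D : NumIndex W S input) (F : Finset ℕ) (u : ℕ) : Finset ℕ :=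
  F.filter fun e => D.src e = u

/-- The leaves reached through the processed edges. -/
def NumIndex.partLeaves (D : NumIndex W S input) (F : Finset ℕ) (u : ℕ) : ℕ :=
  ∑ e ∈ D.done F u, D.leaves (D.dst e) + if u = D.sink then 1 else 0

section
variable (D : NumIndex W S input) {F : Finset ℕ} {u e : ℕ}

theorem NumIndex.done_subset (hF : F ⊆ Finset.range D.E) (hu : u < D.N) :
    D.done F u ⊆ D.outSet u := by
  intro e he
  rw [done, Finset.mem_filter] at he
  exact (D.mem_outSet hu).2 ⟨by simpa using hF he.1, he.2⟩

theorem NumIndex.card_outSet : (D.outSet u).card = D.outCount u := by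
  simp [outSet]

/-- Since the processed edges are among the outgoing ones, comparing a counter with the out-degree
decides whether a node is finished. -/
theorem NumIndex.card_done_eq (hF : F ⊆ Finset.range D.E) (hu : u < D.N) :
    (D.done F u).card = D.outCount u ↔ D.outSet u ⊆ F := by
  rw [← D.card_outSet]
  constructor
  · intro h
    rw [← Finset.eq_of_subset_of_card_le (D.done_subset hF hu) h.ge]
    exact Finset.filter_subset _ _
  · intro h
    congr 1
    refine Finset.Subset.antisymm (D.done_subset hF hu) fun e he => ?_
    rw [done, Finset.mem_filter]
    exact ⟨h he, ((D.mem_outSet hu).1 he).2⟩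

theorem NumIndex.done_eq (hF : F ⊆ Finset.range D.E) (hu : u < D.N) (h : D.outSet u ⊆ F) :
    D.done F u = D.outSet u :=
  Finset.eq_of_subset_of_card_le (D.done_subset hF hu)
    (by rw [D.card_outSet, (D.card_done_eq hF hu).2 h])

theorem NumIndex.partLeaves_eq (hF : F ⊆ Finset.range D.E) (hu : u < D.N) (h : D.outSet u ⊆ F) :
    D.partLeaves F u = D.leaves u := by
  rw [partLeaves, D.done_eq hF hu h]
  split_ifs with hs
  · subst hs
    have := (D.outCount_eq_zero _ D.sink_lt).2 rfl
    simp [outSet, this, D.leaves_sink]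
  · rw [D.leaves_eq u hu hs]; rfl

/-- Partial sums never exceed the final number of leaves, so the additions do not overflow. -/
theorem NumIndex.partLeaves_le (hF : F ⊆ Finset.range D.E) (hu : u < D.N) :
    D.partLeaves F u ≤ D.leaves u := by
  have h1 := D.partLeaves_eq subset_rfl hu fun e he => by
    simpa using ((D.mem_outSet hu).1 he).1
  rw [← h1]
  refine Nat.add_le_add_right (Finset.sum_le_sum_of_subset ?_) _
  exact Finset.filter_subset_filter _ hF

theorem NumIndex.done_insert : D.done (insert e F) u =
    if D.src e = u then insert e (D.done F u) else D.done F u := by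
  rw [done, Finset.filter_insert]; rfl

theorem NumIndex.not_mem_done (he : e ∉ F) : e ∉ D.done F u :=
  fun h => he (Finset.filter_subset _ _ h)

theorem NumIndex.card_done_insert (he : e ∉ F) : (D.done (insert e F) u).card =
    (D.done F u).card + if D.src e = u then 1 else 0 := by
  rw [D.done_insert]
  split_ifs with h
  · rw [Finset.card_insert_of_notMem (D.not_mem_done he)]
  · rfl

theorem NumIndex.partLeaves_insert (he : e ∉ F) : D.partLeaves (insert e F) u =
    D.partLeaves F u + if D.src e = u then D.leaves (D.dst e) else 0 := by
  rw [partLeaves, D.done_insert, partLeaves]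
  split_ifs with h
  all_goals try rw [Finset.sum_insert (D.not_mem_done he)]
  all_goals omega

end

/-- Cells 7: leaves, cells 1: processed outgoing edges, cells 3: the queue. -/
def peelBody : Program :=
  seqs [.arith 10 .sub (.reg 10) (.const 1),
    .ite (.lt (.reg 8) (.reg 9))
      (seqs [incEntry 12 (.reg 8), .arith 8 .add (.reg 8) (.const 1), edgeField 13 (.reg 12) 0,
        getCell 14 (.reg 13) 7, .arith 14 .add (.reg 14) (.reg 11), setCell (.reg 13) 7 (.reg 14),
        getCell 15 (.reg 13) 1, .arith 15 .add (.reg 15) (.const 1), setCell (.reg 13) 1 (.reg 15),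
        nodeField 16 (.reg 13) 5,
        .ite (.eq (.reg 15) (.reg 16))
          (seqs [setCell (.reg 7) 3 (.reg 13), .arith 7 .add (.reg 7) (.const 1)]) .skip])
      (seqs [getCell 17 (.reg 6) 3, .arith 6 .add (.reg 6) (.const 1), nodeField 8 (.reg 17) 6,
        nodeField 9 (.reg 17) 7, .arith 9 .add (.reg 9) (.reg 8), getCell 11 (.reg 17) 7])]

/-- Computes the numbers of leaves and a reverse topological order. -/
def peelLoop : Program := .loop (.lt (.const 0) (.reg 10)) peelBody

def peelInit : Program :=
  seqs [.arith 6 .add (.const 0) (.const 0), .arith 7 .add (.const 1) (.const 0),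
    .arith 8 .add (.const 0) (.const 0), .arith 9 .add (.const 0) (.const 0),
    .arith 10 .add (.reg 0) (.reg 1), setCell (.const 0) 3 (.reg 3), setCell (.reg 3) 7 (.const 1)]

/-- The state of the computation of the leaves. -/
structure PeelState (D : NumIndex W S input) (s₀ : State) (Q : List ℕ) (F : Finset ℕ)
    (h v j je n : ℕ) (s : State) : Prop where
  header : HasHeader D s
  peel : Peeling D Q F h v j je
  left_eq : n = (D.N - h) + (D.E - F.card)
  r6 : s.reg 6 = h
  r7 : s.reg 7 = Q.length
  r8 : s.reg 8 = j
  r9 : s.reg 9 = je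
  r10 : s.reg 10 = n
  r11 : j < je → s.reg 11 = D.leaves v
  leaves : ∀ u < D.N, s.mem (u * 8 + 7) = D.partLeaves F u
  count : ∀ u < D.N, s.mem (u * 8 + 1) = (D.done F u).card
  queue : ∀ i (hi : i < Q.length), s.mem (i * 8 + 3) = Q[i]
  hasPos : HasPos D s
  r24 : s.reg 24 = s₀.reg 24
  r25 : s.reg 25 = s₀.reg 25
  out : s.out = s₀.out
  log : s.log = s₀.log

theorem PeelState.pop {D : NumIndex W S input} {s₀ s : State} {Q : List ℕ} {F : Finset ℕ}
    {h v j je n : ℕ} (P : PeelState D s₀ Q F h v j je (n + 1) s) (hj : je ≤ j) :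
    wp W S input peelBody (fun s' => ∃ Q F h v j je, PeelState D s₀ Q F h v j je n s') s := by
  obtain ⟨hh, pl, hn, g6, g7, g8, g9, g10, g11, gl, gc, gq, gp, g24, g25, go, gg⟩ := P
  have ⟨g0, g1, g2, g3, g4, g5⟩ := hh
  have hW := D.hW
  have hlt := pl.lt_length hj (by omega)
  have hQ := gq _ hlt
  have hQN := pl.lt_of_mem (List.getElem_mem hlt)
  have hle := pl.length_le
  have hinc := D.inc_le _ hQN
  have hcard := pl.card_le
  -- The number of leaves of a node in the queue is final, and may be passed on to the sources of
  -- its incoming edges.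
  have hlv := D.partLeaves_eq pl.subset_range hQN ((pl.mem_queue _).1 (List.getElem_mem hlt)).2
  subst h j je
  rw [peelBody, wp_seqs_cons, wp_sub (by simp only [val_reg]; omega), wp_seqs_cons, wp_ite]
  refine ⟨fun hc => ?_, fun _ => ?_⟩
  · simp only [holds_lt, val_reg, reg_set] at hc
    norm_num at hc
    omega
  simp (disch := (try simp [reg_set, val_reg, val_const, mem_set, mem_put, reg_put, hQ]) <;> omega) only
      [wp_seqs_cons, wp_seqs_nil, wp_getCell D, wp_incStart D, wp_incCount D, wp_add]
  refine ⟨Q, F, _, _, _, _, ?_, pl.step_pop hj hlt, ?_, ?_, ?_, ?_, ?_, ?_, ?_, gl, gc, gq, gp,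
    ?_, ?_, go, gg⟩
  · constructor <;> simp [reg_set, g0, g1, g2, g3, g4, g5]
  · omega
  all_goals simp [reg_set, val_reg, val_const, mem_set, hQ, g7, g10, g24, g25]
  · omega
  · intro _
    rw [gl _ hQN, hlv]

theorem PeelState.edge {D : NumIndex W S input} {s₀ s : State} {Q : List ℕ} {F : Finset ℕ}
    {h v j je n : ℕ} (P : PeelState D s₀ Q F h v j je (n + 1) s) (hj : j < je) :
    wp W S input peelBody (fun s' => ∃ Q F h v j je, PeelState D s₀ Q F h v j je n s') s := by
  obtain ⟨hh, pl, hn, g6, g7, g8, g9, g10, g11, gl, gc, gq, gp, g24, g25, go, gg⟩ := P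
  have ⟨g0, g1, g2, g3, g4, g5⟩ := hh
  have hW := D.hW
  have hle := pl.length_le
  have hcard := pl.card_le
  have hpos := pl.pos_lt hj
  have hdst := pl.dst_inc hj
  have hnot := pl.not_mem hj
  have hv11 := g11 hj
  have hinc := D.inc_lt _ hpos
  have hsrc := D.src_lt _ hinc
  have hsub : insert (D.inc j) F ⊆ Finset.range D.E :=
    Finset.insert_subset (by simpa using hinc) pl.subset_range
  have hlW := D.leaves_lt _ hsrc
  have hl1 := D.partLeaves_le hsub hsrc
  have hl2 := D.partLeaves_insert (u := D.src (D.inc j)) hnot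
  have hc1 := Finset.card_le_card (Finset.filter_subset (fun e => D.src e = D.src (D.inc j)) F)
  have hc2 := D.card_done_insert (u := D.src (D.inc j)) hnot
  have hc3 := D.card_done_eq hsub hsrc
  have hci := Finset.card_insert_of_notMem hnot
  have hcard' : (insert (D.inc j) F).card ≤ D.E := by simpa using Finset.card_le_card hsub
  change (D.done F _).card ≤ _ at hc1
  rw [if_pos rfl] at hl2 hc2
  rw [hdst] at hl2
  have ml := gl _ hsrc
  have mc := gc _ hsrc
  have hnew : ∀ u, D.partLeaves (insert (D.inc j) F) u =
      if u = D.src (D.inc j) then D.partLeaves F (D.src (D.inc j)) + D.leaves v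
      else D.partLeaves F u := by
    intro u
    rw [D.partLeaves_insert hnot, hdst]
    by_cases h : u = D.src (D.inc j)
    · rw [if_pos h.symm, if_pos h, h]
    · rw [if_neg (Ne.symm h), if_neg h, add_zero]
  have hnewc : ∀ u, (D.done (insert (D.inc j) F) u).card =
      if u = D.src (D.inc j) then (D.done F (D.src (D.inc j))).card + 1
      else (D.done F u).card := by
    intro u
    rw [D.card_done_insert hnot]
    by_cases h : u = D.src (D.inc j)
    · rw [if_pos h.symm, if_pos h, h]
    · rw [if_neg (Ne.symm h), if_neg h, add_zero]
  subst h j je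
  rw [peelBody, wp_seqs_cons, wp_sub (by simp only [val_reg]; omega), wp_seqs_cons, wp_ite]
  refine ⟨fun _ => ?_, fun hc => ?_⟩
  swap
  · simp only [holds_lt, val_reg, reg_set] at hc
    norm_num at hc
    omega
  simp (disch := (try simp [reg_set, val_reg, val_const, mem_set, mem_put, reg_put]) <;> omega) only
      [wp_seqs_cons, wp_seqs_nil, wp_getCell D, wp_setCell D, wp_incEntry D, wp_src D,
        wp_outCount D, wp_add, wp_ite, wp_skip, holds_eq, cell_eq_iff, and_false, set_set, ml, mc,
        val_reg, val_const, reg_set, reg_put, mem_set, mem_put, reduceIte, Nat.reduceEqDiff]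
  have hjN : s.reg 7 ≤ D.N := by omega
  constructor
  · intro hfull
    rw [← hc2] at hfull
    have P := pl.step_push hj (hc3.1 hfull)
    refine ⟨_, _, _, _, _, _, ?_, P, ?_, ?_, ?_, ?_, ?_, ?_, ?_, ?_, ?_, ?_, ?_, ?_, ?_, ?_, ?_⟩
    · constructor <;> simp [reg_set, reg_put, g0, g1, g2, g3, g4, g5]
    · omega
    · simp [reg_set, reg_put]
    · simp [reg_set, reg_put, g7]
    · simp [reg_set, reg_put]
    · simp [reg_set, reg_put]
    · simp [reg_set, reg_put, g10]
    · intro _; simp [reg_set, reg_put, hv11]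
    · intro u hu
      simp (disch := omega) only [mem_put, mem_set, cell_eq_iff, hnew, hv11]
      by_cases h : u = D.src (D.inc (s.reg 8)) <;> simp [h, gl u hu]
    · intro u hu
      simp (disch := omega) only [mem_put, mem_set, cell_eq_iff, hnewc]
      by_cases h : u = D.src (D.inc (s.reg 8)) <;> simp [h, gc u hu]
    · intro i hi
      simp (disch := omega) only [mem_put, mem_set, cell_eq_iff]
      rw [List.length_append, List.length_singleton] at hi
      by_cases h : i = Q.length
      · subst h; simp [g7]
      · rw [if_neg (by omega), if_neg (by omega), if_neg (by omega),
          List.getElem_append_left (by omega), gq i (by omega)]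
    · intro e he
      simp (disch := omega) only [mem_put, mem_set, cell_eq_iff]
      simp [gp e he]
    · simp [reg_set, reg_put, g24]
    · simp [reg_set, reg_put, g25]
    · simp [out_set, out_put, go]
    · simp [log_set, log_put, gg]
  · intro hfull
    rw [← hc2] at hfull
    have P := pl.step_skip hj fun h => hfull (hc3.2 h)
    refine ⟨_, _, _, _, _, _, ?_, P, ?_, ?_, ?_, ?_, ?_, ?_, ?_, ?_, ?_, ?_, ?_, ?_, ?_, ?_, ?_⟩
    · constructor <;> simp [reg_set, reg_put, g0, g1, g2, g3, g4, g5]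
    · omega
    · simp [reg_set, reg_put]
    · simp [reg_set, reg_put, g7]
    · simp [reg_set, reg_put]
    · simp [reg_set, reg_put]
    · simp [reg_set, reg_put, g10]
    · intro _; simp [reg_set, reg_put, hv11]
    · intro u hu
      simp (disch := omega) only [mem_put, mem_set, cell_eq_iff, hnew, hv11]
      by_cases h : u = D.src (D.inc (s.reg 8)) <;> simp [h, gl u hu]
    · intro u hu
      simp (disch := omega) only [mem_put, mem_set, cell_eq_iff, hnewc]
      by_cases h : u = D.src (D.inc (s.reg 8)) <;> simp [h, gc u hu]
    · intro i hi
      simp (disch := omega) only [mem_put, mem_set, cell_eq_iff]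
      simp [gq i hi]
    · intro e he
      simp (disch := omega) only [mem_put, mem_set, cell_eq_iff]
      simp [gp e he]
    · simp [reg_set, reg_put, g24]
    · simp [reg_set, reg_put, g25]
    · simp [out_set, out_put, go]
    · simp [log_set, log_put, gg]

/-- The leaves have been counted, and `Q` is a reverse topological order. -/
structure Peeled (D : NumIndex W S input) (s₀ : State) (Q : List ℕ) (s : State) : Prop where
  header : HasHeader D s
  length_eq : Q.length = D.N
  lt_of_mem : ∀ u ∈ Q, u < D.N
  mem : ∀ u < D.N, u ∈ Q
  topo : ∀ i (hi : i < Q.length), ∀ e ∈ D.outSet Q[i], D.dst e ∈ Q.take i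
  nodup : Q.Nodup
  r6 : s.reg 6 = D.N
  leaves : ∀ u < D.N, s.mem (u * 8 + 7) = D.leaves u
  queue : ∀ i (hi : i < Q.length), s.mem (i * 8 + 3) = Q[i]
  hasPos : HasPos D s
  r24 : s.reg 24 = s₀.reg 24
  r25 : s.reg 25 = s₀.reg 25
  out : s.out = s₀.out
  log : s.log = s₀.log

theorem PeelState.finish {D : NumIndex W S input} {s₀ s : State} {Q : List ℕ} {F : Finset ℕ}
    {h v j je : ℕ} (P : PeelState D s₀ Q F h v j je 0 s) : Peeled D s₀ Q s := by
  have h1 := P.peel.le_length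
  have h2 := P.peel.length_le
  have h3 := P.peel.card_le
  have h4 := P.left_eq
  have hF : F = Finset.range D.E :=
    Finset.eq_of_subset_of_card_le P.peel.subset_range (by rw [Finset.card_range]; omega)
  have hsub : ∀ u < D.N, D.outSet u ⊆ F := fun u hu e he => by
    rw [hF, Finset.mem_range]
    exact ((D.mem_outSet hu).1 he).1
  refine ⟨P.header, by omega, fun u => P.peel.lt_of_mem,
    fun u hu => (P.peel.mem_queue u).2 ⟨hu, hsub u hu⟩, P.peel.topo, P.peel.nodup,
    by rw [P.r6]; omega, fun u hu => ?_, P.queue, P.hasPos, P.r24, P.r25, P.out, P.log⟩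
  rw [P.leaves u hu, D.partLeaves_eq P.peel.subset_range hu (hsub u hu)]

/-- The counters of leaves and processed edges start from the zeros of the initial memory. Only the
sink needs an entry of its own, with one leaf, and it forms the initial queue. -/
theorem wp_peelInit (D : NumIndex W S input) {s : State} (hh : HasHeader D s) (hp : HasPos D s)
    (hmem : ∀ i c, c < 8 → c ≠ 4 → s.mem (i * 8 + c) = 0) :
    wp W S input peelInit (PeelState D s [D.sink] ∅ 0 0 0 0 (D.N + D.E)) s := by
  have ⟨g0, g1, g2, g3, g4, g5⟩ := hh
  have hW := D.hW
  have hs := D.sink_lt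
  simp (disch := (try simp [reg_set, val_reg, val_const, mem_set, mem_put, reg_put]) <;> omega) only
    [peelInit, wp_seqs_cons, wp_seqs_nil, wp_setCell D, wp_add, val_reg, val_const, reg_set, reg_put,
      reduceIte, Nat.reduceEqDiff, g0, g1, g3]
  have hd : ∀ u, D.done ∅ u = ∅ := fun u => by simp [NumIndex.done]
  refine ⟨?_, Peeling.init D 0, ?_, ?_, ?_, ?_, ?_, ?_, ?_, ?_, ?_, ?_, ?_, ?_, ?_, ?_, ?_⟩
  · constructor <;> simp [reg_set, reg_put, g0, g1, g2, g3, g4, g5]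
  · simp
  · simp [reg_set, reg_put]
  · simp [reg_set, reg_put]
  · simp [reg_set, reg_put]
  · simp [reg_set, reg_put]
  · simp [reg_set, reg_put]
  · intro h; omega
  · intro u hu
    simp (disch := omega) only [mem_put, mem_set, cell_eq_iff, hmem, NumIndex.partLeaves, hd]
    simp
  · intro u hu
    simp (disch := omega) only [mem_put, mem_set, cell_eq_iff, hmem, hd]
    simp
  · intro i hi
    obtain rfl : i = 0 := by simpa using hi
    simp only [mem_put, mem_set]
    rw [if_neg (by omega)]
    simp
  · intro e he
    simp (disch := omega) only [mem_put, mem_set, cell_eq_iff]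
    rw [if_neg (by omega), if_neg (by omega), hp e he]
  · simp [reg_set, reg_put]
  · simp [reg_set, reg_put]
  · simp [out_set, out_put]
  · simp [log_set, log_put]

/-- Every iteration either processes one edge or removes one node from the queue, so their number is
known in advance and kept in register 10. -/
theorem runs_peelLoop (D : NumIndex W S input) {s₀ s : State} {n : ℕ}
    (hs : PeelState D s₀ [D.sink] ∅ 0 0 0 0 n s) :
    Runs W S input peelLoop s (n * (cost peelBody + 1) + 1) (fun s' => ∃ Q, Peeled D s₀ Q s') := by
  refine (Runs.loop (k := cost peelBody) (fun n s' => ∃ Q F h v j je,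
    PeelState D s₀ Q F h v j je n s') ?_ ?_ n ⟨_, _, _, _, _, _, hs⟩).mono le_rfl ?_
  · rintro n s' ⟨Q, F, h, v, j, je, P⟩
    refine ⟨?_, runs_of_wp ?_⟩
    · rw [holds_lt, val_const, val_reg, P.r10]; omega
    · rcases lt_or_ge j je with hj | hj
      · exact P.edge hj
      · exact P.pop hj
  · rintro s' ⟨Q, F, h, v, j, je, P⟩
    rw [holds_lt, val_const, val_reg, P.r10]; omega
  · rintro s' ⟨Q, F, h, v, j, je, P⟩
    exact ⟨Q, P.finish⟩

/-! ### The first symbols of the shortest upper strings -/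

/-- Cells 2: first symbols of the shortest upper strings. -/
def leadBody : Program :=
  seqs [.arith 6 .sub (.reg 6) (.const 1), getCell 17 (.reg 6) 3,
    .ite (.eq (.reg 17) (.reg 2)) .skip
      (seqs [nodeField 18 (.reg 17) 6, nodeField 19 (.reg 17) 7, .arith 18 .add (.reg 18) (.reg 19),
        .arith 18 .sub (.reg 18) (.const 1), incEntry 21 (.reg 18), edgeSymbol 22 (.reg 21),
        setCell (.reg 17) 2 (.reg 22)])]

def leadLoop : Program := .loop (.lt (.const 0) (.reg 6)) leadBody

/-- All tables have been computed. -/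
structure Prepared (D : NumIndex W S input) (s₀ s : State) : Prop where
  header : HasHeader D s
  leaves : ∀ u < D.N, s.mem (u * 8 + 7) = D.leaves u
  lead : ∀ u < D.N, u ≠ D.root → s.mem (u * 8 + 2) = D.lead u
  hasPos : HasPos D s
  r6 : s.reg 6 = 0
  r24 : s.reg 24 = s₀.reg 24
  r25 : s.reg 25 = s₀.reg 25
  out : s.out = s₀.out
  log : s.log = s₀.log

/-- The queue is traversed backwards. As it is a reverse topological order, the source of the last
incoming edge of a node is treated before the node. -/
theorem runs_leadLoop (D : NumIndex W S input) {s₀ s : State} {Q : List ℕ}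
    (hs : Peeled D s₀ Q s) :
    Runs W S input leadLoop s (D.N * (cost leadBody + 1) + 1) (Prepared D s₀) := by
  have hQ := hs.length_eq
  refine (Runs.loop (k := cost leadBody) (fun n s' => n ≤ D.N ∧ HasHeader D s' ∧ s'.reg 6 = n ∧
    (∀ u < D.N, s'.mem (u * 8 + 7) = D.leaves u) ∧ HasPos D s' ∧
    (∀ i (hi : i < Q.length), s'.mem (i * 8 + 3) = Q[i]) ∧
    (∀ i (hi : i < Q.length), n ≤ i → Q[i] ≠ D.root → s'.mem (Q[i] * 8 + 2) = D.lead Q[i]) ∧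
    s'.reg 24 = s₀.reg 24 ∧ s'.reg 25 = s₀.reg 25 ∧ s'.out = s₀.out ∧ s'.log = s₀.log)
    ?_ ?_ D.N ⟨le_rfl, hs.header, hs.r6, hs.leaves, hs.hasPos, hs.queue, fun i hi h => by omega,
      hs.r24, hs.r25, hs.out, hs.log⟩).mono le_rfl ?_
  · rintro n s' ⟨hn, hh, g6, gl, gp, gq, gs, g24, g25, go, gg⟩
    have ⟨g0, g1, g2, g3, g4, g5⟩ := hh
    have hW := D.hW
    have hnQ : n < Q.length := by omega
    have hv := hs.lt_of_mem _ (List.getElem_mem hnQ)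
    have g6' : s'.reg 6 - 1 = n := by omega
    have hqv := gq n hnQ
    have hinc := D.inc_le _ hv
    refine ⟨by rw [holds_lt, val_const, val_reg]; omega, runs_of_wp ?_⟩
    simp (disch := (try simp [reg_set, val_reg, val_const, mem_set, mem_put, reg_put]) <;> omega) only
      [leadBody, wp_seqs_cons, wp_seqs_nil, wp_getCell D, wp_sub, wp_ite, wp_skip, holds_eq,
        val_reg, val_const, reg_set, reg_put, mem_set, reduceIte, Nat.reduceEqDiff, g6', hqv, g2]
    constructor
    · intro hr
      refine ⟨by omega, ?_, ?_, gl, gp, gq, ?_, ?_, ?_, go, gg⟩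
      · constructor <;> simp [reg_set, reg_put, g0, g1, g2, g3, g4, g5]
      · simp [reg_set]
      · intro i hi hni hne
        refine gs i hi (lt_of_le_of_ne hni ?_) hne
        rintro rfl; exact hne hr
      · simp [reg_set, g24]
      · simp [reg_set, g25]
    · intro hr
      have hpos := D.incCount_pos _ hv hr
      have hl := D.lead_eq _ hv hr
      have hk : D.incStart Q[n] + D.incCount Q[n] - 1 < D.E := by omega
      have he := D.inc_lt _ hk
      have hsl := D.sym_lt he
      have hsrc := D.src_lt _ he
      have hdst : D.dst (D.inc (D.incStart Q[n] + D.incCount Q[n] - 1)) = Q[n] := by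
        rw [D.dst_eq_iff _ he _ hv, D.pos_inc _ hk]
        omega
      -- By the order of the queue, the target `Q[n]` precedes the source of this edge, whose
      -- leading symbol has therefore been stored in an earlier iteration.
      have hsym : D.src (D.inc (D.incStart Q[n] + D.incCount Q[n] - 1)) ≠ D.root →
          s'.mem (D.src (D.inc (D.incStart Q[n] + D.incCount Q[n] - 1)) * 8 + 2) =
            D.lead (D.src (D.inc (D.incStart Q[n] + D.incCount Q[n] - 1))) := by
        intro hne
        obtain ⟨k, hk', hke⟩ := List.getElem_of_mem (hs.mem _ hsrc)
        have htopo := hs.topo k hk' _ ((D.mem_outSet (hke ▸ hsrc)).2 ⟨he, hke.symm⟩)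
        rw [hdst] at htopo
        obtain ⟨i, hi, hie⟩ := List.mem_take_iff_getElem.1 htopo
        have := hs.nodup.getElem_inj_iff.1 hie
        rw [← hke] at hne ⊢
        exact gs k hk' (by omega) hne
      generalize hE : D.inc (D.incStart Q[n] + D.incCount Q[n] - 1) = E at *
      change _ = D.sym E at hl
      simp (disch := (try simp [reg_set, val_reg, val_const, mem_set, mem_put, reg_put, hE, *]) <;> omega) only
        [wp_seqs_cons, wp_seqs_nil, wp_incStart D, wp_incCount D, wp_add, wp_sub, wp_incEntry D,
          val_reg, val_const, reg_set, reg_put, mem_set, reduceIte, Nat.reduceEqDiff, hE, set_set]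
      rw [wp_edgeSymbol D (by simp [reg_set, he]) (by simp [reg_set, g2]) (by simp [reg_set, g4])
        (by decide) (by decide) (by simpa [reg_set, mem_set] using hsym)]
      simp (disch := (try simp [reg_set, val_reg, val_const, mem_set, mem_put, reg_put]) <;> omega) only
        [wp_seqs_cons, wp_seqs_nil, wp_setCell D,
          val_reg, val_const, reg_set, reg_put, mem_set, reduceIte, Nat.reduceEqDiff]
      refine ⟨by omega, ?_, ?_, ?_, ?_, ?_, ?_, ?_, ?_, go, gg⟩
      · constructor <;> simp [reg_set, reg_put, g0, g1, g2, g3, g4, g5]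
      · simp [reg_set, reg_put]
      · intro u hu
        simp (disch := omega) only [mem_put, mem_set, cell_eq_iff]
        simp [gl u hu]
      · intro u hu
        simp (disch := omega) only [mem_put, mem_set, cell_eq_iff]
        simp [gp u hu]
      · intro i hi
        simp (disch := omega) only [mem_put, mem_set, cell_eq_iff]
        simp [gq i hi]
      · intro i hi hni hne
        simp (disch := omega) only [mem_put, mem_set, cell_eq_iff]
        by_cases h : Q[i] = Q[n]
        · simp [h, hl]
        · simp only [h, false_and, if_false]
          refine gs i hi (lt_of_le_of_ne hni ?_) hne
          rintro rfl; exact h rfl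
      · simp [reg_set, reg_put, g24]
      · simp [reg_set, reg_put, g25]
  · rintro s' ⟨-, -, g6, -⟩
    rw [holds_lt, val_const, val_reg, g6]; omega
  · rintro s' ⟨-, hh, g6, gl, gp, -, gs, g24, g25, go, gg⟩
    refine ⟨hh, gl, fun u hu hr => ?_, gp, g6, g24, g25, go, gg⟩
    obtain ⟨i, hi, rfl⟩ := List.getElem_of_mem (hs.mem u hu)
    exact gs i hi (by omega) hr

end WordRAM

namespace WordRAM

variable {W S : ℕ} {input : List ℕ}

/-! ### The output -/

/-- Adds the run of `reg 27` symbols `reg 26` to the output, whose last run, of `reg 25` symbols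
`reg 24`, is pending. -/
def emitRun : Program :=
  .ite (.lt (.const 0) (.reg 27))
    (.ite (.eq (.reg 24) (.reg 26)) (.arith 25 .add (.reg 25) (.reg 27))
      (seqs [.ite (.lt (.const 0) (.reg 25)) (seqs [.write (.reg 24), .write (.reg 25)]) .skip,
        .arith 24 .add (.reg 26) (.const 0), .arith 25 .add (.reg 27) (.const 0)])) .skip

/-- The words of a run-length encoded string. -/
def runWords (A : List (ℕ × ℕ)) : List ℕ := A.flatMap fun p => [p.1, p.2]

/-- The output and the pending run represent the string `A`. -/
def HasOutput (W : ℕ) (A : List (ℕ × ℕ)) (s : State) : Prop :=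
  s.reg 24 < W ∧ (A = [] ∧ s.out = [] ∧ s.reg 25 = 0 ∨
    ∃ A', A = A' ++ [(s.reg 24, s.reg 25)] ∧ 0 < s.reg 25 ∧ s.out = runWords A')

/-- The next run may still merge with the last one, so the last run stays in registers 24 and 25 and
is written only when a different symbol arrives. -/
theorem wp_emitRun {A : List (ℕ × ℕ)} {s : State} {Q : State → Prop} (hA : HasOutput W A s)
    (h26 : s.reg 26 < W) (h27 : 0 < s.reg 27) (ht : runTotal A + s.reg 27 < W)
    (hQ : ∀ s', HasOutput W (rlConcat A [(s.reg 26, s.reg 27)]) s' → s'.mem = s.mem →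
      s'.log = s.log → (∀ r, r ≠ 24 → r ≠ 25 → s'.reg r = s.reg r) → Q s') :
    wp W S input emitRun Q s := by
  rw [emitRun, wp_ite]
  refine ⟨fun _ => ?_, fun h => absurd (by simpa only [holds_lt, val_const, val_reg] using h27) h⟩
  have h25 : s.reg 25 ≤ runTotal A := by
    obtain ⟨-, ⟨-, -, h⟩ | ⟨A', rfl, -⟩⟩ := hA
    · omega
    · simp [runTotal]
  rw [wp_ite]
  obtain ⟨h24, hA⟩ := hA
  constructor
  · intro he
    rw [holds_eq, val_reg, val_reg] at he
    rw [wp_add (by simp only [val_reg]; omega)]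
    refine hQ _ ⟨by simpa [reg_set] using h24, Or.inr ?_⟩ rfl rfl fun r _ h => by simp [reg_set, h]
    -- Register 24 has no meaning while nothing is pending, but an accidental equality is harmless:
    -- register 25 is zero, so the addition stores the right length.
    rcases hA with ⟨rfl, h1, h2⟩ | ⟨A', rfl, h1, h2⟩
    · exact ⟨[], by simp [rlConcat_nil_left, reg_set, val_reg, he, h2],
        by simp [reg_set, val_reg]; omega, by simp [out_set, h1, runWords]⟩
    · refine ⟨A', ?_, by simp [reg_set, val_reg]; omega, by simp [out_set, h2]⟩
      rw [rlConcat_concat_cons]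
      simp [he, reg_set, val_reg]
  · intro he
    rw [holds_eq, val_reg, val_reg] at he
    rw [wp_seqs_cons, wp_ite]
    constructor
    · intro hp
      rw [holds_lt, val_const, val_reg] at hp
      obtain ⟨A', rfl, h1, h2⟩ := hA.resolve_left (by omega)
      simp (disch := (try simp [val_reg, val_const, reg_set, reg_emit]) <;> omega) only
        [wp_seqs_cons, wp_seqs_nil, wp_write, wp_add, val_reg, val_const, reg_set, reg_emit,
          reduceIte, Nat.reduceEqDiff]
      refine hQ _ ⟨by simpa [reg_set, reg_emit] using h26, Or.inr ⟨A' ++ [(s.reg 24, s.reg 25)], ?_,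
        by simp [reg_set, reg_emit]; omega, ?_⟩⟩ rfl rfl fun r h h' => by simp [reg_set, reg_emit, h, h']
      · rw [rlConcat_concat_cons]
        simp [he, reg_set, reg_emit]
      · simp [out_set, out_emit, h2, runWords]
    · intro hp
      rw [holds_lt, val_const, val_reg] at hp
      obtain ⟨rfl, h1, h2⟩ := hA.resolve_right (by rintro ⟨-, -, h, -⟩; omega)
      simp (disch := (try simp [val_reg, val_const, reg_set, reg_emit]) <;> omega) only
        [wp_seqs_cons, wp_seqs_nil, wp_write, wp_add, wp_skip, val_reg, val_const, reg_set, reg_emit,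
          reduceIte, Nat.reduceEqDiff]
      refine hQ _ ⟨by simpa [reg_set, reg_emit] using h26, Or.inr ⟨[], ?_,
        by simp [reg_set, reg_emit]; omega, ?_⟩⟩ rfl rfl fun r h h' => by simp [reg_set, reg_emit, h, h']
      · simp [rlConcat_nil_left, reg_set, reg_emit]
      · simp [out_set, h1, runWords]

/-- Length zero signals that there is no run to add, so every iteration of the traversal can end
with the same code. -/
theorem wp_emitRun_zero {s : State} {Q : State → Prop} (h27 : s.reg 27 = 0) (hQ : Q s) :
    wp W S input emitRun Q s := by
  rw [emitRun, wp_ite]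
  refine ⟨fun h => ?_, fun _ => by rwa [wp_skip]⟩
  rw [holds_lt, val_const, val_reg] at h
  omega

/-! ### The traversal -/

/-- The symbol of the end-marker: the first symbol at the first edge of the root. -/
def NumIndex.endSym (D : NumIndex W S input) : ℕ := D.fst (D.outStart D.root)

/-- `Walk D j je ems L`: the traversal of the edges from `j` to `je` of a node, and of everything
below primary edges, emits the runs `ems` and handles the edges `L`. -/
inductive Walk (D : NumIndex W S input) : ℕ → ℕ → List (ℕ × ℕ) → List ℕ → Prop
  | done (j : ℕ) : Walk D j j [] []
  | primary {j je : ℕ} {E₁ E₂ : List (ℕ × ℕ)} {L₁ L₂ : List ℕ} (hj : j < je)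
      (hp : D.pos j = D.incStart (D.dst j))
      (hsub : Walk D (D.outStart (D.dst j)) (D.outStart (D.dst j) + D.outCount (D.dst j)) E₁ L₁)
      (hrest : Walk D (j + 1) je E₂ L₂) :
      Walk D j je ((if D.outCount (D.dst j) = 0 then [(D.endSym, 1)] else []) ++ E₁ ++ E₂)
        (j :: L₁ ++ L₂)
  | secondary {j je : ℕ} {E : List (ℕ × ℕ)} {L : List ℕ} (hj : j < je)
      (hp : D.pos j ≠ D.incStart (D.dst j)) (hrest : Walk D (j + 1) je E L) :
      Walk D j je ((D.sym (D.inc (D.pos j - 1)), D.leaves (D.dst j)) :: E) (j :: L)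

/-- Appends runs. -/
def addRuns (A ems : List (ℕ × ℕ)) : List (ℕ × ℕ) := ems.foldl (fun A e => rlConcat A [e]) A

def walkBody : Program :=
  seqs [.arith 27 .add (.const 0) (.const 0),
    .ite (.lt (.reg 8) (.reg 9))
      (seqs [.report (.reg 8), .arith 12 .add (.reg 8) (.const 0), .arith 8 .add (.reg 8) (.const 1),
        edgeField 13 (.reg 12) 1, getCell 14 (.reg 12) 4, nodeField 15 (.reg 13) 6,
        .ite (.eq (.reg 14) (.reg 15))
          (seqs [setCell (.reg 6) 5 (.reg 8), setCell (.reg 6) 6 (.reg 9),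
            .arith 6 .add (.reg 6) (.const 1), nodeField 8 (.reg 13) 4, nodeField 9 (.reg 13) 5,
            .ite (.eq (.reg 9) (.const 0)) (seqs [.arith 26 .add (.reg 23) (.const 0),
              .arith 27 .add (.const 1) (.const 0)]) .skip,
            .arith 9 .add (.reg 9) (.reg 8)])
          (seqs [.arith 14 .sub (.reg 14) (.const 1), incEntry 21 (.reg 14),
            edgeSymbol 26 (.reg 21), getCell 27 (.reg 13) 7])])
      (seqs [.arith 6 .sub (.reg 6) (.const 1), getCell 8 (.reg 6) 5, getCell 9 (.reg 6) 6]),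
    emitRun]

/-- The traversal, with a stack of intervals of edges in cells 5 and 6. -/
def walkLoop : Program := .loop (.lt (.const 0) (.reg 6)) walkBody

/-- The state of the traversal. -/
structure Walking (D : NumIndex W S input) (j je sp : ℕ) (A : List (ℕ × ℕ)) (L : List ℕ)
    (s : State) : Prop where
  header : HasHeader D s
  leaves : ∀ u < D.N, s.mem (u * 8 + 7) = D.leaves u
  lead : ∀ u < D.N, u ≠ D.root → s.mem (u * 8 + 2) = D.lead u
  hasPos : HasPos D s
  r6 : s.reg 6 = sp
  r8 : s.reg 8 = j
  r9 : s.reg 9 = je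
  r23 : s.reg 23 = D.endSym
  output : HasOutput W A s
  log : s.log = L

/-- The part of the stack below `sp` is the same. -/
def SameStack (sp : ℕ) (s s' : State) : Prop :=
  ∀ i < sp, s'.mem (i * 8 + 5) = s.mem (i * 8 + 5) ∧ s'.mem (i * 8 + 6) = s.mem (i * 8 + 6)

variable {D : NumIndex W S input} {j je sp : ℕ} {A : List (ℕ × ℕ)} {L : List ℕ} {s : State}

theorem HasOutput.congr {s' : State} (h : HasOutput W A s) (h24 : s'.reg 24 = s.reg 24)
    (h25 : s'.reg 25 = s.reg 25) (ho : s'.out = s.out) : HasOutput W A s' := by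
  unfold HasOutput
  rw [h24, h25, ho]
  exact h

theorem Walking.pop (h : Walking D je je (sp + 1) A L s) (hsp : sp < D.N + D.E + 1) :
    wp W S input walkBody (fun s' => Walking D (s.mem (sp * 8 + 5)) (s.mem (sp * 8 + 6)) sp A L s' ∧
      SameStack sp s s') s := by
  obtain ⟨hh, gl, gs, gp, g6, g8, g9, g23, ho, gg⟩ := h
  have ⟨g0, g1, g2, g3, g4, g5⟩ := hh
  have hW := D.hW
  have g6' : s.reg 6 - 1 = sp := by omega
  rw [walkBody, wp_seqs_cons, wp_add (by simp only [val_const]; omega), wp_seqs_cons, wp_ite]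
  refine ⟨fun hc => ?_, fun _ => ?_⟩
  · simp only [holds_lt, val_reg, reg_set] at hc
    norm_num at hc
    omega
  simp (disch := (try simp [reg_set, val_reg, val_const, mem_set, mem_put, reg_put]) <;> omega) only
    [wp_seqs_cons, wp_seqs_nil, wp_getCell D, wp_sub, val_reg, val_const, reg_set, mem_set,
      reduceIte, Nat.reduceEqDiff, g6']
  refine wp_emitRun_zero (by simp [reg_set]) ⟨⟨?_, gl, gs, gp, ?_, ?_, ?_, ?_, ?_, gg⟩,
    fun i _ => ⟨rfl, rfl⟩⟩
  · constructor <;> simp [reg_set, g0, g1, g2, g3, g4, g5]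
  · simp [reg_set]
  · simp [reg_set]
  · simp [reg_set]
  · simp [reg_set, g23]
  · exact ho.congr (by simp [reg_set]) (by simp [reg_set]) rfl

/-- The preceding symbol is looked up at position `D.pos j - 1`: the edge just before `j` in the
list of the incoming edges of its target. -/
theorem Walking.secondary (h : Walking D j je sp A L s) (hj : j < je) (hje : je ≤ D.E)
    (hp : D.pos j ≠ D.incStart (D.dst j)) (ht : runTotal A + D.leaves (D.dst j) < W) :
    wp W S input walkBody (fun s' =>
      Walking D (j + 1) je sp (rlConcat A [(D.sym (D.inc (D.pos j - 1)), D.leaves (D.dst j))])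
        (L ++ [j]) s' ∧ SameStack sp s s') s := by
  obtain ⟨hh, gl, gs, gp, g6, g8, g9, g23, ho, gg⟩ := h
  have ⟨g0, g1, g2, g3, g4, g5⟩ := hh
  have hW := D.hW
  have hjE : j < D.E := by omega
  have hdst := D.dst_lt j hjE
  have hposj := D.pos_lt j hjE
  have gpj := gp j hjE
  have hinc := D.inc_lt (D.pos j - 1) (by omega)
  have hsrc := D.src_lt _ hinc
  have hsym := D.sym_lt hinc
  have hlv := gl _ hdst
  have hlpos := D.leaves_pos _ hdst
  rw [walkBody, wp_seqs_cons, wp_add (by simp only [val_const]; omega), wp_seqs_cons, wp_ite]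
  refine ⟨fun _ => ?_, fun hc => ?_⟩
  swap
  · simp only [holds_lt, val_reg, reg_set] at hc
    norm_num at hc
    omega
  simp (disch := (try simp [reg_set, val_reg, val_const, mem_set, mem_put, reg_put, reg_note, g8]) <;>
      omega) only
    [wp_seqs_cons, wp_seqs_nil, wp_getCell D, wp_sub, wp_add, wp_report, wp_dst D, wp_incStart D,
      val_reg, val_const, reg_set, mem_set, reg_note, mem_note, wp_ite, holds_eq,
      reduceIte, Nat.reduceEqDiff, g8, gpj, add_zero]
  refine ⟨fun h => absurd h hp, fun _ => ?_⟩
  simp (disch := (try simp [reg_set, val_reg, val_const, mem_set, mem_put, reg_put, reg_note]) <;>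
      omega) only
    [wp_seqs_cons, wp_seqs_nil, wp_sub, wp_incEntry D, val_reg, val_const, reg_set, mem_set,
      reg_note, mem_note, reduceIte, Nat.reduceEqDiff]
  rw [wp_edgeSymbol D (by simp [reg_set, hinc]) (by simp [reg_set, reg_note, g2])
    (by simp [reg_set, reg_note, g4]) (by decide) (by decide)
    (by simpa [reg_set, mem_set, mem_note] using gs _ hsrc)]
  simp (disch := (try simp [reg_set, val_reg, val_const, mem_set, mem_put, reg_put, reg_note]) <;>
      omega) only
    [wp_seqs_cons, wp_seqs_nil, wp_getCell D, val_reg, val_const, reg_set, mem_set,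
      reg_note, mem_note, reduceIte, Nat.reduceEqDiff, hlv]
  refine wp_emitRun (A := A) (ho.congr ?_ ?_ rfl) ?_ ?_ ?_ ?_
  · simp [reg_set, reg_note]
  · simp [reg_set, reg_note]
  · simpa [reg_set, reg_note] using hsym
  · simpa [reg_set, reg_note] using hlpos
  · simpa [reg_set, reg_note] using ht
  · intro s' ho' hm hl hr
    simp only [reg_set, reduceIte, Nat.reduceEqDiff, mem_set, mem_note, log_set, log_note] at ho' hm hl
    refine ⟨⟨?_, ?_, ?_, ?_, ?_, ?_, ?_, ?_, ho', ?_⟩, fun i _ => by rw [hm]; exact ⟨rfl, rfl⟩⟩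
    · constructor <;> rw [hr _ (by decide) (by decide)] <;>
        simp [reg_set, reg_note, g0, g1, g2, g3, g4, g5]
    · rw [hm]; exact gl
    · rw [hm]; exact gs
    · unfold HasPos; rw [hm]; exact gp
    · rw [hr _ (by decide) (by decide)]; simp [reg_set, reg_note, g6]
    · rw [hr _ (by decide) (by decide)]; simp [reg_set, reg_note]
    · rw [hr _ (by decide) (by decide)]; simp [reg_set, reg_note, g9]
    · rw [hr _ (by decide) (by decide)]; simp [reg_set, reg_note, g23]
    · rw [hl, gg]

/-- A recursive call saves the rest of the current interval on the stack and continues with the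
interval of the target. At the sink this interval is empty, and the run of the end-marker is emitted
at once. -/
theorem Walking.primary (h : Walking D j je sp A L s) (hj : j < je) (hje : je ≤ D.E)
    (hsp : sp < D.N + D.E + 1)
    (hp : D.pos j = D.incStart (D.dst j)) (ht : D.outCount (D.dst j) = 0 → runTotal A + 1 < W) (hend : D.endSym < W) :
    wp W S input walkBody (fun s' =>
      Walking D (D.outStart (D.dst j)) (D.outStart (D.dst j) + D.outCount (D.dst j)) (sp + 1)
        (addRuns A (if D.outCount (D.dst j) = 0 then [(D.endSym, 1)] else [])) (L ++ [j]) s' ∧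
      SameStack sp s s' ∧ s'.mem (sp * 8 + 5) = j + 1 ∧ s'.mem (sp * 8 + 6) = je) s := by
  obtain ⟨hh, gl, gs, gp, g6, g8, g9, g23, ho, gg⟩ := h
  have ⟨g0, g1, g2, g3, g4, g5⟩ := hh
  have hW := D.hW
  have hjE : j < D.E := by omega
  have hdst := D.dst_lt j hjE
  have hposj := D.pos_lt j hjE
  have gpj := gp j hjE
  have hout := D.out_le _ hdst
  rw [walkBody, wp_seqs_cons, wp_add (by simp only [val_const]; omega), wp_seqs_cons, wp_ite]
  refine ⟨fun _ => ?_, fun hc => ?_⟩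
  swap
  · simp only [holds_lt, val_reg, reg_set] at hc
    norm_num at hc
    omega
  simp (disch := (try simp [reg_set, val_reg, val_const, mem_set, mem_put, reg_put, reg_note, g8]) <;>
      omega) only
    [wp_seqs_cons, wp_seqs_nil, wp_getCell D, wp_add, wp_report, wp_dst D, wp_incStart D,
      val_reg, val_const, reg_set, mem_set, reg_note, mem_note, wp_ite, holds_eq,
      reduceIte, Nat.reduceEqDiff, g8, gpj, add_zero]
  refine ⟨fun _ => ?_, fun h => absurd hp h⟩
  simp (disch := (try simp [reg_set, val_reg, val_const, mem_set, mem_put, reg_put, reg_note]) <;>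
      omega) only
    [wp_seqs_cons, wp_seqs_nil, wp_setCell D, wp_outStart D, wp_outCount D, wp_add, val_reg,
      val_const, reg_set, mem_set, wp_ite, wp_skip, holds_eq, reg_put, mem_put,
      reg_note, mem_note, reduceIte, Nat.reduceEqDiff, g6, g9, g23, set_set, add_zero]
  have hstack : ∀ t : State, t.mem = (Function.update (Function.update s.mem (sp * 8 + 5) (j + 1))
      (sp * 8 + 6) je) → SameStack sp s t ∧ t.mem (sp * 8 + 5) = j + 1 ∧ t.mem (sp * 8 + 6) = je ∧
      (∀ u c, c < 8 → c ≠ 5 → c ≠ 6 → t.mem (u * 8 + c) = s.mem (u * 8 + c)) := by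
    intro t ht
    rw [ht]
    refine ⟨fun i hi => ?_, ?_, ?_, fun u c h1 h2 h3 => ?_⟩
    · rw [ht]
      simp only [Function.update_apply]
      rw [if_neg (by omega), if_neg (by omega), if_neg (by omega), if_neg (by omega)]
      exact ⟨rfl, rfl⟩
    · simp [Function.update_apply]
    · simp [Function.update_apply]
    · simp only [Function.update_apply]
      rw [if_neg (by omega), if_neg (by omega)]
  constructor
  · intro h0
    refine wp_emitRun (A := A) (ho.congr ?_ ?_ rfl) ?_ ?_ ?_ ?_
    · simp [reg_set, reg_put, reg_note]
    · simp [reg_set, reg_put, reg_note]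
    · simpa [reg_set, reg_put, reg_note] using hend
    · simp [reg_set, reg_put, reg_note]
    · simpa [reg_set, reg_put, reg_note] using ht h0
    · intro s' ho' hm hl hr
      simp only [reg_set, reg_put, reg_note, reduceIte, Nat.reduceEqDiff, log_set, log_put,
        log_note] at ho' hl
      obtain ⟨k1, k2, k3, k4⟩ := hstack s' hm
      refine ⟨⟨?_, ?_, ?_, ?_, ?_, ?_, ?_, ?_, ?_, ?_⟩, k1, k2, k3⟩
      · constructor <;> rw [hr _ (by decide) (by decide)] <;>
          simp [reg_set, reg_put, reg_note, g0, g1, g2, g3, g4, g5]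
      · intro u hu; rw [k4 u 7 (by decide) (by decide) (by decide), gl u hu]
      · intro u hu hne; rw [k4 u 2 (by decide) (by decide) (by decide), gs u hu hne]
      · intro u hu; rw [k4 u 4 (by decide) (by decide) (by decide), gp u hu]
      · rw [hr _ (by decide) (by decide)]; simp [reg_set, reg_put, reg_note]
      · rw [hr _ (by decide) (by decide)]; simp [reg_set, reg_put, reg_note]
      · rw [hr _ (by decide) (by decide)]; simp [reg_set, reg_put, reg_note, h0]
      · rw [hr _ (by decide) (by decide)]; simp [reg_set, reg_put, reg_note, g23]
      · simpa [h0, addRuns] using ho'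
      · rw [hl, gg]
  · intro h0
    refine wp_emitRun_zero (by simp [reg_set, reg_put, reg_note]) ?_
    generalize hst : State.set _ 9 _ = t
    obtain ⟨k1, k2, k3, k4⟩ := hstack t (by rw [← hst]; rfl)
    subst hst
    refine ⟨⟨?_, ?_, ?_, ?_, ?_, ?_, ?_, ?_, ?_, ?_⟩, k1, k2, k3⟩
    · constructor <;> simp [reg_set, reg_put, reg_note, g0, g1, g2, g3, g4, g5]
    · intro u hu; exact (k4 u 7 (by decide) (by decide) (by decide)).trans (gl u hu)
    · intro u hu hne; exact (k4 u 2 (by decide) (by decide) (by decide)).trans (gs u hu hne)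
    · intro u hu; exact (k4 u 4 (by decide) (by decide) (by decide)).trans (gp u hu)
    · simp [reg_set, reg_put, reg_note]
    · simp [reg_set, reg_put, reg_note]
    · simp [reg_set, reg_put, reg_note, add_comm]
    · simp [reg_set, reg_put, reg_note, g23]
    · rw [if_neg h0]
      exact ho.congr (by simp [reg_set, reg_put, reg_note]) (by simp [reg_set, reg_put, reg_note]) rfl
    · simp [log_set, log_put, log_note, gg]

theorem addRuns_append (A E₁ E₂ : List (ℕ × ℕ)) :
    addRuns A (E₁ ++ E₂) = addRuns (addRuns A E₁) E₂ := by simp [addRuns]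

theorem runTotal_append (E₁ E₂ : List (ℕ × ℕ)) :
    runTotal (E₁ ++ E₂) = runTotal E₁ + runTotal E₂ := by simp [runTotal]

theorem runTotal_addRuns (A ems : List (ℕ × ℕ)) :
    runTotal (addRuns A ems) = runTotal A + runTotal ems := by
  induction ems generalizing A with
  | nil => simp [addRuns, runTotal]
  | cons e ems ih =>
    have := ih (rlConcat A [e])
    rw [runTotal_rlConcat] at this
    change runTotal (addRuns (rlConcat A [e]) ems) = _
    rw [this]
    simp [runTotal, Nat.add_assoc]

theorem SameStack.trans {s₁ s₂ s₃ : State} (h : SameStack sp s₁ s₂) (h' : SameStack sp s₂ s₃) :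
    SameStack sp s₁ s₃ := fun i hi => ⟨(h' i hi).1.trans (h i hi).1, (h' i hi).2.trans (h i hi).2⟩

/-- Induction on the walk with a continuation `hQ`, which stands for the execution after the
interval is exhausted. Each edge costs at most two iterations, one to handle it and, if it is
primary, one to pop the interval saved for it. The stack never holds more intervals than edges
handled, apart from those present at the start. -/
theorem Walk.runs {ems : List (ℕ × ℕ)} {L : List ℕ} (hw : Walk D j je ems L)
    (hend : D.endSym < W) {Q : State → Prop} {k sp : ℕ} {A : List (ℕ × ℕ)} {L₀ : List ℕ} {s : State}
    (hs : Walking D j je sp A L₀ s) (hje : je ≤ D.E) (hsp0 : 0 < sp)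
    (hsp : sp + L.length ≤ D.N + D.E + 1)
    (ht : runTotal A + runTotal ems < W)
    (hQ : ∀ s', Walking D je je sp (addRuns A ems) (L₀ ++ L) s' → SameStack sp s s' →
      Runs W S input walkLoop s' k Q) :
    Runs W S input walkLoop s (k + 2 * L.length * (cost walkBody + 1)) Q := by
  induction hw generalizing Q k sp A L₀ s with
  | done j =>
    simpa using hQ s (by simpa [addRuns] using hs) fun i _ => ⟨rfl, rfl⟩
  | @secondary j je E L hj hp hrest ih =>
    have ht' : runTotal A + (D.leaves (D.dst j) + runTotal E) < W := by simpa [runTotal] using ht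
    have h1 := hs.secondary hj hje hp (by omega)
    have h2 := (runs_of_wp h1).mono (Q' := fun s' => Runs W S input walkLoop s'
      (k + 2 * L.length * (cost walkBody + 1)) Q) le_rfl fun s' ⟨hs', hst⟩ =>
        ih hs' hje hsp0 (by simp at hsp; omega) (by rw [runTotal_rlConcat]; simp [runTotal] at *; omega)
          fun s'' hs'' hst' => hQ s'' (by simpa [addRuns] using hs'') (hst.trans hst')
    refine (Runs.loop_step ?_ h2).mono ?_ fun _ => id
    · rw [holds_lt, val_const, val_reg, hs.r6]; exact hsp0
    · simp only [List.length_cons]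
      ring_nf
      omega
  | @primary j je E₁ E₂ L₁ L₂ hj hp hsub hrest ih1 ih2 =>
    rw [runTotal_append, runTotal_append] at ht
    simp only [List.cons_append, List.length_cons, List.length_append] at hsp
    have hdst := D.dst_lt j (by omega)
    have hlt : D.outCount (D.dst j) = 0 → runTotal A + 1 < W := by
      intro h0
      simp [h0, runTotal] at ht
      unfold runTotal
      omega
    have h1 := hs.primary hj hje (by omega) hp hlt hend
    have h2 := (runs_of_wp h1).mono (Q' := fun s' => Runs W S input walkLoop s'
      (k + 2 * L₂.length * (cost walkBody + 1) + (cost walkBody + 1) +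
        2 * L₁.length * (cost walkBody + 1)) Q) le_rfl fun s' ⟨hs', hst, hm5, hm6⟩ => by
      refine ih1 hs' (D.out_le _ hdst) (by omega) (by omega) ?_ fun s'' hs'' hst' => ?_
      · rw [runTotal_addRuns]; omega
      have h3 := hs''.pop (by omega)
      -- The call has worked above level `sp` only, so the interval saved there is still the rest of
      -- the caller's interval.
      rw [(hst' sp (by omega)).1, (hst' sp (by omega)).2, hm5, hm6] at h3
      have h4 := (runs_of_wp h3).mono (Q' := fun s' => Runs W S input walkLoop s'
        (k + 2 * L₂.length * (cost walkBody + 1)) Q) le_rfl fun s₃ ⟨hs₃, hst₃⟩ => by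
          refine ih2 hs₃ hje hsp0 (by omega) ?_ fun s₄ hs₄ hst₄ => hQ s₄ ?_ ?_
          · rw [runTotal_addRuns, runTotal_addRuns]; omega
          · rw [addRuns_append, addRuns_append]
            simpa using hs₄
          · exact hst.trans (SameStack.trans (fun i hi => hst' i (by omega)) (hst₃.trans hst₄))
      exact Runs.loop_step (by rw [holds_lt, val_const, val_reg, hs''.r6]; omega) h4
    refine (Runs.loop_step ?_ h2).mono ?_ fun _ => id
    · rw [holds_lt, val_const, val_reg, hs.r6]; exact hsp0
    · simp only [List.cons_append, List.length_cons, List.length_append]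
      ring_nf
      omega

/-! ### The whole program -/

def walkInit : Program :=
  seqs [nodeField 23 (.reg 2) 4, edgeField 23 (.reg 23) 3, nodeField 8 (.reg 2) 4,
    nodeField 9 (.reg 2) 5, .arith 9 .add (.reg 9) (.reg 8), .arith 6 .add (.const 1) (.const 0)]

def flush : Program := seqs [.write (.reg 24), .write (.reg 25)]

/-- Computes the run-length BWT from the self-index. -/
def recRBWTProgram : Program :=
  .seq header (.seq posLoop (.seq peelInit (.seq peelLoop (.seq leadLoop
    (.seq walkInit (.seq walkLoop flush))))))

/-- A bound for the number of steps per node and edge. -/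
def stepBound : ℕ :=
  cost header + (cost posBody + 1) + cost peelInit + (cost peelBody + 1) + (cost leadBody + 1) +
    cost walkInit + 3 * (cost walkBody + 1) + cost flush + 4

theorem NumIndex.outStart_root_lt (D : NumIndex W S input) : D.outStart D.root < D.E := by
  have h1 := D.out_le _ D.root_lt
  have h2 : D.outCount D.root ≠ 0 := fun h =>
    D.root_ne_sink ((D.outCount_eq_zero _ D.root_lt).1 h)
  omega

theorem wp_walkInit {s₀ : State} (hs : Prepared D s₀ s) (h24 : s.reg 24 = 0) (h25 : s.reg 25 = 0)
    (ho : s.out = []) (hl : s.log = []) :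
    wp W S input walkInit (Walking D (D.outStart D.root)
      (D.outStart D.root + D.outCount D.root) 1 [] []) s := by
  obtain ⟨hh, gl, gs, gp, -, -, -, -, -⟩ := hs
  have ⟨g0, g1, g2, g3, g4, g5⟩ := hh
  have hW := D.hW
  have hr := D.root_lt
  have hlt := D.outStart_root_lt
  have hout := D.out_le _ hr
  simp (disch := (try simp [reg_set, val_reg, val_const, g2]) <;> omega) only
    [walkInit, wp_seqs_cons, wp_seqs_nil, wp_outStart D, wp_outCount D, wp_fst D, wp_add, val_reg,
      val_const, reg_set, reduceIte, Nat.reduceEqDiff, g2, set_set]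
  refine ⟨?_, gl, gs, gp, ?_, ?_, ?_, ?_, ⟨?_, Or.inl ⟨rfl, ho, ?_⟩⟩, hl⟩
  · constructor <;> simp [reg_set, g0, g1, g2, g3, g4, g5]
  · simp [reg_set]
  · simp [reg_set]
  · simp [reg_set, add_comm]
  · simp [reg_set, NumIndex.endSym]
  · simp [reg_set, h24]; omega
  · simp [reg_set, h25]

theorem wp_flush {A : List (ℕ × ℕ)} (hA : HasOutput W A s) (hne : A ≠ []) (ht : runTotal A < W) :
    wp W S input flush (fun s' => s'.out = runWords A ∧ s'.log = s.log) s := by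
  obtain ⟨h24, ⟨rfl, -⟩ | ⟨A', rfl, h1, h2⟩⟩ := hA
  · exact absurd rfl hne
  have h25 : s.reg 25 < W := by simp [runTotal] at ht; omega
  simp (disch := (try simp [reg_emit, val_reg]) <;> omega) only
    [flush, wp_seqs_cons, wp_seqs_nil, wp_write, val_reg, reg_emit]
  simp [out_emit, log_emit, h2, runWords]

theorem runs_recRBWTProgram (D : NumIndex W S input) {ems : List (ℕ × ℕ)} {L : List ℕ}
    (hw : Walk D (D.outStart D.root) (D.outStart D.root + D.outCount D.root) ems L)
    (hL : L.length ≤ D.E) (ht : runTotal ems < W) (hne : addRuns [] ems ≠ []) :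
    Runs W S input recRBWTProgram initial (stepBound * (D.N + D.E + 1)) fun s =>
      s.out = runWords (addRuns [] ems) ∧ s.log = L := by
  have hend : D.endSym < W := D.fst_lt _ D.outStart_root_lt
  have hr := D.out_le _ D.root_lt
  have hS := D.hS
  -- The stack pointer starts at 1, above a dummy entry. After the last edge of the root one more
  -- iteration pops the dummy, the pointer becomes 0 and the loop ends, with the last run still
  -- pending.
  have hflush : ∀ s, Walking D (D.outStart D.root + D.outCount D.root)
      (D.outStart D.root + D.outCount D.root) 1 (addRuns [] ems) L s →
      Runs W S input walkLoop s (1 + (cost walkBody + 1)) fun s' =>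
        Runs W S input flush s' (cost flush) fun s =>
          s.out = runWords (addRuns [] ems) ∧ s.log = L := by
    intro s hs
    refine Runs.loop_step (by rw [holds_lt, val_const, val_reg, hs.r6]; omega)
      ((runs_of_wp (hs.pop (by omega))).mono le_rfl fun s' ⟨hs', _⟩ => ?_)
    refine Runs.loop_end (by rw [holds_lt, val_const, val_reg, hs'.r6]; omega) ?_
    have := wp_flush (S := S) (input := input) hs'.output hne
      (by rw [runTotal_addRuns]; simpa [runTotal] using ht)
    rw [hs'.log] at this
    exact runs_of_wp this
  have key := Runs.seq ((runs_of_wp (wp_header D)).mono le_rfl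
    fun s₁ ⟨hh, h6, h24, h25, hm, ho, hl⟩ => Runs.seq ((runs_posLoop D hh h6).mono le_rfl
    fun s₂ ⟨hh2, hp2, i24, i25, io, il, im⟩ => Runs.seq ((runs_of_wp (wp_peelInit D hh2 hp2
      (fun i c hc hc4 => by rw [im i c hc hc4, hm]))).mono le_rfl
    fun s₃ hs₃ => Runs.seq ((runs_peelLoop D hs₃).mono le_rfl
    fun s₄ ⟨Q, hs₄⟩ => Runs.seq ((runs_leadLoop D hs₄).mono le_rfl
    fun s₅ hs₅ => Runs.seq ((runs_of_wp (wp_walkInit hs₅ (hs₅.r24.trans (i24.trans h24))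
      (hs₅.r25.trans (i25.trans h25)) (hs₅.out.trans (io.trans ho))
      (hs₅.log.trans (il.trans hl)))).mono le_rfl
    fun s₆ hs₆ => Runs.seq (hw.runs hend hs₆ hr (by omega) (by omega)
      (by simpa [runTotal] using ht) fun s₇ hs₇ _ => hflush s₇ (by simpa using hs₇))))))))
  refine key.mono ?_ fun _ => id
  have e1 : D.E * (cost posBody + 1) ≤ (cost posBody + 1) * (D.N + D.E + 1) := by
    rw [mul_comm]; exact Nat.mul_le_mul_left _ (by omega)
  have e2 : (D.N + D.E) * (cost peelBody + 1) ≤ (cost peelBody + 1) * (D.N + D.E + 1) := by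
    rw [mul_comm]; exact Nat.mul_le_mul_left _ (by omega)
  have e3 : D.N * (cost leadBody + 1) ≤ (cost leadBody + 1) * (D.N + D.E + 1) := by
    rw [mul_comm]; exact Nat.mul_le_mul_left _ (by omega)
  have e4 : 2 * L.length * (cost walkBody + 1) ≤ 2 * (cost walkBody + 1) * (D.N + D.E + 1) := by
    rw [mul_assoc, mul_assoc, mul_comm L.length]; gcongr; omega
  have e5 : ∀ a, a ≤ a * (D.N + D.E + 1) := fun a => Nat.le_mul_of_pos_right a (by omega)
  have f1 := e5 (cost header)
  have f2 := e5 (cost peelInit)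
  have f3 := e5 (cost walkInit)
  have f4 := e5 (cost walkBody + 1)
  have f5 := e5 (cost flush)
  have f6 := e5 4
  have : stepBound * (D.N + D.E + 1) = cost header * (D.N + D.E + 1) +
      (cost posBody + 1) * (D.N + D.E + 1) + cost peelInit * (D.N + D.E + 1) +
      (cost peelBody + 1) * (D.N + D.E + 1) + (cost leadBody + 1) * (D.N + D.E + 1) +
      cost walkInit * (D.N + D.E + 1) + 2 * (cost walkBody + 1) * (D.N + D.E + 1) +
      (cost walkBody + 1) * (D.N + D.E + 1) + cost flush * (D.N + D.E + 1) +
      4 * (D.N + D.E + 1) := by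
    unfold stepBound; ring
  omega

end WordRAM

/-! ### Tables of records -/

section
variable {α β : Type*}

theorem flatMap_split (l : List α) (f : α → List β) {i : ℕ} (hi : i < l.length) :
    l.flatMap f = (l.take i).flatMap f ++ (f l[i] ++ (l.drop (i + 1)).flatMap f) := by
  have h := List.take_append_drop i l
  rw [List.drop_eq_getElem_cons hi] at h
  rw [← List.flatMap_cons, ← List.flatMap_append, h]

theorem getElem?_flatMap (l : List α) (f : α → List β) {i m : ℕ} (hi : i < l.length)
    (hm : m < (f l[i]).length) :
    (l.flatMap f)[((l.take i).flatMap f).length + m]? = some (f l[i])[m] := by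
  rw [flatMap_split l f hi, List.getElem?_append_right (by omega), Nat.add_sub_cancel_left,
    List.getElem?_append_left hm, List.getElem?_eq_getElem hm]

theorem length_flatMap_le (l : List α) (f : α → List β) {i : ℕ} (hi : i < l.length) :
    ((l.take i).flatMap f).length + (f l[i]).length ≤ (l.flatMap f).length := by
  rw [flatMap_split l f hi]
  simp only [List.length_append]
  omega

theorem length_flatMap_const (l : List α) (f : α → List β) {m : ℕ}
    (h : ∀ x ∈ l, (f x).length = m) : (l.flatMap f).length = l.length * m := by
  induction l with
  | nil => simp
  | cons x l ih =>
    rw [List.flatMap_cons, List.length_append, h x (by simp), ih fun y hy => h y (by simp [hy]),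
      List.length_cons, Nat.succ_mul, add_comm]

theorem getElem?_flatMap_const (l : List α) (f : α → List β) {m i c : ℕ}
    (h : ∀ x, (f x).length = m) (hi : i < l.length) (hc : c < m) :
    (l.flatMap f)[i * m + c]? = (f l[i])[c]? := by
  have := getElem?_flatMap l f hi (m := c) (by rw [h]; exact hc)
  rw [length_flatMap_const (l.take i) f fun x _ => h x, List.length_take,
    min_eq_left hi.le] at this
  rw [this, List.getElem?_eq_getElem]

-- In a table without repetitions the block of an entry can be read off from its index. For the edge
-- tables, this expresses sources and targets as intervals of positions.
open scoped Classical in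
theorem mem_iff_idxOf {l : List α} {f : α → List β} (hn : (l.flatMap f).Nodup) {i : ℕ}
    (hi : i < l.length) {e : β} (he : e ∈ l.flatMap f) :
    e ∈ f l[i] ↔ ((l.take i).flatMap f).length ≤ (l.flatMap f).idxOf e ∧
      (l.flatMap f).idxOf e < ((l.take i).flatMap f).length + (f l[i]).length := by
  have hlt := List.idxOf_lt_length_iff.2 he
  constructor
  · intro h
    obtain ⟨m, hm, rfl⟩ := List.getElem_of_mem h
    have h1 := getElem?_flatMap l f hi hm
    obtain ⟨h2, h3⟩ := List.getElem?_eq_some_iff.1 h1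
    rw [← h3, hn.idxOf_getElem]
    omega
  · rintro ⟨h1, h2⟩
    have h3 := getElem?_flatMap l f hi (m := (l.flatMap f).idxOf e - ((l.take i).flatMap f).length)
      (by omega)
    rw [Nat.add_sub_cancel' h1, List.getElem?_eq_getElem hlt, List.getElem_idxOf,
      Option.some_inj] at h3
    rw [h3]
    exact List.getElem_mem _

end

-- Numbers of nodes and edges, and the layout of the self-index

namespace OrderedCDAWG

variable {T : List ℕ} (G : OrderedCDAWG T)

/-- The list of all edges, grouped by their targets. -/
def incs : List CEdge := G.nodes.flatMap G.inc

theorem mem_edges (f : CEdge) : f ∈ G.edges ↔ f ∈ cdawgEdges T := by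
  simp only [edges, List.mem_flatMap, G.mem_nodes]
  constructor
  · rintro ⟨v, hv, hf⟩; exact (((G.isOutList v hv).2 f).1 hf).1
  · intro hf
    exact ⟨f.src, src_mem_cdawgNodes hf, ((G.isOutList _ (src_mem_cdawgNodes hf)).2 f).2 ⟨hf, rfl⟩⟩

theorem mem_incs (f : CEdge) : f ∈ G.incs ↔ f ∈ cdawgEdges T := by
  simp only [incs, List.mem_flatMap, G.mem_nodes]
  constructor
  · rintro ⟨v, hv, hf⟩; exact (((G.isInList v hv).2.2 f).1 hf).1
  · intro hf
    exact ⟨f.dst, dst_mem_cdawgNodes hf, ((G.isInList _ (dst_mem_cdawgNodes hf)).2.2 f).2 ⟨hf, rfl⟩⟩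

theorem nodup_edges : G.edges.Nodup := by
  rw [edges, List.nodup_flatMap]
  refine ⟨fun v hv => ((G.isOutList v ((G.mem_nodes v).1 hv)).1.imp fun h => ?_),
    G.nodes_nodup.imp_of_mem fun {v w} hv hw hvw f hf hf' => hvw ?_⟩
  · rintro rfl; exact lt_irrefl _ h
  · rw [← (((G.isOutList v ((G.mem_nodes v).1 hv)).2 f).1 hf).2,
      ← (((G.isOutList w ((G.mem_nodes w).1 hw)).2 f).1 hf').2]

theorem nodup_incs : G.incs.Nodup := by
  rw [incs, List.nodup_flatMap]
  refine ⟨fun v hv => (G.isInList v ((G.mem_nodes v).1 hv)).1,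
    G.nodes_nodup.imp_of_mem fun {v w} hv hw hvw f hf hf' => hvw ?_⟩
  rw [← (((G.isInList v ((G.mem_nodes v).1 hv)).2.2 f).1 hf).2,
    ← (((G.isInList w ((G.mem_nodes w).1 hw)).2.2 f).1 hf').2]

theorem length_edges {tr : List CEdge} (h : tr.Nodup) (hm : ∀ f, f ∈ tr ↔ f ∈ cdawgEdges T) :
    G.edges.length = tr.length :=
  ((List.perm_ext_iff_of_nodup G.nodup_edges h).2 fun f =>
    (G.mem_edges f).trans (hm f).symm).length_eq

theorem length_incs : G.incs.length = G.edges.length :=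
  ((List.perm_ext_iff_of_nodup G.nodup_incs G.nodup_edges).2 fun f =>
    (G.mem_incs f).trans (G.mem_edges f).symm).length_eq

/-- Every node except the root is the target of some edge. -/
theorem length_nodes_le : G.nodes.length ≤ G.edges.length + 1 := by
  have h1 : G.nodes ⊆ cdawgRoot T :: G.edges.map CEdge.dst := by
    intro v hv
    rw [G.mem_nodes] at hv
    by_cases hr : v = cdawgRoot T
    · simp [hr]
    · obtain ⟨g, hg, rfl⟩ := exists_edge_to hv hr
      exact List.mem_cons_of_mem _ (List.mem_map_of_mem ((G.mem_edges g).2 hg))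
  simpa using (G.nodes_nodup.subperm h1).length_le

theorem length_nodeRecord (v : Node) : (G.nodeRecord v).length = 5 := rfl

theorem length_edgeRecord (f : CEdge) : (G.edgeRecord f).length = 4 := rfl

theorem length_selfIndex :
    G.selfIndex.length = 4 + G.nodes.length * 5 + G.edges.length * 4 + G.edges.length := by
  rw [selfIndex]
  simp only [List.length_append, List.length_map]
  rw [length_flatMap_const _ _ fun v _ => G.length_nodeRecord v,
    length_flatMap_const _ _ fun f _ => G.length_edgeRecord f]
  change _ + G.incs.length = _
  rw [G.length_incs]
  rfl

theorem nodeId_lt {v : Node} (hv : v ∈ cdawgNodes T) : G.nodeId v < G.nodes.length := by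
  classical
  exact List.idxOf_lt_length_iff.2 ((G.mem_nodes v).2 hv)

theorem edgeId_lt {f : CEdge} (hf : f ∈ cdawgEdges T) : G.edgeId f < G.edges.length := by
  classical
  exact List.idxOf_lt_length_iff.2 ((G.mem_edges f).2 hf)

/-- The node with a given number. -/
def nodeAt (i : ℕ) : Node := G.nodes.getD i ∅

/-- The edge with a given number. -/
def edgeAt (i : ℕ) : CEdge := G.edges.getD i ⟨∅, [], ∅⟩

/-- The edge at a given position of the table of incoming edges. -/
def incAt (i : ℕ) : CEdge := G.incs.getD i ⟨∅, [], ∅⟩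

theorem nodeAt_eq {i : ℕ} (hi : i < G.nodes.length) : G.nodeAt i = G.nodes[i] := by
  simp [nodeAt, hi]

theorem edgeAt_eq {i : ℕ} (hi : i < G.edges.length) : G.edgeAt i = G.edges[i] := by
  simp [edgeAt, hi]

theorem incAt_eq {i : ℕ} (hi : i < G.incs.length) : G.incAt i = G.incs[i] := by
  simp [incAt, hi]

theorem nodeAt_mem {i : ℕ} (hi : i < G.nodes.length) : G.nodeAt i ∈ cdawgNodes T := by
  rw [G.nodeAt_eq hi, ← G.mem_nodes]; exact List.getElem_mem _

theorem edgeAt_mem {i : ℕ} (hi : i < G.edges.length) : G.edgeAt i ∈ cdawgEdges T := by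
  rw [G.edgeAt_eq hi, ← G.mem_edges]; exact List.getElem_mem _

theorem incAt_mem {i : ℕ} (hi : i < G.edges.length) : G.incAt i ∈ cdawgEdges T := by
  rw [G.incAt_eq (by rwa [G.length_incs]), ← G.mem_incs]; exact List.getElem_mem _

theorem nodeAt_nodeId {v : Node} (hv : v ∈ cdawgNodes T) : G.nodeAt (G.nodeId v) = v := by
  rw [G.nodeAt_eq (G.nodeId_lt hv)]
  classical exact List.getElem_idxOf _

theorem edgeAt_edgeId {f : CEdge} (hf : f ∈ cdawgEdges T) : G.edgeAt (G.edgeId f) = f := by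
  rw [G.edgeAt_eq (G.edgeId_lt hf)]
  classical exact List.getElem_idxOf _

theorem nodeId_nodeAt {i : ℕ} (hi : i < G.nodes.length) : G.nodeId (G.nodeAt i) = i := by
  rw [G.nodeAt_eq hi]
  classical exact G.nodes_nodup.idxOf_getElem i hi

theorem edgeId_edgeAt {i : ℕ} (hi : i < G.edges.length) : G.edgeId (G.edgeAt i) = i := by
  rw [G.edgeAt_eq hi]
  classical exact G.nodup_edges.idxOf_getElem i hi

open scoped Classical in
/-- The position of an edge in the table of incoming edges. -/
noncomputable def incPos (f : CEdge) : ℕ := G.incs.idxOf f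

theorem incPos_lt {f : CEdge} (hf : f ∈ cdawgEdges T) : G.incPos f < G.edges.length := by
  classical
  rw [← G.length_incs]
  exact List.idxOf_lt_length_iff.2 ((G.mem_incs f).2 hf)

theorem incAt_incPos {f : CEdge} (hf : f ∈ cdawgEdges T) : G.incAt (G.incPos f) = f := by
  rw [G.incAt_eq (by rw [G.length_incs]; exact G.incPos_lt hf)]
  classical exact List.getElem_idxOf _

theorem incPos_incAt {i : ℕ} (hi : i < G.edges.length) : G.incPos (G.incAt i) = i := by
  rw [G.incAt_eq (by rwa [G.length_incs])]
  classical exact G.nodup_incs.idxOf_getElem i _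

/-- The start of the outgoing edges of the node number `i`. -/
def outStart (i : ℕ) : ℕ := ((G.nodes.take i).flatMap G.out).length

/-- The start of the incoming edges of the node number `i`. -/
def incStart (i : ℕ) : ℕ := ((G.nodes.take i).flatMap G.inc).length

theorem outStart_le {i : ℕ} (hi : i < G.nodes.length) :
    G.outStart i + (G.out (G.nodeAt i)).length ≤ G.edges.length := by
  rw [G.nodeAt_eq hi]; exact length_flatMap_le _ _ hi

theorem incStart_le {i : ℕ} (hi : i < G.nodes.length) :
    G.incStart i + (G.inc (G.nodeAt i)).length ≤ G.edges.length := by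
  rw [G.nodeAt_eq hi, ← G.length_incs]; exact length_flatMap_le _ _ hi

theorem edgeAt_outStart {i m : ℕ} (hi : i < G.nodes.length)
    (hm : m < (G.out (G.nodeAt i)).length) :
    G.edgeAt (G.outStart i + m) = (G.out (G.nodeAt i))[m] := by
  simp only [G.nodeAt_eq hi] at hm ⊢
  have := getElem?_flatMap G.nodes G.out hi hm
  rw [edgeAt, List.getD_eq_getElem?_getD, edges, outStart, this, Option.getD_some]

theorem incAt_incStart {i m : ℕ} (hi : i < G.nodes.length)
    (hm : m < (G.inc (G.nodeAt i)).length) :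
    G.incAt (G.incStart i + m) = (G.inc (G.nodeAt i))[m] := by
  simp only [G.nodeAt_eq hi] at hm ⊢
  have := getElem?_flatMap G.nodes G.inc hi hm
  rw [incAt, List.getD_eq_getElem?_getD, incs, incStart, this, Option.getD_some]

theorem src_eq_iff {i : ℕ} (hi : i < G.nodes.length) {f : CEdge} (hf : f ∈ cdawgEdges T) :
    G.nodeId f.src = i ↔ G.outStart i ≤ G.edgeId f ∧
      G.edgeId f < G.outStart i + (G.out (G.nodeAt i)).length := by
  have h := mem_iff_idxOf G.nodup_edges hi ((G.mem_edges f).2 hf)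
  rw [← G.nodeAt_eq hi] at h
  rw [outStart, edgeId, edges]
  rw [← h, (G.isOutList _ (G.nodeAt_mem hi)).2 f]
  constructor
  · rintro rfl; exact ⟨hf, (G.nodeAt_nodeId (src_mem_cdawgNodes hf)).symm⟩
  · rintro ⟨-, h⟩; rw [h, G.nodeId_nodeAt hi]

theorem dst_eq_iff {i : ℕ} (hi : i < G.nodes.length) {f : CEdge} (hf : f ∈ cdawgEdges T) :
    G.nodeId f.dst = i ↔ G.incStart i ≤ G.incPos f ∧
      G.incPos f < G.incStart i + (G.inc (G.nodeAt i)).length := by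
  have h := mem_iff_idxOf G.nodup_incs hi ((G.mem_incs f).2 hf)
  rw [← G.nodeAt_eq hi] at h
  rw [incStart, incPos, incs]
  rw [← h, (G.isInList _ (G.nodeAt_mem hi)).2.2 f]
  constructor
  · rintro rfl; exact ⟨hf, (G.nodeAt_nodeId (dst_mem_cdawgNodes hf)).symm⟩
  · rintro ⟨-, h⟩; rw [h, G.nodeId_nodeAt hi]

theorem nodeId_inj {v w : Node} (hv : v ∈ cdawgNodes T) (hw : w ∈ cdawgNodes T) :
    G.nodeId v = G.nodeId w ↔ v = w :=
  ⟨fun h => by rw [← G.nodeAt_nodeId hv, h, G.nodeAt_nodeId hw], fun h => h ▸ rfl⟩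

/-! ### The self-index as an input -/

theorem selfIndex_node {i c : ℕ} (hi : i < G.nodes.length) (hc : c < 5) :
    G.selfIndex[i * 5 + (4 + c)]? = (G.nodeRecord (G.nodeAt i))[c]? := by
  have hl := length_flatMap_const G.nodes G.nodeRecord fun v _ => G.length_nodeRecord v
  rw [selfIndex, List.append_assoc, List.append_assoc, List.getElem?_append_right (by simp; omega),
    List.getElem?_append_left (by rw [hl]; simp; omega)]
  have : i * 5 + (4 + c) - [G.nodes.length, G.edges.length, G.nodeId (cdawgRoot T),
    G.nodeId (cdawgSink T)].length = i * 5 + c := by simp; omega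
  rw [this, getElem?_flatMap_const _ _ G.length_nodeRecord hi hc, G.nodeAt_eq hi]

theorem selfIndex_edge {i c : ℕ} (hi : i < G.edges.length) (hc : c < 4) :
    G.selfIndex[i * 4 + (G.nodes.length * 5 + 4) + c]? = (G.edgeRecord (G.edgeAt i))[c]? := by
  have hl := length_flatMap_const G.nodes G.nodeRecord fun v _ => G.length_nodeRecord v
  have hl' := length_flatMap_const G.edges G.edgeRecord fun v _ => G.length_edgeRecord v
  rw [selfIndex, List.append_assoc, List.getElem?_append_right (by simp [hl]; omega),
    List.getElem?_append_left (by simp [hl, hl']; omega)]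
  have : i * 4 + (G.nodes.length * 5 + 4) + c - ([G.nodes.length, G.edges.length,
    G.nodeId (cdawgRoot T), G.nodeId (cdawgSink T)] ++ G.nodes.flatMap G.nodeRecord).length =
      i * 4 + c := by simp [hl]; omega
  rw [this, getElem?_flatMap_const _ _ G.length_edgeRecord hi hc, G.edgeAt_eq hi]

theorem selfIndex_inc {k : ℕ} (hk : k < G.edges.length) :
    G.selfIndex[k + (G.edges.length * 4 + (G.nodes.length * 5 + 4))]? =
      some (G.edgeId (G.incAt k)) := by
  have hl := length_flatMap_const G.nodes G.nodeRecord fun v _ => G.length_nodeRecord v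
  have hl' := length_flatMap_const G.edges G.edgeRecord fun v _ => G.length_edgeRecord v
  rw [selfIndex, List.getElem?_append_right (by simp [hl, hl']; omega)]
  have : k + (G.edges.length * 4 + (G.nodes.length * 5 + 4)) - ([G.nodes.length, G.edges.length,
    G.nodeId (cdawgRoot T), G.nodeId (cdawgSink T)] ++ G.nodes.flatMap G.nodeRecord ++
      G.edges.flatMap G.edgeRecord).length = k := by simp [hl, hl']; omega
  rw [this, List.getElem?_map]
  change Option.map G.edgeId G.incs[k]? = _
  rw [List.getElem?_eq_getElem (by rwa [G.length_incs]), G.incAt_eq (by rwa [G.length_incs])]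
  rfl

end OrderedCDAWG

/-! ### Bounds for the words -/

theorem IsText.nleaves_le {T : List ℕ} {v : Node} (hT : IsText T) (hv : v ∈ cdawgNodes T) :
    nleaves T v ≤ T.length := by
  obtain ⟨U, hU, rfl⟩ := hv
  rw [← hT.length_below hU, ← length_sortedSufs T]
  exact List.length_filter_le _ _

theorem headD_mem {l : List ℕ} (h : l ≠ []) : l.headD 0 ∈ l := by
  cases l with
  | nil => exact absurd rfl h
  | cons a l => simp

theorem firstSym_mem {T : List ℕ} {f : CEdge} (hf : f ∈ cdawgEdges T) : firstSym f ∈ T := by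
  have h0 := lab_ne_nil hf
  obtain ⟨U, X, hX, rfl⟩ := hf
  exact ((List.suffix_append U X).isInfix.trans hX.2.2.1.infix).subset (headD_mem h0)

theorem IsText.leadSym_mem {T : List ℕ} {v : Node} (hT : IsText T) (hv : v ∈ cdawgNodes T)
    (hr : v ≠ cdawgRoot T) : leadSym T v ∈ T := by
  obtain ⟨V, hV⟩ := exists_isShortest hv
  have hu := mem_upper_iff.1 hV.1
  rw [hT.leadSym_eq hV]
  refine hu.1.infix.subset (headD_mem ?_)
  rintro rfl
  exact hr hu.2.symm

/-- This is the acyclicity of the CDAWG in a quantitative form. It supplies the rank that makes the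
peeling succeed. -/
theorem reprUpLen_lt {T : List ℕ} {f : CEdge} (hf : f ∈ cdawgEdges T) :
    reprUpLen T f.src < reprUpLen T f.dst := by
  have h1 := topLen_le hf
  have h2 := List.length_pos_of_ne_nil (lab_ne_nil hf)
  unfold topLen at h1
  omega

theorem reprUpLen_le {T : List ℕ} {v : Node} (hv : v ∈ cdawgNodes T) :
    reprUpLen T v ≤ T.length := by
  obtain ⟨U, hU⟩ := exists_isReprUp hv
  rw [hU.reprUpLen_eq]
  exact hU.treeNode.infix.length_le

/-! ### Incoming edges -/

section
variable {T : List ℕ} {v : Node} {es : List CEdge}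

theorem IsInList.topLen_le (h : IsInList T v es) {i j : ℕ} (hij : i ≤ j) (hj : j < es.length) :
    topLen T es[j] ≤ topLen T es[i] := by
  rcases hij.lt_or_eq with hlt | rfl
  · exact List.pairwise_iff_getElem.1 h.2.1 i j _ hj hlt
  · exact le_rfl

theorem IsInList.getElem_mem (h : IsInList T v es) {i : ℕ} (hi : i < es.length) :
    es[i] ∈ cdawgEdges T ∧ es[i].dst = v := (h.2.2 _).1 (List.getElem_mem hi)

/-- The list is only required to be weakly sorted, but different edges into a node have different
lengths. -/
theorem IsInList.topLen_lt (hT : IsText T) (h : IsInList T v es) {i j : ℕ} (hij : i < j)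
    (hj : j < es.length) : topLen T es[j] < topLen T es[i] := by
  refine lt_of_le_of_ne (h.topLen_le hij.le hj) fun he => ?_
  obtain ⟨h1, h2⟩ := h.getElem_mem hj
  obtain ⟨h3, h4⟩ := h.getElem_mem (hij.trans hj)
  have := h.1.getElem_inj_iff.1 (hT.topLen_inj h1 h3 (h2.trans h4.symm) he)
  omega

theorem IsInList.isPrimaryUp_iff (hT : IsText T) (h : IsInList T v es) {i : ℕ}
    (hi : i < es.length) : IsPrimaryUp T es[i] ↔ i = 0 := by
  obtain ⟨h1, h2⟩ := h.getElem_mem hi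
  rw [hT.isPrimaryUp_iff_topLen h1]
  constructor
  · intro hp
    by_contra h0
    obtain ⟨h3, h4⟩ := h.getElem_mem (i := 0) (by omega)
    have := hp _ h3 (h4.trans h2.symm)
    have := h.topLen_lt hT (Nat.pos_of_ne_zero h0) hi
    omega
  · rintro rfl g hg hd
    obtain ⟨j, hj, rfl⟩ := List.getElem_of_mem ((h.2.2 g).2 ⟨hg, hd.trans h2⟩)
    exact h.topLen_le (Nat.zero_le _) hj

theorem IsInList.precSym_eq (hT : IsText T) (h : IsInList T v es) {i : ℕ}
    (hi : i + 1 < es.length) {c : ℕ} (hc : IsPrecSym T es[i + 1] c) : c = edgeSym T es[i] := by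
  obtain ⟨h1, h2⟩ := h.getElem_mem hi
  obtain ⟨h3, h4⟩ := h.getElem_mem (i := i) (by omega)
  refine hT.precSym_eq h1 h3 (h2.trans h4.symm) (h.topLen_lt hT (by omega) hi) ?_ hc
  intro g hg hd hlt
  obtain ⟨j, hj, rfl⟩ := List.getElem_of_mem ((h.2.2 g).2 ⟨hg, hd.trans h2⟩)
  refine h.topLen_le ?_ (by omega)
  by_contra! hij
  have := h.topLen_le (i := i + 1) (j := j) (by omega) hj
  omega

theorem IsInList.leadSym_eq (hT : IsText T) (h : IsInList T v es) (h0 : 0 < es.length) :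
    leadSym T v = edgeSym T es[es.length - 1] := by
  obtain ⟨h1, h2⟩ := h.getElem_mem (i := es.length - 1) (by omega)
  conv_lhs => rw [← h2]
  refine hT.leadSym_dst h1 fun g hg hd => ?_
  obtain ⟨j, hj, rfl⟩ := List.getElem_of_mem ((h.2.2 g).2 ⟨hg, hd.trans h2⟩)
  exact h.topLen_le (by omega) (by omega)

end

/-! ### The self-index as an input of the program -/

theorem WordRAM.rlConcat_addRuns (A B E : List (ℕ × ℕ)) :
    rlConcat A (addRuns B E) = addRuns (rlConcat A B) E := by
  induction E generalizing B with
  | nil => rfl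
  | cons e E ih =>
    change rlConcat A (addRuns (rlConcat B [e]) E) = addRuns (rlConcat (rlConcat A B) [e]) E
    rw [ih, rlConcat_assoc]

theorem WordRAM.rlConcat_eq_addRuns (A E : List (ℕ × ℕ)) :
    rlConcat A (addRuns [] E) = addRuns A E := by
  rw [rlConcat_addRuns, rlConcat_nil_right]

namespace OrderedCDAWG

variable {T : List ℕ} (G : OrderedCDAWG T)

theorem sum_out (F : CEdge → ℕ) {i : ℕ} (hi : i < G.nodes.length) :
    ∑ e ∈ Finset.Ico (G.outStart i) (G.outStart i + (G.out (G.nodeAt i)).length),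
      F (G.edgeAt e) = ((G.out (G.nodeAt i)).map F).sum := by
  rw [Finset.sum_Ico_eq_sum_range, Nat.add_sub_cancel_left, Finset.sum_range,
    ← Fin.sum_univ_fun_getElem]
  exact Finset.sum_congr rfl fun m _ => by rw [G.edgeAt_outStart hi m.2]

theorem nodeAt_ne_root {i : ℕ} (hi : i < G.nodes.length) (h : i ≠ G.nodeId (cdawgRoot T)) :
    G.nodeAt i ≠ cdawgRoot T := fun h' => h (by rw [← h', G.nodeId_nodeAt hi])

theorem root_mem (T : List ℕ) : cdawgRoot T ∈ cdawgNodes T :=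
  mem_cdawgNodes_of_treeNode (isTreeNode_nil T)

theorem sink_mem (hT : IsText T) : cdawgSink T ∈ cdawgNodes T :=
  mem_cdawgNodes_of_treeNode (Suf.isTreeNode hT.self_mem_suf)

theorem inc_pos_of_ne_root {v : Node} (hv : v ∈ cdawgNodes T) (hr : v ≠ cdawgRoot T) :
    0 < (G.inc v).length := by
  obtain ⟨g, hg, hd⟩ := exists_edge_to hv hr
  exact List.length_pos_of_mem (((G.isInList v hv).2.2 g).2 ⟨hg, hd⟩)

theorem incAt_last (i : ℕ) (hi : i < G.nodes.length) (h0 : 0 < (G.inc (G.nodeAt i)).length) :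
    G.incAt (G.incStart i + (G.inc (G.nodeAt i)).length - 1) =
      (G.inc (G.nodeAt i))[(G.inc (G.nodeAt i)).length - 1] := by
  rw [Nat.add_sub_assoc h0, G.incAt_incStart hi]

/-- The self-index, read as an input of the program. -/
noncomputable def numIndex (hT : IsText T) {W S σ : ℕ} (hσ : ∀ a ∈ T, a ≤ σ) (hσW : σ < W)
    (hn : T.length < W) (hW : 10 * (G.nodes.length + G.edges.length + 2) ≤ W)
    (hS : 8 * (G.nodes.length + G.edges.length + 2) ≤ S) : NumIndex W S G.selfIndex where
  N := G.nodes.length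
  E := G.edges.length
  root := G.nodeId (cdawgRoot T)
  sink := G.nodeId (cdawgSink T)
  nodeBase := G.nodes.length * 5 + 4
  edgeBase := G.edges.length * 4 + (G.nodes.length * 5 + 4)
  outStart := G.outStart
  outCount i := (G.out (G.nodeAt i)).length
  incStart := G.incStart
  incCount i := (G.inc (G.nodeAt i)).length
  src e := G.nodeId (G.edgeAt e).src
  dst e := G.nodeId (G.edgeAt e).dst
  fst e := firstSym (G.edgeAt e)
  inc k := G.edgeId (G.incAt k)
  pos e := G.incPos (G.edgeAt e)
  rank i := T.length - reprUpLen T (G.nodeAt i)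
  leaves i := nleaves T (G.nodeAt i)
  lead i := leadSym T (G.nodeAt i)
  hW := hW
  hS := hS
  leaves_lt i hi := (hT.nleaves_le (G.nodeAt_mem hi)).trans_lt hn
  leaves_pos i hi := hT.nleaves_pos (G.nodeAt_mem hi)
  fst_lt e he := (hσ _ (firstSym_mem (G.edgeAt_mem he))).trans_lt hσW
  lead_lt i hi hr := (hσ _ (hT.leadSym_mem (G.nodeAt_mem hi) (G.nodeAt_ne_root hi hr))).trans_lt hσW
  nodeBase_eq := rfl
  edgeBase_eq := rfl
  read_N := rfl
  read_E := rfl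
  read_root := rfl
  read_sink := rfl
  read_outStart i hi := by
    rw [show i * 5 + 4 = i * 5 + (4 + 0) from rfl, G.selfIndex_node hi (by omega), nodeRecord,
      G.nodeId_nodeAt hi]
    rfl
  read_outCount i hi := G.selfIndex_node hi (c := 1) (by omega)
  read_incStart i hi := by
    rw [show i * 5 + 6 = i * 5 + (4 + 2) from rfl, G.selfIndex_node hi (by omega), nodeRecord,
      G.nodeId_nodeAt hi]
    rfl
  read_incCount i hi := G.selfIndex_node hi (c := 3) (by omega)
  read_src e he := G.selfIndex_edge he (c := 0) (by omega)
  read_dst e he := G.selfIndex_edge he (c := 1) (by omega)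
  read_fst e he := G.selfIndex_edge he (c := 3) (by omega)
  read_inc k hk := G.selfIndex_inc hk
  root_lt := G.nodeId_lt (root_mem T)
  sink_lt := G.nodeId_lt (sink_mem hT)
  root_ne_sink h := hT.root_ne_sink ((G.nodeId_inj (root_mem T) (sink_mem hT)).1 h)
  src_lt e he := G.nodeId_lt (src_mem_cdawgNodes (G.edgeAt_mem he))
  dst_lt e he := G.nodeId_lt (dst_mem_cdawgNodes (G.edgeAt_mem he))
  inc_lt k hk := G.edgeId_lt (G.incAt_mem hk)
  pos_lt e he := G.incPos_lt (G.edgeAt_mem he)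
  pos_inc k hk := by rw [G.edgeAt_edgeId (G.incAt_mem hk), G.incPos_incAt hk]
  inc_pos e he := by rw [G.incAt_incPos (G.edgeAt_mem he), G.edgeId_edgeAt he]
  src_eq_iff e he v hv := by
    have := G.src_eq_iff hv (G.edgeAt_mem he)
    rwa [G.edgeId_edgeAt he] at this
  out_le v hv := G.outStart_le hv
  dst_eq_iff e he v hv := G.dst_eq_iff hv (G.edgeAt_mem he)
  inc_le v hv := G.incStart_le hv
  -- Lengths of representatives increase along edges and are at most the length of the text, so
  -- their complements decrease.
  rank_lt e he := by
    have hm := G.edgeAt_mem he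
    have h1 := reprUpLen_lt hm
    have h2 := reprUpLen_le (dst_mem_cdawgNodes hm)
    rw [G.nodeAt_nodeId (src_mem_cdawgNodes hm), G.nodeAt_nodeId (dst_mem_cdawgNodes hm)]
    omega
  outCount_eq_zero v hv := by
    rw [List.length_eq_zero_iff]
    constructor
    · intro h
      by_contra hs
      exact hT.out_ne_nil (G.nodeAt_mem hv) (fun h' => hs (by rw [← h', G.nodeId_nodeAt hv]))
        (G.isOutList _ (G.nodeAt_mem hv)) h
    · rintro rfl
      rw [G.nodeAt_nodeId (sink_mem hT)]
      exact (G.isOutList _ (sink_mem hT)).unique hT.isOutList_sink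
  leaves_sink := by rw [G.nodeAt_nodeId (sink_mem hT), hT.nleaves_sink]
  leaves_eq v hv hs := by
    rw [hT.nleaves_eq_sum (G.nodeAt_mem hv) (fun h => hs (by rw [← h, G.nodeId_nodeAt hv]))
      (G.isOutList _ (G.nodeAt_mem hv)), ← G.sum_out _ hv]
    refine Finset.sum_congr rfl fun e he => ?_
    have := G.outStart_le hv
    rw [Finset.mem_Ico] at he
    rw [G.nodeAt_nodeId (dst_mem_cdawgNodes (G.edgeAt_mem (by omega)))]
  incCount_pos v hv hr := G.inc_pos_of_ne_root (G.nodeAt_mem hv) (G.nodeAt_ne_root hv hr)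
  lead_eq v hv hr := by
    have h0 := G.inc_pos_of_ne_root (G.nodeAt_mem hv) (G.nodeAt_ne_root hv hr)
    have hI := G.isInList _ (G.nodeAt_mem hv)
    have hm := (hI.getElem_mem (Nat.sub_lt h0 one_pos)).1
    rw [hI.leadSym_eq hT h0, G.incAt_last v hv h0, G.edgeAt_edgeId hm,
      G.nodeAt_nodeId (src_mem_cdawgNodes hm), edgeSym]
    simp only [G.nodeId_inj (src_mem_cdawgNodes hm) (root_mem T)]

variable {W S σ : ℕ} (hT : IsText T) (hσ : ∀ a ∈ T, a ≤ σ)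
  (hσW : σ < W) (hn : T.length < W) (hW : 10 * (G.nodes.length + G.edges.length + 2) ≤ W)
  (hS : 8 * (G.nodes.length + G.edges.length + 2) ≤ S)

theorem numIndex_sym {g : CEdge} (hg : g ∈ cdawgEdges T) :
    (G.numIndex hT hσ hσW hn hW hS).sym (G.edgeId g) = edgeSym T g := by
  change (if G.nodeId (G.edgeAt (G.edgeId g)).src = G.nodeId (cdawgRoot T) then
    firstSym (G.edgeAt (G.edgeId g)) else
    leadSym T (G.nodeAt (G.nodeId (G.edgeAt (G.edgeId g)).src))) = _
  rw [G.edgeAt_edgeId hg, G.nodeAt_nodeId (src_mem_cdawgNodes hg), edgeSym]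
  simp only [G.nodeId_inj (src_mem_cdawgNodes hg) (root_mem T)]

/-- The end-marker is the smallest symbol and forms a suffix by itself, so it labels the first edge
out of the root. There it can be read without the text. -/
theorem numIndex_endSym {d : ℕ} (hd : T.getLast? = some d) :
    (G.numIndex hT hσ hσW hn hW hS).endSym = d := by
  change firstSym (G.edgeAt (G.outStart (G.nodeId (cdawgRoot T)))) = d
  have hr := G.nodeId_lt (root_mem T)
  have hO := G.isOutList _ (root_mem T)
  have hT' := hT
  obtain ⟨w, d', rfl, hw⟩ := hT'
  obtain rfl : d' = d := by simpa using hd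
  have hsuf : [d'] ∈ Suf (w ++ [d']) := ⟨by simp, List.suffix_append _ _⟩
  obtain ⟨X, hX, hXD⟩ := exists_first_edge (isTreeNode_nil _) (Z := [d']) (by simp)
    (Suf.isTreeNode hsuf)
  obtain rfl : X = [d'] := by
    cases X with
    | nil => exact absurd rfl hX.1
    | cons x X =>
      rw [List.cons_prefix_cons] at hXD
      rw [hXD.1, List.prefix_nil.1 hXD.2]
  have hf := (hO.2 _).2 ⟨hX.mem_cdawgEdges, rfl⟩
  obtain ⟨m, hm, he⟩ := List.getElem_of_mem hf
  have h0 : 0 < (G.out (cdawgRoot (w ++ [d']))).length := by omega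
  have h1 := G.edgeAt_outStart hr (m := 0) (by rwa [G.nodeAt_nodeId (root_mem _)])
  simp only [G.nodeAt_nodeId (root_mem _), Nat.add_zero] at h1
  rw [h1]
  have hmem := firstSym_mem ((hO.2 _).1 (List.getElem_mem h0)).1
  rcases Nat.eq_zero_or_pos m with rfl | hpos
  · rw [he]; rfl
  -- If the edge of the end-marker were not the first one, the first one would carry a symbol of the
  -- text below the end-marker.
  · have hlt := List.pairwise_iff_getElem.1 hO.1 0 m h0 hm hpos
    rw [he] at hlt
    change _ < d' at hlt
    rw [List.mem_append, List.mem_singleton] at hmem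
    rcases hmem with h | h
    · have := hw _ h; omega
    · omega

/-- A primary edge is the first one in the list of the incoming edges of its target. -/
theorem isPrimaryUp_iff_incPos (hT : IsText T) {f : CEdge} (hf : f ∈ cdawgEdges T) :
    IsPrimaryUp T f ↔ G.incPos f = G.incStart (G.nodeId f.dst) := by
  have hd := dst_mem_cdawgNodes hf
  have hI := G.isInList _ hd
  obtain ⟨i, hi, he⟩ := List.getElem_of_mem ((hI.2.2 f).2 ⟨hf, rfl⟩)
  have h1 := G.incAt_incStart (G.nodeId_lt hd) (m := i) (by rwa [G.nodeAt_nodeId hd])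
  simp only [G.nodeAt_nodeId hd, he] at h1
  have h2 := G.incStart_le (G.nodeId_lt hd)
  rw [G.nodeAt_nodeId hd] at h2
  have h3 := G.incPos_incAt (i := G.incStart (G.nodeId f.dst) + i) (by omega)
  rw [h1] at h3
  have h4 := hI.isPrimaryUp_iff hT hi
  rw [he] at h4
  rw [h4, h3]
  omega

theorem precSym_eq_incAt (hT : IsText T) {f : CEdge} {c : ℕ} (hf : f ∈ cdawgEdges T)
    (hp : ¬ IsPrimaryUp T f) (hc : IsPrecSym T f c) :
    G.incPos f - 1 < G.edges.length ∧ c = edgeSym T (G.incAt (G.incPos f - 1)) := by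
  have hd := dst_mem_cdawgNodes hf
  have hI := G.isInList _ hd
  obtain ⟨i, hi, he⟩ := List.getElem_of_mem ((hI.2.2 f).2 ⟨hf, rfl⟩)
  have h4 := hI.isPrimaryUp_iff hT hi
  rw [he] at h4
  have h0 : i ≠ 0 := fun h => hp (h4.2 h)
  obtain ⟨i, rfl⟩ := Nat.exists_eq_succ_of_ne_zero h0
  have h1 := G.incAt_incStart (G.nodeId_lt hd) (m := i + 1) (by rwa [G.nodeAt_nodeId hd])
  have h1' := G.incAt_incStart (G.nodeId_lt hd) (m := i) (by rw [G.nodeAt_nodeId hd]; omega)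
  simp only [G.nodeAt_nodeId hd] at h1 h1'
  have h2 := G.incStart_le (G.nodeId_lt hd)
  rw [G.nodeAt_nodeId hd] at h2
  have h3 := G.incPos_incAt (i := G.incStart (G.nodeId f.dst) + (i + 1)) (by omega)
  rw [h1, he] at h3
  rw [h3, show G.incStart (G.nodeId f.dst) + (i + 1) - 1 = G.incStart (G.nodeId f.dst) + i by omega,
    h1']
  refine ⟨by omega, hI.precSym_eq hT hi (by rw [he]; exact hc)⟩

/-- Simultaneous induction over calls and loops. A loop over the remaining edges of a node
corresponds to a final part of its interval in the edge table. The walk of the empty interval of the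
sink emits nothing, so its single run is added separately. -/
theorem exists_walk {v : Node} {R : List (ℕ × ℕ)} {tr : List CEdge} (h : RecRBWT T v R tr)
    (hv : v ∈ cdawgNodes T) : let D := G.numIndex hT hσ hσW hn hW hS
    ∃ ems, Walk D (G.outStart (G.nodeId v)) (G.outStart (G.nodeId v) + (G.out v).length) ems
      (tr.map G.edgeId) ∧
      R = addRuns [] ((if (G.out v).length = 0 then [(D.endSym, 1)] else []) ++ ems) := by
  intro D
  refine RecRBWT.rec
    (motive_1 := fun v R tr _ => v ∈ cdawgNodes T →
      ∃ ems, Walk D (G.outStart (G.nodeId v)) (G.outStart (G.nodeId v) + (G.out v).length) ems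
        (tr.map G.edgeId) ∧
        R = addRuns [] ((if (G.out v).length = 0 then [(D.endSym, 1)] else []) ++ ems))
    (motive_2 := fun es A R tr _ => ∀ v ∈ cdawgNodes T, ∀ m ≤ (G.out v).length,
      es = (G.out v).drop m →
      ∃ ems, Walk D (G.outStart (G.nodeId v) + m)
        (G.outStart (G.nodeId v) + (G.out v).length) ems (tr.map G.edgeId) ∧ R = addRuns A ems)
    ?_ ?_ ?_ ?_ ?_ h hv
  · intro v d hes hd hv
    rw [(G.isOutList v hv).unique hes]
    refine ⟨[], Walk.done _, ?_⟩
    rw [show D.endSym = d from G.numIndex_endSym hT hσ hσW hn hW hS hd]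
    rfl
  · intro v es R tr hes hne _ ih hv
    obtain rfl := (G.isOutList v hv).unique hes
    have := List.length_pos_of_ne_nil hne
    rw [if_neg this.ne']
    exact ih v hv 0 (by omega) rfl
  · intro A v hv m hm he
    have := List.drop_eq_nil_iff.1 he.symm
    obtain rfl : m = (G.out v).length := by omega
    exact ⟨[], Walk.done _, rfl⟩
  · intro f es A R' R tr' tr hf _ _ ih1 ih2 v hv m hm he
    have hlt : m < (G.out v).length := by
      by_contra h; rw [List.drop_eq_nil_of_le (by omega)] at he; simp at he
    rw [List.drop_eq_getElem_cons hlt, List.cons.injEq] at he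
    obtain ⟨rfl, hes⟩ := he
    set f := (G.out v)[m] with hfdef
    have hmem : f ∈ cdawgEdges T := (((G.isOutList v hv).2 _).1 (List.getElem_mem hlt)).1
    have hat : G.edgeAt (G.outStart (G.nodeId v) + m) = f := by
      have := G.edgeAt_outStart (G.nodeId_lt hv) (m := m) (by rwa [G.nodeAt_nodeId hv])
      simpa only [G.nodeAt_nodeId hv] using this
    have hd := dst_mem_cdawgNodes hmem
    obtain ⟨E₁, w1, rfl⟩ := ih1 hd
    obtain ⟨E₂, w2, rfl⟩ := ih2 v hv (m + 1) hlt hes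
    have hid : G.edgeId f = G.outStart (G.nodeId v) + m := by
      have h1 := G.outStart_le (G.nodeId_lt hv)
      rw [G.nodeAt_nodeId hv] at h1
      rw [← hat, G.edgeId_edgeAt (by omega)]
    have hdst : D.dst (G.outStart (G.nodeId v) + m) = G.nodeId f.dst := by
      change G.nodeId (G.edgeAt _).dst = _
      rw [hat]
    have hcount : D.outCount (G.nodeId f.dst) = (G.out f.dst).length := by
      change (G.out (G.nodeAt _)).length = _
      rw [G.nodeAt_nodeId hd]
    refine ⟨(if (G.out f.dst).length = 0 then [(D.endSym, 1)] else []) ++ E₁ ++ E₂, ?_, ?_⟩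
    · rw [List.map_append, List.map_cons, hid, ← hcount, ← hdst]
      refine Walk.primary (by omega) ?_ ?_ w2
      · rw [hdst]
        change G.incPos (G.edgeAt _) = G.incStart _
        rw [hat]
        exact (G.isPrimaryUp_iff_incPos hT hmem).1 hf
      · rw [hdst, hcount]
        exact w1
    · rw [rlConcat_eq_addRuns, ← addRuns_append]
  · intro f es A R tr c hf hc _ ih v hv m hm he
    have hlt : m < (G.out v).length := by
      by_contra h; rw [List.drop_eq_nil_of_le (by omega)] at he; simp at he
    rw [List.drop_eq_getElem_cons hlt, List.cons.injEq] at he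
    obtain ⟨rfl, hes⟩ := he
    set f := (G.out v)[m] with hfdef
    have hmem : f ∈ cdawgEdges T := (((G.isOutList v hv).2 _).1 (List.getElem_mem hlt)).1
    have hat : G.edgeAt (G.outStart (G.nodeId v) + m) = f := by
      have := G.edgeAt_outStart (G.nodeId_lt hv) (m := m) (by rwa [G.nodeAt_nodeId hv])
      simpa only [G.nodeAt_nodeId hv] using this
    have hd := dst_mem_cdawgNodes hmem
    obtain ⟨E₂, w2, rfl⟩ := ih v hv (m + 1) hlt hes
    have hid : G.edgeId f = G.outStart (G.nodeId v) + m := by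
      have h1 := G.outStart_le (G.nodeId_lt hv)
      rw [G.nodeAt_nodeId hv] at h1
      rw [← hat, G.edgeId_edgeAt (by omega)]
    have hpos : D.pos (G.outStart (G.nodeId v) + m) = G.incPos f := by
      change G.incPos (G.edgeAt _) = _
      rw [hat]
    have hdst : D.dst (G.outStart (G.nodeId v) + m) = G.nodeId f.dst := by
      change G.nodeId (G.edgeAt _).dst = _
      rw [hat]
    have hw := Walk.secondary (D := D) (j := G.outStart (G.nodeId v) + m)
      (by omega) (by
        rw [hpos, hdst]
        exact fun h => hf ((G.isPrimaryUp_iff_incPos hT hmem).2 h)) w2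
    obtain ⟨hk, hsym⟩ := G.precSym_eq_incAt hT hmem hf hc
    refine ⟨_, by rw [List.map_cons, hid]; exact hw, ?_⟩
    have h1 : D.sym (D.inc (D.pos (G.outStart (G.nodeId v) + m) - 1)) = c := by
      rw [hpos, hsym]
      exact G.numIndex_sym hT hσ hσW hn hW hS (G.incAt_mem hk)
    have h2 : D.leaves (D.dst (G.outStart (G.nodeId v) + m)) = nleaves T f.dst := by
      rw [hdst]
      change nleaves T (G.nodeAt _) = _
      rw [G.nodeAt_nodeId hd]
    rw [h1, h2]
    rfl

end OrderedCDAWG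

-- The main theorem

theorem mainTheorem1 :
    ∃ (P : WordRAM.Program) (C : ℕ), ∀ T : List ℕ, IsText T →
      (rlbwt T).length ≤ cdawgSize T ∧
      ∃ tr : List CEdge,
        RecRBWT T (cdawgRoot T) (rlbwt T) tr ∧
        tr.Nodup ∧ (∀ f, f ∈ tr ↔ f ∈ cdawgEdges T) ∧
        ∀ (G : OrderedCDAWG T) (σ : ℕ), (∀ a ∈ T, a ≤ σ) →
          G.selfIndex.length ≤ C * cdawgSize T ∧
          ∃ (s : WordRAM.State) (t : ℕ),
            WordRAM.Exec (C * (T.length + σ + 1)) (C * cdawgSize T) G.selfIndex P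
              WordRAM.initial s t ∧
            t ≤ C * cdawgSize T ∧
            s.out = (rlbwt T).flatMap (fun p => [p.1, p.2]) ∧
            s.log = tr.map G.edgeId := by
  -- With `E ≥ 1` edges and at most `E + 1` nodes, the 8-word records need at most `8 * (2 * E + 3)
  -- ≤ 40 * E` cells. Since `E + 1 ≤ 2 * n`, words below `40 * (n + σ + 1)` suffice. The running
  -- time is `stepBound` times the number of nodes and edges plus one, which is at most `4 * E`.
  refine ⟨recRBWTProgram, 40 + 4 * stepBound, fun T hT => ?_⟩
  obtain ⟨tr, hrec, hnd, hmem⟩ := hT.exists_trace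
  have hsize : tr.length ≤ cdawgSize T := by
    rw [cdawgSize, ncard_edges hnd hmem]
    exact Nat.le_add_right _ _
  have hne := hT.trace_ne_nil hmem
  have hpos := List.length_pos_of_ne_nil hne
  have htr := hT.trace_length_le (OrderedCDAWG.root_mem T) hrec
  rw [runTotal_rlbwt] at htr
  refine ⟨(hrec.length_le.resolve_right fun h => hne h.1).trans hsize, tr, hrec, hnd, hmem,
    fun G σ hσ => ?_⟩
  have hE := G.length_edges hnd hmem
  have hN := G.length_nodes_le
  rw [hE] at hN
  have hC : ∀ x, 40 * x ≤ (40 + 4 * stepBound) * x := fun x => by gcongr; omega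
  have h1 := hC (T.length + σ + 1)
  have h2 := hC (cdawgSize T)
  refine ⟨by rw [G.length_selfIndex, hE]; omega, ?_⟩
  have hW : 10 * (G.nodes.length + G.edges.length + 2) ≤
    (40 + 4 * stepBound) * (T.length + σ + 1) := by omega
  have hS : 8 * (G.nodes.length + G.edges.length + 2) ≤
    (40 + 4 * stepBound) * cdawgSize T := by omega
  have hsink : (G.out (cdawgRoot T)).length ≠ 0 := fun h =>
    hT.out_ne_nil (OrderedCDAWG.root_mem T) hT.root_ne_sink
      (G.isOutList _ (OrderedCDAWG.root_mem T)) (List.length_eq_zero_iff.1 h)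
  obtain ⟨ems, hwalk, hout⟩ := G.exists_walk (W := (40 + 4 * stepBound) * (T.length + σ + 1))
    (S := (40 + 4 * stepBound) * cdawgSize T) hT hσ (by omega) (by omega) hW hS hrec
    (OrderedCDAWG.root_mem T)
  rw [if_neg hsink, List.nil_append] at hout
  have htotal : runTotal ems = T.length := by
    rw [← runTotal_rlbwt, hout, runTotal_addRuns]
    simp [runTotal]
  have hnil : addRuns [] ems ≠ [] := by
    rw [← hout]
    intro h
    have := runTotal_rlbwt T
    rw [h] at this
    simp [runTotal] at this
    omega
  obtain ⟨s, t, hexec, ht, hs, hlog⟩ := runs_recRBWTProgram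
    (G.numIndex (W := (40 + 4 * stepBound) * (T.length + σ + 1))
      (S := (40 + 4 * stepBound) * cdawgSize T) hT hσ (by omega) (by omega) hW hS)
    (ems := ems) (L := tr.map G.edgeId)
    (by
      change Walk _ (G.outStart (G.nodeId (cdawgRoot T))) (G.outStart (G.nodeId (cdawgRoot T)) +
        (G.out (G.nodeAt (G.nodeId (cdawgRoot T)))).length) _ _
      rwa [G.nodeAt_nodeId (OrderedCDAWG.root_mem T)])
    (by rw [List.length_map, ← hE]; exact le_rfl) (by rw [htotal]; omega) hnil
  refine ⟨s, t, hexec, ?_, by rw [hs, hout]; rfl, hlog⟩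
  refine ht.trans ?_
  change stepBound * (G.nodes.length + G.edges.length + 1) ≤ _
  calc stepBound * (G.nodes.length + G.edges.length + 1) ≤ stepBound * (4 * cdawgSize T) :=
        Nat.mul_le_mul_left _ (by omega)
    _ = 4 * stepBound * cdawgSize T := by ring
    _ ≤ _ := Nat.mul_le_mul_right _ (by omega)
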